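/- All graphs are finite and have no loops, but may have parallel edges; for a graph $G$ let $V_k(G)$ be the set of its vertices of degree $k$. A cycle is a connected 2-regular graph (so two parallel edges form a cycle), and the girth of a graph is the least number of edges of a cycle contained in it ($\infty$ if there is none). For an edge set $F$ of $G$, $G\setminus F$ denotes the graph obtained from $G$ by deleting the edges in $F$ (and keeping all vertices); for a vertex set $S$, $G-S$ denotes the graph obtained by deleting the vertices in $S$ and all edges incident with them. Let $\mathcal{S}_{2,3}$ be the class of connected graphs $G$ in which every vertex has degree 2 or 3 and for which $G\setminus E(C)$ is disconnected for every cycle $C\subseteq G$. The 2-Decomposition Conjecture states that the edge set of every $G\in\mathcal{S}_{2,3}$ can be partitioned into the edge set of a spanning tree of $G$ and a (possibly empty) matching of $G$. A counterexample is a graph $G\in\mathcal{S}_{2,3}$ that has no such partition; it is a minimum counterexample if $|V(G)|+|E(G)|$ is minimum among all counterexamples. Theorem 1.4. Every minimum counterexample $G$ to the 2-Decomposition Conjecture satisfies the following properties: 1. $G$ is simple and 2-edge-connected (that is, $G$ has at least two vertices and $G\setminus F$ is connected for every set $F$ of at most one edge); 2. the girth of $G$ is at least 5; 3. any two distinct vertices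 in $V_2(G)$ are at distance at least 3 in $G$; 4. $G-V_2(G)$ is connected (in particular it has a vertex); 5. there is a cycle $C\subseteq G$ with $V(C)\subseteq V_3(G)$. -/

import Mathlib

/-! Graphs are Mathlib's multigraphs `Graph α β` (vertex set in `α`, edge set in `β`, parallel
edges allowed).  All graphs to which the notions below are applied are finite and loopless. -/

namespace Graph

universe u v

variable {α : Type u} {β : Type v}

/-- The degree of a vertex of a finite loopless graph: the number of edges incident with it. -/
noncomputable def degree (G : Graph α β) (x : α) : ℕ := (G.incidenceSet x).ncard

/-- `G.verticesOfDegree k` is the set `V_k(G)` of the vertices of degree `k`. -/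
def verticesOfDegree (G : Graph α β) (k : ℕ) : Set α := {x | x ∈ V(G) ∧ G.degree x = k}

/-- A graph is connected if it has a vertex and any two of its vertices are joined by a walk. -/
def IsConnected (G : Graph α β) : Prop :=
  V(G).Nonempty ∧ ∀ x ∈ V(G), ∀ y ∈ V(G), Relation.ReflTransGen G.Adj x y

/-- A cycle is a finite connected loopless 2-regular graph.  Two parallel edges form a cycle. -/
structure IsCycle (C : Graph α β) : Prop where
  finite : V(C).Finite
  loopless : C.Loopless
  connected : C.IsConnected
  degree_eq_two : ∀ x ∈ V(C), C.degree x = 2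

/-- A (loopless) graph is acyclic if no subgraph of it is a cycle. -/
def IsAcyclic (G : Graph α β) : Prop := ∀ C : Graph α β, C ≤ G → ¬ C.IsCycle

/-- A tree is a connected acyclic (loopless) graph. -/
structure IsTree (T : Graph α β) : Prop where
  connected : T.IsConnected
  acyclic : T.IsAcyclic

/-- A matching of `G`: a set of edges of `G`, no two of which share an end. -/
def IsMatching (G : Graph α β) (M : Set β) : Prop :=
  M ⊆ E(G) ∧ ∀ e ∈ M, ∀ f ∈ M, ∀ x, G.Inc e x → G.Inc f x → e = f

/-- `G` can be decomposed into a spanning tree and a matching: the edge set of `G` is the disjoint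
union of the edge set of a spanning tree `T` of `G` and a (possibly empty) matching `M` of `G`. -/
def HasTwoDecomposition (G : Graph α β) : Prop :=
  ∃ (T : Graph α β) (M : Set β), T ≤s G ∧ T.IsTree ∧ G.IsMatching M ∧
    Disjoint E(T) M ∧ E(T) ∪ M = E(G)

/-- `G` belongs to the class `S_{p,q}`: `G` is a finite loopless connected graph, every cycle `C`
of `G` is separating (deleting the edges of `C` from `G` leaves a disconnected graph), and every
vertex of `G` has degree at least `p` and at most `q`. -/
structure IsSepCycle (p q : ℕ) (G : Graph α β) : Prop where
  finite_vertexSet : V(G).Finite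
  finite_edgeSet : E(G).Finite
  loopless : G.Loopless
  connected : G.IsConnected
  separating : ∀ C : Graph α β, C ≤ G → C.IsCycle → ¬ (G.deleteEdges E(C)).IsConnected
  le_degree : ∀ x ∈ V(G), p ≤ G.degree x
  degree_le : ∀ x ∈ V(G), G.degree x ≤ q

/-- A counterexample to the 2-Decomposition Conjecture. -/
def IsCounterexample (G : Graph α β) : Prop := G.IsSepCycle 2 3 ∧ ¬ G.HasTwoDecomposition

/-- `φ(G) = |V(G)| + |E(G)|` for a finite graph `G`. -/
noncomputable def phi (G : Graph α β) : ℕ := V(G).ncard + E(G).ncard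

/-- A minimum counterexample to the 2-Decomposition Conjecture: a counterexample that minimises
`φ` among all counterexamples, on arbitrary vertex and edge types.  (Every finite graph has a copy
in every pair of universes, so fixing the universes loses nothing.) -/
def IsMinimumCounterexample (G : Graph α β) : Prop :=
  G.IsCounterexample ∧
    ∀ (α' : Type u) (β' : Type v) (H : Graph α' β'), H.IsCounterexample → G.phi ≤ H.phi

/-- `G` is `k`-edge-connected: it has at least two vertices, and deleting fewer than `k` edges
leaves a connected graph. -/
def IsEdgeConnected (k : ℕ) (G : Graph α β) : Prop :=
  V(G).Nontrivial ∧ ∀ F : Set β, F ⊆ E(G) → F.encard < k → (G.deleteEdges F).IsConnected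

/-- The girth of a graph: the least number of edges of a cycle, `⊤` if there is no cycle. -/
noncomputable def girth (G : Graph α β) : ℕ∞ :=
  ⨅ (C : Graph α β) (_ : C ≤ G ∧ C.IsCycle), E(C).encard

/-- `p` is the vertex sequence of a path of `G` from `x` to `y`: its entries are distinct vertices
and consecutive entries are adjacent. -/
structure IsPathBetween (G : Graph α β) (x y : α) (p : List α) : Prop where
  mem : ∀ z ∈ p, z ∈ V(G)
  nodup : p.Nodup
  chain : p.IsChain G.Adj
  head : p.head? = some x
  last : p.getLast? = some y

/-- The distance of two vertices: the least number of edges of a path between them,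
`⊤` if there is no such path. -/
noncomputable def dist (G : Graph α β) (x y : α) : ℕ∞ :=
  ⨅ (p : List α) (_ : G.IsPathBetween x y p), ((p.length - 1 : ℕ) : ℕ∞)

end Graph

/-! A decomposition amounts to a matching `M` whose removal leaves a connected graph with one edge
fewer than vertices (`IsCotreeMatching`), so acyclicity turns into a count. Connectivity is tested
throughout by saturated predicates: a nonempty graph is connected exactly when every predicate that
is constant along edges is constant on the vertices. Surgery on graphs then reduces to chaining
equivalences along a few explicit edges. Likewise a cycle enters mainly through its edge set being
leafless; any nonempty finite leafless edge set contains a cycle, so in the class its deletion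
disconnects the graph.

The engine is minimality. If a smaller graph `H`, made from `G` by `rewire`, lies in the class, then
`H` has a cotree matching, and lifting it to `G` is a contradiction. New edges reuse names of
removed ones, so a matching of `H` is almost a matching of `G`. For membership of `H` only the
cycles through new edges matter (`IsSepCycle.rewire`); one through a vertex of degree two is
separating because its deletion isolates that vertex.

Suppressing a vertex of degree two always admits a lift, so it must leave the class. Hence the
suppressed graph has a non-separating cycle through the new edge, all of whose vertices have degree
three (`exists_isCycle_suppress`). The rest of this cycle joins the two neighbours inside `G - V_2`.
This yields connectivity of `G - V_2`, and it excludes bridges with an end of degree two. For any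
other bridge, decompositions of the two sides combine (`isBridgeless`).

Bridgelessness excludes parallel edges, and triangles of vertices of degree three: deleting such a
cycle would leave a vertex whose third edge is a bridge. Four configurations remain, each with its
own reduction: two vertices of degree two with a common neighbour (`IsCherry`), a triangle (`IsTip`)
or a square (`IsSquareTip`) with a vertex of degree two, and a square of vertices of degree three.
In the last case deleting the square splits its vertices two against two, and new edges are placed
across that cut (`IsSeparatedSquare`). This gives the distance and girth bounds.

If finally no cycle lay within `V_3`, then `G - V_2` would be a tree. Putting one edge at each
vertex of degree two into the matching and the other into the tree would decompose `G`. -/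

open Set

namespace Graph

section


variable {α β : Type*} {G H : Graph α β} {P : α → Prop} {x y z u v w a b : α} {e f g : β}
  {D M : Set β}

/-! ### Connectivity through saturated predicates -/

/-- A predicate on vertices is saturated if it does not separate the ends of any edge. -/
def IsSaturated (G : Graph α β) (P : α → Prop) : Prop :=
  ∀ ⦃e x y⦄, G.IsLink e x y → (P x ↔ P y)

lemma isSaturated_of_imp (h : ∀ e x y, G.IsLink e x y → P x → P y) : G.IsSaturated P :=
  fun e x y hxy ↦ ⟨h e x y hxy, h e y x hxy.symm⟩

lemma IsSaturated.mono (h : G.IsSaturated P) (hle : H ≤ G) : H.IsSaturated P :=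
  fun _ _ _ hl ↦ h (hl.mono hle)

lemma IsConnected.iff_of_isSaturated (hG : G.IsConnected) (hP : G.IsSaturated P)
    (hx : x ∈ V(G)) (hy : y ∈ V(G)) : P x ↔ P y := by
  have h := hG.2 x hx y hy
  induction h with
  | refl => rfl
  | @tail b c hb hbc ih =>
    obtain ⟨e, he⟩ := hbc
    exact (ih he.left_mem).trans (hP he)

/-- Reachability from a fixed vertex is itself saturated, so no walk has to be built. -/
lemma isConnected_of_isSaturated (hne : V(G).Nonempty)
    (h : ∀ P : α → Prop, G.IsSaturated P → ∀ x ∈ V(G), ∀ y ∈ V(G), P x → P y) :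
    G.IsConnected :=
  ⟨hne, fun x hx y hy ↦ h (Relation.ReflTransGen G.Adj x)
    (isSaturated_of_imp fun _ _ _ hl hx ↦ hx.tail ⟨_, hl⟩) x hx y hy .refl⟩

lemma exists_isSaturated_of_not_isConnected (hne : V(G).Nonempty) (h : ¬ G.IsConnected) :
    ∃ P : α → Prop, G.IsSaturated P ∧ ∃ x ∈ V(G), ∃ y ∈ V(G), P x ∧ ¬ P y := by
  contrapose! h
  exact isConnected_of_isSaturated hne fun P hP x hx y hy ↦ h P hP x hx y hy

lemma not_isConnected_of_isSaturated (hP : G.IsSaturated P) (hx : x ∈ V(G)) (hy : y ∈ V(G))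
    (hPx : P x) (hPy : ¬ P y) : ¬ G.IsConnected :=
  fun h ↦ hPy ((h.iff_of_isSaturated hP hx hy).1 hPx)

/-! ### Double counting of incidences -/

lemma degree_eq_card_filter (hE : E(G).Finite) (x : α) [DecidablePred (G.Inc · x)] :
    G.degree x = (hE.toFinset.filter (G.Inc · x)).card := by
  rw [degree, ← ncard_coe_finset]
  congr 1
  ext e
  simpa using Inc.edge_mem

lemma sum_degree_eq_sum_card [∀ e x, Decidable (G.Inc e x)] (hE : E(G).Finite) (S : Finset α) :
    ∑ x ∈ S, G.degree x = ∑ e ∈ hE.toFinset, (S.filter (G.Inc e ·)).card := by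
  simp_rw [degree_eq_card_filter hE]
  exact (Finset.sum_card_bipartiteAbove_eq_sum_card_bipartiteBelow (fun e x ↦ G.Inc e x)).symm

lemma IsLink.filter_inc [DecidableEq α] [∀ e x, Decidable (G.Inc e x)] (h : G.IsLink e x y)
    (S : Finset α) : S.filter (G.Inc e ·) = S.filter (fun z ↦ z = x ∨ z = y) := by
  ext z
  simp only [Finset.mem_filter, and_congr_right_iff]
  exact fun _ ↦ ⟨fun hz ↦ hz.eq_or_eq_of_isLink h,
    by rintro (rfl | rfl); exacts [h.inc_left, h.inc_right]⟩

lemma sum_degree [G.Loopless] (hV : V(G).Finite) (hE : E(G).Finite) :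
    ∑ x ∈ hV.toFinset, G.degree x = 2 * E(G).ncard := by
  classical
  rw [sum_degree_eq_sum_card hE, ncard_eq_toFinset_card _ hE, mul_comm, ← smul_eq_mul,
    ← Finset.sum_const]
  refine Finset.sum_congr rfl fun e he ↦ ?_
  obtain ⟨x, y, h⟩ := exists_isLink_of_mem_edgeSet (hE.mem_toFinset.1 he)
  rw [h.filter_inc, ← Finset.card_pair h.ne]
  congr 1
  ext z
  have := h.left_mem
  have := h.right_mem
  simp
  grind

lemma ncard_le_ncard_edgeSet [G.Loopless] (hV : V(G).Finite) (hE : E(G).Finite)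
    (h : ∀ x ∈ V(G), 2 ≤ G.degree x) : V(G).ncard ≤ E(G).ncard := by
  have h1 : ∑ x ∈ hV.toFinset, 2 ≤ ∑ x ∈ hV.toFinset, G.degree x :=
    Finset.sum_le_sum fun x hx ↦ h x (hV.mem_toFinset.1 hx)
  rw [sum_degree hV hE, Finset.sum_const, ← ncard_eq_toFinset_card _ hV, smul_eq_mul] at h1
  omega

lemma incidenceSet_finite (hE : E(G).Finite) (x : α) : (G.incidenceSet x).Finite :=
  hE.subset (G.incidenceSet_subset_edgeSet x)

/-! ### Cycles -/

lemma IsCycle.finite_edgeSet {C : Graph α β} (hC : C.IsCycle) : E(C).Finite := by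
  refine (hC.finite.biUnion (t := fun x ↦ C.incidenceSet x) fun x hx ↦
    finite_of_ncard_ne_zero ?_).subset fun e he ↦ ?_
  · have := hC.degree_eq_two x hx
    rw [degree] at this
    omega
  · obtain ⟨x, y, h⟩ := exists_isLink_of_mem_edgeSet he
    exact mem_biUnion h.left_mem h.inc_left

lemma IsCycle.ncard_eq {C : Graph α β} (hC : C.IsCycle) : V(C).ncard = E(C).ncard := by
  have := hC.loopless
  have h := sum_degree hC.finite hC.finite_edgeSet
  rw [Finset.sum_congr rfl (g := fun _ ↦ 2)
    fun x hx ↦ hC.degree_eq_two x (hC.finite.mem_toFinset.1 hx), Finset.sum_const,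
    ← ncard_eq_toFinset_card _ hC.finite, smul_eq_mul] at h
  omega

/-- A cycle does not cross a vertex bipartition exactly once. -/
lemma IsCycle.exists_crossing_ne {C : Graph α β} (hC : C.IsCycle) (he : C.IsLink e x y)
    (hx : P x) (hy : ¬ P y) : ∃ f x' y', f ≠ e ∧ C.IsLink f x' y' ∧ P x' ∧ ¬ P y' := by
  classical
  by_contra! hcon
  have := hC.loopless
  set S := hC.finite.toFinset.filter P with hS
  -- Parity: the degrees on the `P`-side have an even sum, to which `e` contributes 1 and every edge
  -- that does not cross contributes 0 or 2.
  have h1 : ∑ z ∈ S, C.degree z = S.card * 2 := by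
    rw [← smul_eq_mul, ← Finset.sum_const]
    exact Finset.sum_congr rfl fun z hz ↦ hC.degree_eq_two z (by simp_all)
  rw [sum_degree_eq_sum_card hC.finite_edgeSet,
    ← Finset.add_sum_erase _ _ (hC.finite_edgeSet.mem_toFinset.2 he.edge_mem)] at h1
  have h2 : (S.filter (C.Inc e ·)).card = 1 := by
    rw [he.filter_inc, Finset.card_eq_one]
    refine ⟨x, ?_⟩
    ext z
    have := he.left_mem
    simp [hS]
    grind
  have h3 : 2 ∣ ∑ f ∈ hC.finite_edgeSet.toFinset.erase e, (S.filter (C.Inc f ·)).card := by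
    refine Finset.dvd_sum fun f hf ↦ ?_
    simp only [Finset.mem_erase, Finite.mem_toFinset] at hf
    obtain ⟨x', y', h⟩ := exists_isLink_of_mem_edgeSet hf.2
    rw [h.filter_inc]
    have hxy := hcon f x' y' hf.1 h
    have hyx := hcon f y' x' hf.1 h.symm
    have hxV := h.left_mem
    have hyV := h.right_mem
    by_cases hP : P x'
    · have : S.filter (fun z ↦ z = x' ∨ z = y') = {x', y'} := by
        ext z
        simp [hS]
        grind
      rw [this, Finset.card_pair h.ne]
    · have : S.filter (fun z ↦ z = x' ∨ z = y') = ∅ := by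
        ext z
        simp [hS]
        grind
      simp [this]
  omega

/-- A cycle minus an edge is connected: an edge crossing the bipartition comes with a second one,
and at most one of the two is `e`. -/
lemma IsCycle.iff_of_isSaturated_deleteEdges {C : Graph α β} (hC : C.IsCycle)
    (hP : (C.deleteEdges {e}).IsSaturated P) (hx : x ∈ V(C)) (hy : y ∈ V(C)) : P x ↔ P y := by
  refine hC.connected.iff_of_isSaturated (isSaturated_of_imp fun f a b hf ha ↦ ?_) hx hy
  by_contra hb
  obtain ⟨f', a', b', hne, hf', ha', hb'⟩ := hC.exists_crossing_ne hf ha hb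
  have h1 : f = e := by
    by_contra h
    exact hb ((hP (e := f) (by simp [hf, h])).1 ha)
  exact hb' ((hP (e := f') (by simp [hf', h1 ▸ hne])).1 ha')

/-! ### Edge counts -/

/-- In a connected graph, every vertex set `S` needs at least `|V \ S|` edges to be extended to
a connected spanning graph. -/
lemma IsConnected.ncard_add_ncard_le (hG : G.IsConnected) (hV : V(G).Finite) (hE : E(G).Finite)
    {S : Set α} (hS : S.Nonempty) (hSV : S ⊆ V(G)) (hD : D ⊆ E(G))
    (hDS : ∀ e ∈ D, ∀ x, G.Inc e x → x ∈ S) : V(G).ncard + D.ncard ≤ E(G).ncard + S.ncard := by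
  induction hn : (V(G) \ S).ncard generalizing S D with
  | zero =>
    rw [ncard_eq_zero (hV.subset sdiff_subset), sdiff_eq_empty] at hn
    rw [hSV.antisymm hn, add_comm]
    exact Nat.add_le_add_right (ncard_le_ncard hD hE) _
  | succ n ih =>
    obtain ⟨y, hyV, hyS⟩ : (V(G) \ S).Nonempty := nonempty_of_ncard_ne_zero (by omega)
    obtain ⟨x, hx⟩ := hS
    obtain ⟨e, x', y', he, hx', hy'⟩ : ∃ e x' y', G.IsLink e x' y' ∧ x' ∈ S ∧ y' ∉ S := by
      by_contra! hcon
      exact hyS ((hG.iff_of_isSaturated (P := (· ∈ S)) (isSaturated_of_imp hcon)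
        (hSV hx) hyV).1 hx)
    have heD : e ∉ D := fun h ↦ hy' (hDS e h _ he.inc_right)
    have h1 := @ih (insert e D) (insert y' S) (insert_nonempty _ _)
      (insert_subset he.right_mem hSV) (insert_subset he.edge_mem hD) (by
        rintro f (rfl | hf) z hz
        · obtain rfl | rfl := hz.eq_or_eq_of_isLink he <;> simp [hx']
        · exact mem_insert_of_mem _ (hDS f hf z hz)) (by
        have : V(G) \ insert y' S = (V(G) \ S) \ {y'} := by ext; simp; tauto
        rw [this, ncard_sdiff_singleton_of_mem (mem_sdiff_of_mem he.right_mem hy'), hn,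
          Nat.add_sub_cancel])
    rw [ncard_insert_of_notMem heD (hE.subset hD),
      ncard_insert_of_notMem hy' (hV.subset hSV)] at h1
    omega

/-- A cycle has as many edges as vertices; extending it to a connected spanning graph costs one edge
per further vertex, which exceeds the supply. -/
lemma IsConnected.isAcyclic_of_ncard (hG : G.IsConnected) (hV : V(G).Finite) (hE : E(G).Finite)
    (h : V(G).ncard = E(G).ncard + 1) : G.IsAcyclic := by
  intro C hC hcyc
  have := hG.ncard_add_ncard_le hV hE (S := V(C)) (D := E(C)) hcyc.connected.1 hC.vertexSet_mono
    hC.edgeSet_mono fun e he x hx ↦ ((hC.inc_congr he).2 hx).vertex_mem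
  rw [hcyc.ncard_eq] at this
  omega

lemma edgeSet_induce_union (hP : G.IsSaturated P) :
    E(G.induce {x ∈ V(G) | P x}) ∪ E(G.induce {x ∈ V(G) | ¬ P x}) = E(G) := by
  ext e
  simp only [edgeSet_induce, mem_union]
  refine ⟨?_, fun he ↦ ?_⟩
  · rintro (⟨x, y, h, -⟩ | ⟨x, y, h, -⟩) <;> exact h.edge_mem
  · obtain ⟨x, y, h⟩ := exists_isLink_of_mem_edgeSet he
    have := hP h
    have := h.left_mem
    have := h.right_mem
    by_cases P x
    · exact .inl ⟨x, y, h, by simp_all⟩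
    · exact .inr ⟨x, y, h, by simp_all⟩

/-- Induction on the size. Removing a vertex of degree at most one, removing a surplus edge, or
passing to a suitable side of a disconnected graph preserves the inequality. If none of these
applies, the graph is connected with all degrees at least two and as many edges as vertices, so it
is 2-regular. -/
lemma exists_isCycle_of_ncard_le [G.Loopless] (hV : V(G).Finite) (hE : E(G).Finite)
    (hne : V(G).Nonempty) (hle : V(G).ncard ≤ E(G).ncard) : ∃ C ≤ G, C.IsCycle := by
  induction hn : V(G).ncard + E(G).ncard using Nat.strong_induction_on generalizing G with
  | _ n ih =>
  have step : ∀ H ≤ G, V(H).Nonempty → V(H).ncard ≤ E(H).ncard →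
      V(H).ncard + E(H).ncard < n → ∃ C ≤ G, C.IsCycle := by
    intro H hHG hne hle hlt
    have : H.Loopless := Loopless.anti hHG
    obtain ⟨C, hC, h⟩ := ih _ hlt (hV.subset hHG.vertexSet_mono) (hE.subset hHG.edgeSet_mono)
      hne hle rfl
    exact ⟨C, hC.trans hHG, h⟩
  have hVpos : 0 < V(G).ncard := (ncard_pos hV).2 hne
  by_cases hdeg : ∀ x ∈ V(G), 2 ≤ G.degree x
  swap
  · push Not at hdeg
    obtain ⟨x, hx, hd⟩ := hdeg
    have hE' : E(G) \ G.incidenceSet x ⊆ E(G.deleteVerts {x}) := by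
      rintro e ⟨he, hex⟩
      obtain ⟨y, z, h⟩ := exists_isLink_of_mem_edgeSet he
      rw [edgeSet_deleteVerts]
      refine ⟨y, z, h, ?_, ?_⟩
      · rintro rfl
        exact hex h.inc_left
      · rintro rfl
        exact hex h.inc_right
    have h1 := ncard_le_ncard hE' (hE.subset deleteVerts_le.edgeSet_mono)
    have h2 := le_ncard_sdiff (G.incidenceSet x) E(G) (incidenceSet_finite hE x)
    rw [degree] at hd
    have h3 : V(G.deleteVerts {x}).ncard = V(G).ncard - 1 := by
      rw [vertexSet_deleteVerts, ncard_sdiff_singleton_of_mem hx]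
    have h4 := ncard_le_ncard (G.deleteVerts_le (X := {x})).edgeSet_mono hE
    refine step (G.deleteVerts {x}) deleteVerts_le ?_ (by omega) (by omega)
    -- A vertex other than `x` exists because the inequality forces an edge, which is not a loop.
    obtain ⟨y, hy, hyx⟩ := (vertexSet_nontrivial_of_edgeSet_nonempty_of_loopless (G := G)
      (nonempty_of_ncard_ne_zero (by omega))).exists_ne x
    exact ⟨y, by simp [hy, hyx]⟩
  by_cases hlt : V(G).ncard < E(G).ncard
  · obtain ⟨e, he⟩ : E(G).Nonempty := nonempty_of_ncard_ne_zero (by omega)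
    have : E(G.deleteEdges {e}).ncard = E(G).ncard - 1 := by
      rw [edgeSet_deleteEdges, ncard_sdiff_singleton_of_mem he]
    exact step (G.deleteEdges {e}) deleteEdges_le (by simpa) (by simp at *; omega)
      (by simp at *; omega)
  by_cases hcon : G.IsConnected
  · refine ⟨G, le_rfl, hV, ‹_›, hcon, fun x hx ↦ ?_⟩
    by_contra hxd
    have h1 : ∑ x ∈ hV.toFinset, 2 < ∑ x ∈ hV.toFinset, G.degree x :=
      Finset.sum_lt_sum (fun x hx ↦ hdeg x (hV.mem_toFinset.1 hx))
        ⟨x, hV.mem_toFinset.2 hx, lt_of_le_of_ne (hdeg x hx) (Ne.symm hxd)⟩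
    rw [sum_degree hV hE, Finset.sum_const, ← ncard_eq_toFinset_card _ hV, smul_eq_mul] at h1
    omega
  · obtain ⟨P, hP, x, hx, y, hy, hPx, hPy⟩ := exists_isSaturated_of_not_isConnected hne hcon
    have h1 := ncard_union_le E(G.induce {x ∈ V(G) | P x}) E(G.induce {x ∈ V(G) | ¬ P x})
    rw [edgeSet_induce_union hP] at h1
    have h2 : V(G).ncard = {x ∈ V(G) | P x}.ncard + {x ∈ V(G) | ¬ P x}.ncard := by
      rw [← ncard_union_eq _ (hV.subset (sep_subset _ _)) (hV.subset (sep_subset _ _))]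
      · congr 1
        ext; simp; tauto
      · exact disjoint_left.2 fun z hz hz' ↦ hz'.2 hz.2
    have hle1 : G.induce {x ∈ V(G) | P x} ≤ G := induce_le (sep_subset _ _)
    have hle2 : G.induce {x ∈ V(G) | ¬ P x} ≤ G := induce_le (sep_subset _ _)
    have h3 := ncard_le_ncard hle1.edgeSet_mono hE
    have h4 := ncard_le_ncard hle2.edgeSet_mono hE
    have h5 : 0 < {x ∈ V(G) | P x}.ncard := (ncard_pos (hV.subset (sep_subset _ _))).2 ⟨x, hx, hPx⟩
    have h6 : 0 < {x ∈ V(G) | ¬ P x}.ncard :=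
      (ncard_pos (hV.subset (sep_subset _ _))).2 ⟨y, hy, hPy⟩
    by_cases hc : {x ∈ V(G) | P x}.ncard ≤ E(G.induce {x ∈ V(G) | P x}).ncard
    · exact step _ hle1 ⟨x, hx, hPx⟩ hc (by simp; omega)
    · exact step _ hle2 ⟨y, hy, hPy⟩ (by simp; omega) (by simp; omega)

/-- A nonempty edge set in which no edge has an end that is met by no other edge of the set. -/
structure IsLeafless (G : Graph α β) (D : Set β) : Prop where
  subset : D ⊆ E(G)
  nonempty : D.Nonempty
  exists_ne : ∀ e ∈ D, ∀ x, G.Inc e x → ∃ f ∈ D, f ≠ e ∧ G.Inc f x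

lemma IsCycle.isLeafless {C : Graph α β} (hC : C.IsCycle) (hle : C ≤ G) : G.IsLeafless E(C) where
  subset := hle.edgeSet_mono
  nonempty := by
    obtain ⟨x, hx⟩ := hC.connected.1
    have h := hC.degree_eq_two x hx
    obtain ⟨e, he⟩ : (C.incidenceSet x).Nonempty :=
      nonempty_of_ncard_ne_zero (by rw [degree] at h; omega)
    exact ⟨e, Inc.edge_mem he⟩
  exists_ne e he x hx := by
    replace hx := (hle.inc_congr he).2 hx
    have h := hC.degree_eq_two x hx.vertex_mem
    obtain ⟨f, hf, hne⟩ := exists_ne_of_one_lt_ncard (s := C.incidenceSet x)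
      (by rw [degree] at h; omega) e
    exact ⟨f, Inc.edge_mem hf, hne, Inc.mono hle hf⟩

/-- The subgraph formed by `D` and its ends has minimum degree at least two, hence at least as many
edges as vertices. -/
lemma IsLeafless.exists_isCycle [G.Loopless] (hE : E(G).Finite) (hD : G.IsLeafless D) :
    ∃ C ≤ G, C.IsCycle ∧ E(C) ⊆ D := by
  set H := (G.restrict D).induce {x | ∃ e ∈ D, G.Inc e x} with hH
  have hHG : H ≤ G := by
    refine (induce_le ?_).trans restrict_le
    rintro x ⟨e, -, h⟩
    exact h.vertex_mem
  have hinc : ∀ e x, H.Inc e x ↔ e ∈ D ∧ G.Inc e x := by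
    refine fun e x ↦ ⟨fun ⟨y, hy⟩ ↦ ?_, fun ⟨he, y, hy⟩ ↦ ⟨y, ?_⟩⟩
    · simp only [hH, induce_isLink, restrict_isLink] at hy
      exact ⟨hy.1.1, y, hy.1.2⟩
    · simp only [hH, induce_isLink, restrict_isLink]
      exact ⟨⟨he, hy⟩, ⟨e, he, hy.inc_left⟩, ⟨e, he, hy.inc_right⟩⟩
  have hEH : E(H) ⊆ D := fun e he ↦ by
    obtain ⟨x, y, h⟩ := exists_isLink_of_mem_edgeSet he
    exact ((hinc e x).1 h.inc_left).1
  have : H.Loopless := Loopless.anti hHG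
  have hfE : E(H).Finite := hE.subset hHG.edgeSet_mono
  have hfV : V(H).Finite := by
    refine (hE.biUnion (t := fun e ↦ {x | G.Inc e x}) fun e he ↦ ?_).subset ?_
    · obtain ⟨x, y, h⟩ := exists_isLink_of_mem_edgeSet he
      exact (toFinite {x, y}).subset fun z hz ↦ Inc.eq_or_eq_of_isLink hz h
    · rintro x ⟨e, -, h⟩
      exact mem_biUnion h.edge_mem h
  have hne : V(H).Nonempty := by
    obtain ⟨e, he⟩ := hD.nonempty
    obtain ⟨x, y, h⟩ := exists_isLink_of_mem_edgeSet (hD.subset he)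
    exact ⟨x, e, he, h.inc_left⟩
  obtain ⟨C, hC, hcyc⟩ := exists_isCycle_of_ncard_le hfV hfE hne
    (ncard_le_ncard_edgeSet hfV hfE fun x ⟨e, he, hx⟩ ↦ by
      obtain ⟨f, hf, hfe, hfx⟩ := hD.exists_ne e he x hx
      exact (one_lt_ncard (incidenceSet_finite hfE x)).2
        ⟨f, (hinc _ _).2 ⟨hf, hfx⟩, e, (hinc _ _).2 ⟨he, hx⟩, hfe⟩)
  exact ⟨C, hC.trans hHG, hcyc, hC.edgeSet_mono.trans hEH⟩

/-! ### Decompositions as matchings with a connected complement -/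

/-- A matching whose complement is connected and has the number of edges of a spanning tree. -/
structure IsCotreeMatching (G : Graph α β) (M : Set β) : Prop where
  isMatching : G.IsMatching M
  isConnected : (G.deleteEdges M).IsConnected
  ncard_add_ncard : M.ncard + V(G).ncard = E(G).ncard + 1

lemma IsCotreeMatching.hasTwoDecomposition (hM : G.IsCotreeMatching M) (hV : V(G).Finite)
    (hE : E(G).Finite) : G.HasTwoDecomposition := by
  refine ⟨G.deleteEdges M, M, ⟨deleteEdges_le, rfl⟩, ⟨hM.isConnected, ?_⟩, hM.isMatching, ?_, ?_⟩
  · refine hM.isConnected.isAcyclic_of_ncard hV (hE.subset deleteEdges_le.edgeSet_mono) ?_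
    have h1 := hM.ncard_add_ncard
    have h2 := ncard_sdiff_add_ncard_of_subset hM.isMatching.1 hE
    simp only [vertexSet_deleteEdges, edgeSet_deleteEdges]
    omega
  · simpa using disjoint_sdiff_left
  · simpa using hM.isMatching.1

/-- The tree must be `G` minus `M`. Acyclicity bounds its number of edges from above and
connectivity from below. -/
lemma HasTwoDecomposition.exists_isCotreeMatching [G.Loopless] (h : G.HasTwoDecomposition)
    (hV : V(G).Finite) (hE : E(G).Finite) : ∃ M, G.IsCotreeMatching M := by
  obtain ⟨T, M, hT, hTree, hM, hdisj, hun⟩ := h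
  have : T.Loopless := Loopless.anti hT.le
  have hTV : V(T).Finite := hV.subset hT.le.vertexSet_mono
  have hTE : E(T).Finite := hE.subset hT.le.edgeSet_mono
  obtain rfl : T = G.deleteEdges M := by
    refine (Compatible.of_le_le hT.le deleteEdges_le).ext hT.vertexSet_eq ?_
    rw [edgeSet_deleteEdges, ← hun, union_sdiff_right, hdisj.sdiff_eq_left]
  refine ⟨M, hM, hTree.connected, ?_⟩
  have h1 : E(G.deleteEdges M).ncard + 1 ≤ V(G.deleteEdges M).ncard := by
    by_contra! hcon
    obtain ⟨C, hC, hcyc⟩ := exists_isCycle_of_ncard_le hTV hTE hTree.connected.1 (by omega)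
    exact hTree.acyclic C hC hcyc
  obtain ⟨x, hx⟩ := hTree.connected.1
  have h2 := hTree.connected.ncard_add_ncard_le hTV hTE (S := {x}) (D := ∅)
    (singleton_nonempty x) (by simpa using hx) (by simp) (by simp)
  have h3 := ncard_sdiff_add_ncard_of_subset hM.1 hE
  simp only [vertexSet_deleteEdges, edgeSet_deleteEdges, ncard_singleton, ncard_empty] at h1 h2
  omega

end

section


variable {α β : Type*} {G H N : Graph α β} {P : α → Prop} {x y z u v w a b c d : α}
  {e f g : β} {D M K : Set β} {W : Set α} {p q : ℕ}

/-! ### Separating sets of edges -/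

lemma IsConnected.of_isSpanningSubgraph (h : H.IsConnected) (hHG : H ≤s G) : G.IsConnected := by
  refine isConnected_of_isSaturated (hHG.vertexSet_eq ▸ h.1) fun P hP x hx y hy hPx ↦ ?_
  rw [← hHG.vertexSet_eq] at hx hy
  exact (h.iff_of_isSaturated (hP.mono hHG.le) hx hy).1 hPx

/-- Deleting more edges than those of a cycle inside `D` cannot reconnect the graph. Leafless sets,
unlike cycles, transfer between `G` and a rewired graph without checking connectivity. -/
lemma IsSepCycle.not_isConnected_deleteEdges (hG : G.IsSepCycle p q) (hD : G.IsLeafless D) :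
    ¬ (G.deleteEdges D).IsConnected := by
  have := hG.loopless
  obtain ⟨C, hC, hcyc, hCD⟩ := hD.exists_isCycle hG.finite_edgeSet
  refine fun h ↦ hG.separating C hC hcyc (h.of_isSpanningSubgraph ⟨⟨Subset.rfl, ?_⟩, rfl⟩)
  intro e x y hl
  rw [deleteEdges_isLink] at hl ⊢
  exact ⟨hl.1, fun he ↦ hl.2 (hCD he)⟩

/-- If an edge set contains all edges at a vertex, then it is separating. -/
lemma not_isConnected_deleteEdges_of_incidenceSet_subset (hx : x ∈ V(G)) (hV : V(G).Nontrivial)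
    (hD : G.incidenceSet x ⊆ D) : ¬ (G.deleteEdges D).IsConnected := by
  obtain ⟨y, hy, hyx⟩ := hV.exists_ne x
  refine not_isConnected_of_isSaturated (P := (· = x)) ?_ hx hy rfl hyx
  intro e a b h
  rw [deleteEdges_isLink] at h
  refine iff_of_false ?_ ?_
  · rintro rfl
    exact h.2 (hD h.1.inc_left)
  · rintro rfl
    exact h.2 (hD h.1.inc_right)

lemma IsLeafless.incidenceSet_subset (hD : G.IsLeafless D) (hE : E(G).Finite) (he : e ∈ D)
    (hx : G.Inc e x) (hdeg : G.degree x ≤ 2) : G.incidenceSet x ⊆ D := by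
  obtain ⟨f, hf, hfe, hfx⟩ := hD.exists_ne e he x hx
  have : ({e, f} : Set β) = G.incidenceSet x := by
    refine eq_of_subset_of_ncard_le (pair_subset hx hfx) ?_ (incidenceSet_finite hE x)
    rwa [ncard_pair hfe.symm]
  exact this ▸ pair_subset he hf

lemma IsLeafless.not_isConnected_deleteEdges (hD : G.IsLeafless D) (hE : E(G).Finite)
    (hV : V(G).Nontrivial) (he : e ∈ D) (hx : G.Inc e x) (hdeg : G.degree x ≤ 2) :
    ¬ (G.deleteEdges D).IsConnected :=
  not_isConnected_deleteEdges_of_incidenceSet_subset hx.vertex_mem hV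
    (hD.incidenceSet_subset hE he hx hdeg)

/-! ### Stars of vertices of degree two and three -/

/-- The edges at `u` are exactly `e`, which leads to `v`, and `f`, which leads to `w`. -/
structure IsStarTwo (G : Graph α β) (u : α) (e : β) (v : α) (f : β) (w : α) : Prop where
  ne : e ≠ f
  left : G.IsLink e u v
  right : G.IsLink f u w
  eq_or_eq : ∀ g, G.Inc g u → g = e ∨ g = f

/-- The edges at `u` are exactly `e`, `f` and `g`, leading to `v`, `w` and `x`. -/
structure IsStarThree (G : Graph α β) (u : α) (e : β) (v : α) (f : β) (w : α) (g : β) (x : α) :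
    Prop where
  ne₁₂ : e ≠ f
  ne₁₃ : e ≠ g
  ne₂₃ : f ≠ g
  fst : G.IsLink e u v
  snd : G.IsLink f u w
  trd : G.IsLink g u x
  eq_or_eq : ∀ h, G.Inc h u → h = e ∨ h = f ∨ h = g

lemma IsStarTwo.symm (h : G.IsStarTwo u e v f w) : G.IsStarTwo u f w e v :=
  ⟨h.ne.symm, h.right, h.left, fun g hg ↦ (h.eq_or_eq g hg).symm⟩

lemma IsStarTwo.incidenceSet_eq (h : G.IsStarTwo u e v f w) : G.incidenceSet u = {e, f} := by
  ext g
  refine ⟨h.eq_or_eq g, ?_⟩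
  rintro (rfl | rfl)
  exacts [h.left.inc_left, h.right.inc_left]

lemma IsStarTwo.degree_eq (h : G.IsStarTwo u e v f w) : G.degree u = 2 := by
  rw [degree, h.incidenceSet_eq, ncard_pair h.ne]

lemma IsStarThree.rotate {g : β} (h : G.IsStarThree u e v f w g x) :
    G.IsStarThree u f w g x e v :=
  ⟨h.ne₂₃, h.ne₁₂.symm, h.ne₁₃.symm, h.snd, h.trd, h.fst, fun k hk ↦ by grind [h.eq_or_eq k hk]⟩

lemma IsStarThree.swap {g : β} (h : G.IsStarThree u e v f w g x) :
    G.IsStarThree u f w e v g x :=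
  ⟨h.ne₁₂.symm, h.ne₂₃, h.ne₁₃, h.snd, h.fst, h.trd, fun k hk ↦ by grind [h.eq_or_eq k hk]⟩

lemma IsStarThree.incidenceSet_eq {g : β} (h : G.IsStarThree u e v f w g x) :
    G.incidenceSet u = {e, f, g} := by
  ext k
  refine ⟨h.eq_or_eq k, ?_⟩
  rintro (rfl | rfl | rfl)
  exacts [h.fst.inc_left, h.snd.inc_left, h.trd.inc_left]

lemma IsStarThree.degree_eq {g : β} (h : G.IsStarThree u e v f w g x) : G.degree u = 3 := by
  rw [degree, h.incidenceSet_eq, ncard_eq_three]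
  exact ⟨e, f, g, h.ne₁₂, h.ne₁₃, h.ne₂₃, rfl⟩

lemma IsLink.exists_isStarTwo (he : G.IsLink e u v) (h : G.degree u = 2) :
    ∃ f w, G.IsStarTwo u e v f w := by
  obtain ⟨a, b, hab, hs⟩ := ncard_eq_two.1 h
  have key : ∀ k, G.Inc k u ↔ k = a ∨ k = b := fun k ↦ Set.ext_iff.1 hs k
  obtain rfl | rfl := (key e).1 he.inc_left
  · obtain ⟨w, hw⟩ := (key b).2 (.inr rfl)
    exact ⟨b, w, hab, he, hw, fun k hk ↦ (key k).1 hk⟩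
  · obtain ⟨w, hw⟩ := (key a).2 (.inl rfl)
    exact ⟨a, w, hab.symm, he, hw, fun k hk ↦ ((key k).1 hk).symm⟩

lemma exists_isStarTwo (h : G.degree u = 2) : ∃ e v f w, G.IsStarTwo u e v f w := by
  obtain ⟨e, he⟩ : (G.incidenceSet u).Nonempty :=
    nonempty_of_ncard_ne_zero (by rw [degree] at h; omega)
  obtain ⟨v, hv⟩ := he
  exact ⟨e, v, hv.exists_isStarTwo h⟩

lemma IsLink.exists_isStarThree (he : G.IsLink e u v) (h : G.degree u = 3) :
    ∃ f w g x, G.IsStarThree u e v f w g x := by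
  obtain ⟨a, b, c, hab, hac, hbc, hs⟩ := ncard_eq_three.1 h
  have key : ∀ k, G.Inc k u ↔ k = a ∨ k = b ∨ k = c := fun k ↦ Set.ext_iff.1 hs k
  obtain ⟨a', ha⟩ := (key a).2 (.inl rfl)
  obtain ⟨b', hb⟩ := (key b).2 (.inr (.inl rfl))
  obtain ⟨c', hc⟩ := (key c).2 (.inr (.inr rfl))
  have hst : G.IsStarThree u a a' b b' c c' := ⟨hab, hac, hbc, ha, hb, hc, fun k hk ↦ (key k).1 hk⟩
  obtain rfl | rfl | rfl := (key e).1 he.inc_left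
  · obtain rfl := ha.right_unique he
    exact ⟨_, _, _, _, hst⟩
  · obtain rfl := hb.right_unique he
    exact ⟨_, _, _, _, hst.rotate⟩
  · obtain rfl := hc.right_unique he
    exact ⟨_, _, _, _, hst.rotate.rotate⟩

lemma IsLink.exists_isStarThree_of_ne (he : G.IsLink e u v) (hf : G.IsLink f u w) (hef : e ≠ f)
    (h : G.degree u = 3) : ∃ g x, G.IsStarThree u e v f w g x := by
  obtain ⟨f', w', g', x', hst⟩ := he.exists_isStarThree h
  obtain rfl | rfl | rfl := hst.eq_or_eq f hf.inc_left
  · exact absurd rfl hef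
  · obtain rfl := hst.snd.right_unique hf
    exact ⟨_, _, hst⟩
  · obtain rfl := hst.trd.right_unique hf
    exact ⟨_, _, hst.rotate.rotate.swap⟩

/-! ### Replacing part of a graph -/

/-- Delete the vertices in `W` from `G`, and add the vertices and edges of `N`, where the edges
of `N` replace edges of `G` with the same name. -/
def rewire (G : Graph α β) (W : Set α) (N : Graph α β) : Graph α β where
  vertexSet := (V(G) \ W) ∪ V(N)
  IsLink e x y := (e ∉ E(N) ∧ G.IsLink e x y ∧ x ∉ W ∧ y ∉ W) ∨ N.IsLink e x y
  isLink_symm e _ := ⟨fun x y h ↦ h.imp (fun h ↦ ⟨h.1, h.2.1.symm, h.2.2.2, h.2.2.1⟩) .symm⟩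
  eq_or_eq_of_isLink_of_isLink := by
    rintro e x y v w (h | h) (h' | h')
    · exact h.2.1.left_eq_or_eq h'.2.1
    · exact absurd h'.edge_mem h.1
    · exact absurd h.edge_mem h'.1
    · exact h.left_eq_or_eq h'
  left_mem_of_isLink := by
    rintro e x y (h | h)
    · exact .inl ⟨h.2.1.left_mem, h.2.2.1⟩
    · exact .inr h.left_mem

lemma rewire_isLink : (G.rewire W N).IsLink e x y ↔
    (e ∉ E(N) ∧ G.IsLink e x y ∧ x ∉ W ∧ y ∉ W) ∨ N.IsLink e x y := Iff.rfl

lemma vertexSet_rewire (hN : V(N) ⊆ V(G) \ W) : V(G.rewire W N) = V(G) \ W :=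
  union_eq_self_of_subset_right hN

lemma edgeSet_rewire_subset (hN : E(N) ⊆ E(G)) : E(G.rewire W N) ⊆ E(G) := by
  rintro e ⟨x, y, h | h⟩
  · exact h.2.1.edge_mem
  · exact hN h.edge_mem

lemma edgeSet_rewire (hK : ∀ e, e ∈ K ↔ ∃ x ∈ W, G.Inc e x) (hNK : E(N) ⊆ K) :
    E(G.rewire W N) = (E(G) \ K) ∪ E(N) := by
  ext e
  constructor
  · rintro ⟨x, y, h | h⟩
    · refine .inl ⟨h.2.1.edge_mem, fun heK ↦ ?_⟩
      obtain ⟨z, hz, hez⟩ := (hK e).1 heK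
      obtain rfl | rfl := hez.eq_or_eq_of_isLink h.2.1
      exacts [h.2.2.1 hz, h.2.2.2 hz]
    · exact .inr h.edge_mem
  · rintro (⟨he, heK⟩ | he)
    · obtain ⟨x, y, h⟩ := exists_isLink_of_mem_edgeSet he
      refine ⟨x, y, .inl ⟨fun h ↦ heK (hNK h), h, fun hx ↦ ?_, fun hy ↦ ?_⟩⟩
      · exact heK ((hK e).2 ⟨x, hx, h.inc_left⟩)
      · exact heK ((hK e).2 ⟨y, hy, h.inc_right⟩)
    · obtain ⟨x, y, h⟩ := exists_isLink_of_mem_edgeSet he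
      exact ⟨x, y, .inr h⟩

lemma rewire_inc_of_notMem (he : e ∉ E(N)) (h : (G.rewire W N).Inc e x) : G.Inc e x ∧ x ∉ W := by
  obtain ⟨y, h | h⟩ := h
  · exact ⟨⟨y, h.2.1⟩, h.2.2.1⟩
  · exact absurd h.edge_mem he

lemma rewire_inc_iff_of_notMem (he : e ∉ E(N)) (h : e ∈ E(G.rewire W N)) :
    (G.rewire W N).Inc e x ↔ G.Inc e x := by
  refine ⟨fun h ↦ (rewire_inc_of_notMem he h).1, fun hx ↦ ?_⟩
  obtain ⟨a, b, hl⟩ := exists_isLink_of_mem_edgeSet h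
  obtain h' | h' := id hl
  · obtain rfl | rfl := hx.eq_or_eq_of_isLink h'.2.1
    exacts [hl.inc_left, hl.inc_right]
  · exact absurd h'.edge_mem he

lemma rewire_inc_of_mem (he : e ∈ E(N)) : (G.rewire W N).Inc e x ↔ N.Inc e x := by
  refine ⟨?_, fun ⟨y, h⟩ ↦ ⟨y, .inr h⟩⟩
  rintro ⟨y, h | h⟩
  · exact absurd he h.1
  · exact ⟨y, h⟩

lemma incidenceSet_rewire (hK : ∀ e, e ∈ K ↔ ∃ x ∈ W, G.Inc e x) (hNK : E(N) ⊆ K) (x : α) :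
    (G.rewire W N).incidenceSet x = (G.incidenceSet x \ K) ∪ N.incidenceSet x := by
  ext e
  by_cases heN : e ∈ E(N)
  · simp [rewire_inc_of_mem heN, hNK heN]
  have h1 : ¬ N.Inc e x := fun h ↦ heN h.edge_mem
  simp only [mem_incidenceSet, mem_union, mem_sdiff, h1, or_false]
  by_cases he : e ∈ E(G.rewire W N)
  · rw [rewire_inc_iff_of_notMem heN he, iff_self_and]
    rw [edgeSet_rewire hK hNK] at he
    exact fun _ ↦ (he.resolve_right heN).2
  · refine iff_of_false (fun h ↦ he h.edge_mem) fun h ↦ he ?_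
    rw [edgeSet_rewire hK hNK]
    exact .inl ⟨h.1.edge_mem, h.2⟩

lemma Loopless.rewire [G.Loopless] [N.Loopless] (W : Set α) : (G.rewire W N).Loopless where
  not_isLoopAt e x h := by
    obtain h | h := h
    · exact G.not_isLoopAt e x h.2.1
    · exact N.not_isLoopAt e x h

/-- A predicate that is saturated on the part of `G` outside of `W` and on `N`
is saturated on the rewired graph. -/
lemma not_isConnected_rewire_deleteEdges (hG : G.IsSepCycle p q) (hNE : E(N) ⊆ E(G))
    (hNV : V(N) ⊆ V(G) \ W)
    (hgad : ∀ P : α → Prop, (∀ e x y, G.IsLink e x y → x ∈ W → (P x ↔ P y)) →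
      N.IsSaturated P ∧ ∀ x ∈ W, ∃ y ∈ V(G) \ W, (P x ↔ P y))
    (hD : (G.rewire W N).IsLeafless D) (hDN : Disjoint D E(N)) :
    ¬ ((G.rewire W N).deleteEdges D).IsConnected := by
  have hDinc : ∀ e ∈ D, ∀ x, (G.rewire W N).Inc e x ↔ G.Inc e x := fun e he x ↦
    rewire_inc_iff_of_notMem (hDN.notMem_of_mem_left he) (hD.subset he)
  have hDG : G.IsLeafless D := by
    refine ⟨hD.subset.trans (edgeSet_rewire_subset hNE), hD.nonempty, fun e he x hx ↦ ?_⟩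
    obtain ⟨f, hf, hfe, hfx⟩ := hD.exists_ne e he x ((hDinc e he x).2 hx)
    exact ⟨f, hf, hfe, (hDinc f hf x).1 hfx⟩
  obtain ⟨P, hP, x, hx, y, hy, hPx, hPy⟩ := exists_isSaturated_of_not_isConnected
    (G := G.deleteEdges D) hG.connected.1 (hG.not_isConnected_deleteEdges hDG)
  -- The edges of `D` are old edges of the rewired graph, so none of them meets `W`, and `P` is
  -- constant along all edges of `G` at `W`.
  obtain ⟨hPN, hPW⟩ := hgad P fun e a b hl ha ↦ hP (e := e) (by
    rw [deleteEdges_isLink]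
    refine ⟨hl, fun heD ↦ ?_⟩
    exact (rewire_inc_of_notMem (hDN.notMem_of_mem_left heD) ((hDinc e heD a).2 hl.inc_left)).2 ha)
  have hrep : ∀ z ∈ V(G), ∃ z' ∈ V(G.rewire W N), (P z ↔ P z') := by
    intro z hz
    rw [vertexSet_rewire hNV]
    by_cases hzW : z ∈ W
    · exact hPW z hzW
    · exact ⟨z, ⟨hz, hzW⟩, Iff.rfl⟩
  obtain ⟨x', hx', hxx⟩ := hrep x hx
  obtain ⟨y', hy', hyy⟩ := hrep y hy
  refine not_isConnected_of_isSaturated (P := P) ?_ hx' hy' (hxx.1 hPx) (mt hyy.2 hPy)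
  intro e a b hl
  rw [deleteEdges_isLink] at hl
  obtain ⟨h | h, heD⟩ := hl
  · exact hP (e := e) (by rw [deleteEdges_isLink]; exact ⟨h.2.1, heD⟩)
  · exact hPN h

/-- Cycles avoiding `N` are cycles of `G` and are settled uniformly by `hgad`: the removed part
joins the ends of the new edges, and each removed vertex is attached to a surviving one. Each
reduction then only has to treat connectivity, degrees and the cycles through a new edge. -/
lemma IsSepCycle.rewire (hG : G.IsSepCycle 2 3) [N.Loopless] (hNE : E(N) ⊆ E(G))
    (hNV : V(N) ⊆ V(G) \ W) (hconn : (G.rewire W N).IsConnected)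
    (hgad : ∀ P : α → Prop, (∀ e x y, G.IsLink e x y → x ∈ W → (P x ↔ P y)) →
      N.IsSaturated P ∧ ∀ x ∈ W, ∃ y ∈ V(G) \ W, (P x ↔ P y))
    (hdeg : ∀ x ∈ V(G) \ W, 2 ≤ (G.rewire W N).degree x ∧ (G.rewire W N).degree x ≤ 3)
    (hsep : ∀ C ≤ G.rewire W N, C.IsCycle → ¬ Disjoint E(C) E(N) →
      ¬ ((G.rewire W N).deleteEdges E(C)).IsConnected) : (G.rewire W N).IsSepCycle 2 3 where
  finite_vertexSet := by
    rw [vertexSet_rewire hNV]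
    exact hG.finite_vertexSet.subset sdiff_subset
  finite_edgeSet := hG.finite_edgeSet.subset (edgeSet_rewire_subset hNE)
  loopless := have := hG.loopless; .rewire W
  connected := hconn
  separating C hC hcyc := by
    by_cases hdisj : Disjoint E(C) E(N)
    · exact not_isConnected_rewire_deleteEdges hG hNE hNV hgad (hcyc.isLeafless hC) hdisj
    · exact hsep C hC hcyc hdisj
  le_degree x hx := (hdeg x (by rwa [vertexSet_rewire hNV] at hx)).1
  degree_le x hx := (hdeg x (by rwa [vertexSet_rewire hNV] at hx)).2

lemma phi_rewire_lt (hV : V(G).Finite) (hE : E(G).Finite) (hNE : E(N) ⊆ E(G))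
    (hNV : V(N) ⊆ V(G) \ W) (hx : x ∈ W) (hxV : x ∈ V(G)) : (G.rewire W N).phi < G.phi := by
  have h1 : V(G.rewire W N).ncard < V(G).ncard := by
    rw [vertexSet_rewire hNV]
    exact ncard_lt_ncard ⟨sdiff_subset, fun h ↦ (h hxV).2 hx⟩ hV
  have h2 := ncard_le_ncard (edgeSet_rewire_subset (W := W) hNE) hE
  rw [phi, phi]
  omega

/-! ### Lifting matchings -/

lemma IsMatching.insert (hM : G.IsMatching M) (he : G.IsLink e x y)
    (hx : ∀ f ∈ M, ¬ G.Inc f x) (hy : ∀ f ∈ M, ¬ G.Inc f y) : G.IsMatching (insert e M) := by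
  refine ⟨insert_subset he.edge_mem hM.1, ?_⟩
  rintro f (rfl | hf) g (rfl | hg) z hfz hgz
  · rfl
  · obtain rfl | rfl := hfz.eq_or_eq_of_isLink he
    exacts [absurd hgz (hx g hg), absurd hgz (hy g hg)]
  · obtain rfl | rfl := hgz.eq_or_eq_of_isLink he
    exacts [absurd hfz (hx f hf), absurd hfz (hy f hf)]
  · exact hM.2 f hf g hg z hfz hgz

lemma not_inc_insert (he : G.IsLink e x y) (hz : ∀ f ∈ M, ¬ G.Inc f z) (hzx : z ≠ x)
    (hzy : z ≠ y) : ∀ f ∈ insert e M, ¬ G.Inc f z := by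
  rintro f (rfl | hf) h
  · obtain rfl | rfl := h.eq_or_eq_of_isLink he <;> contradiction
  · exact hz f hf h

/-- A name in `E(N)` denotes edges with different ends in the two graphs, so new edges are dropped
here and reinserted with their old ends where needed. -/
lemma IsMatching.sdiff_of_rewire (hM : (G.rewire W N).IsMatching M) (hNE : E(N) ⊆ E(G)) :
    G.IsMatching (M \ E(N)) := by
  refine ⟨fun e he ↦ edgeSet_rewire_subset hNE (hM.1 he.1), fun e he f hf x hex hfx ↦ ?_⟩
  exact hM.2 e he.1 f hf.1 x ((rewire_inc_iff_of_notMem he.2 (hM.1 he.1)).2 hex)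
    ((rewire_inc_iff_of_notMem hf.2 (hM.1 hf.1)).2 hfx)

lemma IsMatching.not_inc_of_mem_rewire (hM : (G.rewire W N).IsMatching M) (hx : x ∈ W) :
    ∀ f ∈ M \ E(N), ¬ G.Inc f x := fun _ hf h ↦
  (rewire_inc_of_notMem hf.2 ((rewire_inc_iff_of_notMem hf.2 (hM.1 hf.1)).2 h)).2 hx

/-- A new edge in the matching reserves both its ends; back in `G` one of these becomes free for
another matching edge. -/
lemma IsMatching.not_inc_of_inc_rewire (hM : (G.rewire W N).IsMatching M) (he : e ∈ M)
    (heN : N.Inc e x) : ∀ f ∈ M \ E(N), ¬ G.Inc f x := by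
  intro f hf h
  have h' := (rewire_inc_iff_of_notMem hf.2 (hM.1 hf.1)).2 h
  obtain rfl := hM.2 e he f hf.1 x ((rewire_inc_of_mem heN.edge_mem).2 heN) h'
  exact hf.2 heN.edge_mem

/-- Lifting connectivity of the complement of a matching from the rewired graph. -/
lemma IsConnected.of_rewire {M' : Set β} (h : ((G.rewire W N).deleteEdges M').IsConnected)
    (hNV : V(N) ⊆ V(G) \ W)
    (hM : ∀ e x y, G.IsLink e x y → e ∉ E(N) → x ∉ W → y ∉ W → e ∉ M' → e ∉ M)
    (hgad : ∀ P : α → Prop, (G.deleteEdges M).IsSaturated P →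
      (∀ e x y, N.IsLink e x y → e ∉ M' → (P x ↔ P y)) ∧
        ∀ x ∈ W, ∃ y ∈ V(G) \ W, (P x ↔ P y)) :
    (G.deleteEdges M).IsConnected := by
  have hV : V((G.rewire W N).deleteEdges M') = V(G) \ W := vertexSet_rewire hNV
  obtain ⟨z, hz⟩ := h.1
  rw [hV] at hz
  refine isConnected_of_isSaturated ⟨z, hz.1⟩ fun P hP x hx y hy hPx ↦ ?_
  obtain ⟨hPN, hPW⟩ := hgad P hP
  have hsat : ((G.rewire W N).deleteEdges M').IsSaturated P := by
    intro e a b hl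
    rw [deleteEdges_isLink] at hl
    obtain ⟨hl | hl, he⟩ := hl
    · exact hP (e := e) (by
        rw [deleteEdges_isLink]
        exact ⟨hl.2.1, hM e a b hl.2.1 hl.1 hl.2.2.1 hl.2.2.2 he⟩)
    · exact hPN e a b hl he
  have hrep : ∀ z ∈ V(G), ∃ z' ∈ V((G.rewire W N).deleteEdges M'), (P z ↔ P z') := by
    intro z hz
    rw [hV]
    by_cases hzW : z ∈ W
    · exact hPW z hzW
    · exact ⟨z, ⟨hz, hzW⟩, Iff.rfl⟩
  obtain ⟨x', hx', hxx⟩ := hrep x hx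
  obtain ⟨y', hy', hyy⟩ := hrep y hy
  exact hyy.2 ((h.iff_of_isSaturated hsat hx' hy').1 (hxx.1 hPx))

/-! ### Minimum counterexamples -/

lemma IsMinimumCounterexample.isSepCycle (hG : G.IsMinimumCounterexample) : G.IsSepCycle 2 3 :=
  hG.1.1

lemma IsMinimumCounterexample.exists_isCotreeMatching (hG : G.IsMinimumCounterexample)
    (hH : H.IsSepCycle 2 3) (hlt : H.phi < G.phi) : ∃ M, H.IsCotreeMatching M := by
  have := hH.loopless
  refine HasTwoDecomposition.exists_isCotreeMatching ?_ hH.finite_vertexSet hH.finite_edgeSet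
  by_contra h
  exact absurd (hG.2 _ _ H ⟨hH, h⟩) (by omega)

lemma IsMinimumCounterexample.not_isCotreeMatching (hG : G.IsMinimumCounterexample) :
    ¬ G.IsCotreeMatching M := fun h ↦
  hG.1.2 (h.hasTwoDecomposition hG.isSepCycle.finite_vertexSet hG.isSepCycle.finite_edgeSet)

lemma IsSepCycle.degree_eq (hG : G.IsSepCycle 2 3) (hx : x ∈ V(G)) :
    G.degree x = 2 ∨ G.degree x = 3 := by
  have := hG.le_degree x hx
  have := hG.degree_le x hx
  omega

lemma IsSepCycle.nontrivial (hG : G.IsSepCycle 2 3) : V(G).Nontrivial := by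
  have := hG.loopless
  obtain ⟨x, hx⟩ := hG.connected.1
  obtain ⟨e, he⟩ : (G.incidenceSet x).Nonempty := by
    refine nonempty_of_ncard_ne_zero ?_
    have := hG.le_degree x hx
    rw [degree] at this
    omega
  exact vertexSet_nontrivial_of_edgeSet_nonempty_of_loopless ⟨e, Inc.edge_mem he⟩

lemma banana_loopless (h : a ≠ b) (F : Set β) : (banana a b F).Loopless where
  not_isLoopAt e x hx := by
    simp at hx
    exact h hx.2.2

end

section


variable {α β : Type*} {G H N : Graph α β} {P Q : α → Prop} {x y z u v w a b c d : α}
  {e f g : β} {D M K : Set β} {W : Set α} {p q : ℕ}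

lemma IsLink.iff_of_iff (h : G.IsLink e a b) (hab : P a ↔ P b) (hxy : G.IsLink e x y) :
    P x ↔ P y := by
  obtain ⟨rfl, rfl⟩ | ⟨rfl, rfl⟩ := h.eq_and_eq_or_eq_and_eq hxy
  exacts [hab, hab.symm]

/-- A predicate on the rewired graph has to be extended to `W` compatibly with all edges of `G`;
connectivity of `G` does the rest. -/
lemma isConnected_rewire (hG : G.IsConnected) (hNV : V(N) ⊆ V(G) \ W)
    (hne : (V(G) \ W).Nonempty)
    (h : ∀ P : α → Prop, (G.rewire W N).IsSaturated P →
      ∃ Q : α → Prop, G.IsSaturated Q ∧ ∀ x ∈ V(G) \ W, (Q x ↔ P x)) :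
    (G.rewire W N).IsConnected := by
  have hV := vertexSet_rewire hNV
  refine isConnected_of_isSaturated (hV ▸ hne) fun P hP x hx y hy hPx ↦ ?_
  rw [hV] at hx hy
  obtain ⟨Q, hQ, hQP⟩ := h P hP
  exact (hQP y hy).1 ((hG.iff_of_isSaturated hQ hx.1 hy.1).1 ((hQP x hx).2 hPx))

/-- A predicate that agrees outside of `W` with a saturated predicate of the rewired graph
is compatible with all edges that do not meet `W`. -/
lemma IsSaturated.iff_of_rewire (hP : (G.rewire W N).IsSaturated P)
    (hK : ∀ e, e ∈ K ↔ ∃ x ∈ W, G.Inc e x) (hNK : E(N) ⊆ K) (hQ : ∀ x ∉ W, Q x ↔ P x)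
    (heK : e ∉ K) (hl : G.IsLink e x y) : Q x ↔ Q y := by
  have hx : x ∉ W := fun h ↦ heK ((hK e).2 ⟨x, h, hl.inc_left⟩)
  have hy : y ∉ W := fun h ↦ heK ((hK e).2 ⟨y, h, hl.inc_right⟩)
  rw [hQ x hx, hQ y hy]
  exact hP (e := e) (.inl ⟨fun h ↦ heK (hNK h), hl, hx, hy⟩)

lemma exists_iff_of_mem_of_notMem (W : Set α) (R P : α → Prop) :
    ∃ Q : α → Prop, (∀ x ∈ W, (Q x ↔ R x)) ∧ ∀ x ∉ W, (Q x ↔ P x) := by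
  classical
  exact ⟨fun x ↦ if x ∈ W then R x else P x, by simp +contextual, by simp +contextual⟩

lemma degree_rewire (hE : E(G).Finite) (hNE : E(N) ⊆ E(G))
    (hK : ∀ e, e ∈ K ↔ ∃ x ∈ W, G.Inc e x) (hNK : E(N) ⊆ K) (x : α) :
    (G.rewire W N).degree x + (G.incidenceSet x ∩ K).ncard = G.degree x + N.degree x := by
  have hx := incidenceSet_finite hE x
  have hNx := incidenceSet_finite (hE.subset hNE) x
  rw [degree, incidenceSet_rewire hK hNK, ncard_union_eq _ (hx.subset sdiff_subset) hNx]
  · have := ncard_inter_add_ncard_sdiff_eq_ncard (G.incidenceSet x) K hx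
    simp only [degree]
    omega
  · exact disjoint_left.2 fun e he he' ↦ he.2 (hNK (Inc.edge_mem he'))

lemma degree_banana_left (a b : α) (f : β) : (banana a b {f}).degree a = 1 := by
  rw [degree, ncard_eq_one]
  exact ⟨f, by ext; simp⟩

lemma degree_banana_right (a b : α) (f : β) : (banana a b {f}).degree b = 1 := by
  rw [banana_comm, degree_banana_left]

lemma degree_banana_of_ne (ha : x ≠ a) (hb : x ≠ b) : (banana a b {f}).degree x = 0 := by
  have : (banana a b {f}).incidenceSet x = ∅ := by ext; simp [ha, hb]
  rw [degree, this, ncard_empty]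

lemma IsCycle.exists_inc {C : Graph α β} (hC : C.IsCycle) (hx : x ∈ V(C)) :
    ∃ e, C.Inc e x := by
  have h := hC.degree_eq_two x hx
  exact nonempty_of_ncard_ne_zero (s := C.incidenceSet x) (by rw [degree] at h; omega)

/-- The cycle uses all edges at `x`, so deleting it isolates `x`. -/
lemma IsCycle.not_isConnected_deleteEdges {C : Graph α β} (hC : C.IsCycle) (hle : C ≤ G)
    (hE : E(G).Finite) (hV : V(G).Nontrivial) (hx : x ∈ V(C)) (hdeg : G.degree x ≤ 2) :
    ¬ (G.deleteEdges E(C)).IsConnected := by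
  obtain ⟨e, he⟩ := hC.exists_inc hx
  exact (hC.isLeafless hle).not_isConnected_deleteEdges hE hV he.edge_mem (he.mono hle) hdeg

/-! ### Suppressing a vertex of degree two -/


lemma IsStarTwo.mem_pair_iff (h : G.IsStarTwo u e v f w) (g : β) :
    g ∈ ({e, f} : Set β) ↔ ∃ x ∈ ({u} : Set α), G.Inc g x := by
  simp only [mem_singleton_iff, exists_eq_left]
  rw [← h.incidenceSet_eq, mem_incidenceSet]

lemma IsStarTwo.degree_rewire [G.Loopless] (h : G.IsStarTwo u e v f w) (hvw : v ≠ w)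
    (hE : E(G).Finite) (hxu : x ≠ u) :
    (G.rewire {u} (banana v w {f})).degree x = G.degree x := by
  have hd := Graph.degree_rewire (W := {u}) (N := banana v w {f}) hE
    (by simpa using h.right.edge_mem) h.mem_pair_iff (by simp) x
  suffices (G.incidenceSet x ∩ {e, f}).ncard = (banana v w {f}).degree x by omega
  by_cases hxv : x = v
  · subst hxv
    rw [degree_banana_left, ncard_eq_one]
    refine ⟨e, ?_⟩
    ext g
    simp only [mem_inter_iff, mem_incidenceSet, mem_insert_iff, mem_singleton_iff]
    refine ⟨?_, fun hg ↦ ⟨hg ▸ h.left.inc_right, .inl hg⟩⟩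
    rintro ⟨hg, rfl | rfl⟩
    · rfl
    · obtain rfl | rfl := hg.eq_or_eq_of_isLink h.right <;> contradiction
  by_cases hxw : x = w
  · subst hxw
    rw [degree_banana_right, ncard_eq_one]
    refine ⟨f, ?_⟩
    ext g
    simp only [mem_inter_iff, mem_incidenceSet, mem_insert_iff, mem_singleton_iff]
    refine ⟨?_, fun hg ↦ ⟨hg ▸ h.right.inc_right, .inr hg⟩⟩
    rintro ⟨hg, rfl | rfl⟩
    · obtain rfl | rfl := hg.eq_or_eq_of_isLink h.left <;> contradiction
    · rfl
  rw [degree_banana_of_ne hxv hxw]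
  convert! ncard_empty β
  ext g
  simp only [mem_inter_iff, mem_incidenceSet, mem_insert_iff, mem_singleton_iff, mem_empty_iff_false,
    iff_false, not_and, not_or]
  refine fun hg ↦ ⟨?_, ?_⟩
  · rintro rfl
    obtain rfl | rfl := hg.eq_or_eq_of_isLink h.left <;> contradiction
  · rintro rfl
    obtain rfl | rfl := hg.eq_or_eq_of_isLink h.right <;> contradiction

/-- In a minimum counterexample, suppressing a vertex of degree two creates a non-separating
cycle, all vertices of which have degree three. -/
lemma IsMinimumCounterexample.exists_isCycle_suppress (hG : G.IsMinimumCounterexample)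
    (h : G.IsStarTwo u e v f w) (hvw : v ≠ w) :
    ∃ C ≤ G.rewire {u} (banana v w {f}), C.IsCycle ∧ f ∈ E(C) ∧ ∀ x ∈ V(C), G.degree x = 3 := by
  by_contra! hcon
  have hS := hG.isSepCycle
  have := hS.loopless
  have hvu : v ≠ u := h.left.ne.symm
  have hwu : w ≠ u := h.right.ne.symm
  have hE := hS.finite_edgeSet
  have := banana_loopless hvw {f}
  have hNE : E(banana v w {f}) ⊆ E(G) := by simpa using h.right.edge_mem
  have hNV : V(banana v w {f}) ⊆ V(G) \ {u} := by
    simp [insert_subset_iff, h.left.right_mem, h.right.right_mem, hvu, hwu]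
  have hvV : v ∈ V(G) \ {u} := ⟨h.left.right_mem, hvu⟩
  have hwV : w ∈ V(G) \ {u} := ⟨h.right.right_mem, hwu⟩
  have hN : (banana v w {f}).IsLink f v w := by simp
  have hH : (G.rewire {u} (banana v w {f})).IsSepCycle 2 3 := by
    refine hS.rewire hNE hNV ?_ ?_ ?_ ?_
    · refine isConnected_rewire hS.connected hNV ⟨v, hvV⟩ fun P hP ↦ ?_
      obtain ⟨Q, hQ, hQP⟩ := exists_iff_of_mem_of_notMem {u} (fun _ ↦ P v) P
      refine ⟨Q, fun g x y hg ↦ ?_, fun x hx ↦ hQP x hx.2⟩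
      have hvw' : P v ↔ P w := hP (.inr hN)
      by_cases hgK : g ∈ ({e, f} : Set β)
      · obtain rfl | rfl := hgK
        · exact h.left.iff_of_iff ((hQ u rfl).trans (hQP v hvu).symm) hg
        · exact h.right.iff_of_iff ((hQ u rfl).trans (hvw'.trans (hQP w hwu).symm)) hg
      · exact hP.iff_of_rewire h.mem_pair_iff (by simp) hQP hgK hg
    · intro P hP
      have h1 := hP e u v h.left rfl
      have h2 := hP f u w h.right rfl
      refine ⟨fun g x y hg ↦ ?_, ?_⟩
      · obtain rfl : g = f := by simpa using hg.edge_mem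
        exact hN.iff_of_iff (h1.symm.trans h2) hg
      · rintro x rfl
        exact ⟨v, hvV, h1⟩
    · rintro x ⟨hx, hxu⟩
      rw [h.degree_rewire hvw hE hxu]
      exact ⟨hS.le_degree x hx, hS.degree_le x hx⟩
    · intro C hC hcyc hdisj
      -- By assumption a cycle through the new edge passes a vertex of degree two, and is therefore
      -- separating.
      have hf : f ∈ E(C) := by simpa using hdisj
      obtain ⟨x, hx, hdx⟩ := hcon C hC hcyc hf
      have hxV := hC.vertexSet_mono hx
      rw [vertexSet_rewire hNV] at hxV
      refine hcyc.not_isConnected_deleteEdges hC (hE.subset (edgeSet_rewire_subset hNE))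
        ?_ hx ?_
      · rw [vertexSet_rewire hNV]
        exact ⟨v, hvV, w, hwV, hvw⟩
      · rw [h.degree_rewire hvw hE hxV.2]
        exact ((hS.degree_eq hxV.1).resolve_right hdx).le
  obtain ⟨M, hM⟩ := hG.exists_isCotreeMatching hH
    (phi_rewire_lt hS.finite_vertexSet hE hNE hNV rfl h.left.left_mem)
  have hM0 := hM.isMatching.sdiff_of_rewire hNE
  rw [edgeSet_banana] at hM0
  have heM : e ∉ M := fun he ↦ by
    have := hM.isMatching.1 he
    rw [edgeSet_rewire h.mem_pair_iff (by simp)] at this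
    simp [h.ne] at this
  -- The same set of names works in `G`: `e` joins the tree, and `f`, now ending at `u` instead of
  -- `v`, stays where it was.
  refine hG.not_isCotreeMatching (M := M) ⟨?_, ?_, ?_⟩
  · by_cases hf : f ∈ M
    · have := hM0.insert h.right (hM.isMatching.not_inc_of_mem_rewire rfl)
        (hM.isMatching.not_inc_of_inc_rewire hf hN.inc_right)
      rwa [insert_sdiff_singleton, insert_eq_of_mem hf] at this
    · rwa [sdiff_singleton_eq_self hf] at hM0
  · refine hM.isConnected.of_rewire hNV (by tauto) fun P hP ↦ ?_
    have h1 : P u ↔ P v := hP (e := e) (by simp [h.left, heM])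
    refine ⟨fun g x y hg hgM ↦ ?_, ?_⟩
    · obtain rfl : g = f := by simpa using hg.edge_mem
      refine hN.iff_of_iff (h1.symm.trans ?_) hg
      exact hP (e := g) (by simp [h.right, hgM])
    · rintro x rfl
      exact ⟨v, hvV, h1⟩
  · have h1 := hM.ncard_add_ncard
    have h2 : E(G.rewire {u} (banana v w {f})) = E(G) \ {e} := by
      rw [edgeSet_rewire h.mem_pair_iff (by simp)]
      have := h.ne
      have := h.right.edge_mem
      ext g
      simp
      grind
    rw [vertexSet_rewire hNV, h2, ncard_sdiff_singleton_of_mem h.left.left_mem,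
      ncard_sdiff_singleton_of_mem h.left.edge_mem] at h1
    have := (ncard_pos hS.finite_vertexSet).2 ⟨u, h.left.left_mem⟩
    have := (ncard_pos hE).2 ⟨e, h.left.edge_mem⟩
    omega

lemma mem_verticesOfDegree {k : ℕ} : x ∈ G.verticesOfDegree k ↔ x ∈ V(G) ∧ G.degree x = k :=
  Iff.rfl

lemma IsMinimumCounterexample.degree_eq_three_of_isStarTwo (hG : G.IsMinimumCounterexample)
    (h : G.IsStarTwo u e v f w) (hvw : v ≠ w) : G.degree v = 3 ∧ G.degree w = 3 := by
  obtain ⟨C, hC, hcyc, hf, hdeg⟩ := hG.exists_isCycle_suppress h hvw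
  have hl : C.IsLink f v w := (hC.isLink_iff hf).2 (.inr (by simp))
  exact ⟨hdeg v hl.left_mem, hdeg w hl.right_mem⟩

/-- The neighbours of a vertex of degree two are joined by a path of vertices of degree three. -/
lemma IsMinimumCounterexample.iff_of_isStarTwo (hG : G.IsMinimumCounterexample)
    (h : G.IsStarTwo u e v f w) (hvw : v ≠ w)
    (hP : (G.deleteVerts (G.verticesOfDegree 2)).IsSaturated P) : P v ↔ P w := by
  obtain ⟨C, hC, hcyc, hf, hdeg⟩ := hG.exists_isCycle_suppress h hvw
  have hl : C.IsLink f v w := (hC.isLink_iff hf).2 (.inr (by simp))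
  refine hcyc.iff_of_isSaturated_deleteEdges (e := f) (fun g x y hg ↦ ?_) hl.left_mem hl.right_mem
  rw [deleteEdges_isLink] at hg
  refine hP (e := g) ?_
  rw [deleteVerts_isLink, mem_verticesOfDegree, mem_verticesOfDegree, hdeg x hg.1.left_mem,
    hdeg y hg.1.right_mem]
  obtain h | h := hC.isLink_mono hg.1
  · simpa using h.2.1
  · exact absurd (by simpa using h.edge_mem) hg.2

/-! ### Bridges -/

/-- A graph is bridgeless if no edge is the only edge between two parts of the vertex set. -/
def IsBridgeless (G : Graph α β) : Prop :=
  ∀ (e : β) (P : α → Prop), (G.deleteEdges {e}).IsSaturated P → G.IsSaturated P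

lemma IsSaturated.iff_of_deleteEdges (hP : (G.deleteEdges {e}).IsSaturated P)
    (hg : G.IsLink g x y) (hge : g ≠ e) : P x ↔ P y :=
  hP (e := g) (by simp [hg, hge])

/-- One side of a bridge of a graph of the class, if the bridge ends there in a vertex of
degree three. -/
lemma IsSepCycle.induce_of_bridge (hG : G.IsSepCycle 2 3) (he : G.IsLink e u v)
    (hP : (G.deleteEdges {e}).IsSaturated P) (hu : P u) (hv : ¬ P v) (hdeg : G.degree u = 3) :
    (G.induce {x ∈ V(G) | P x}).IsSepCycle 2 3 := by
  classical
  have hle : G.induce {x ∈ V(G) | P x} ≤ G := induce_le (sep_subset _ _)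
  have hlink : ∀ g x y, G.IsLink g x y → P x → P y → (G.induce {x ∈ V(G) | P x}).IsLink g x y :=
    fun g x y h hx hy ↦ by simp [h, hx, hy, h.left_mem, h.right_mem]
  have heN : e ∉ E(G.induce {x ∈ V(G) | P x}) := by
    intro h
    have h' := (hle.isLink_iff h).2 he
    exact hv h'.right_mem.2
  have hinc : ∀ x ∈ V(G), P x → (G.induce {x ∈ V(G) | P x}).incidenceSet x =
      G.incidenceSet x \ {e} := by
    intro x hx hPx
    ext g
    refine ⟨fun h ↦ ⟨Inc.mono hle h, ?_⟩, fun ⟨⟨y, h⟩, hge⟩ ↦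
      ⟨y, hlink g x y h hPx ((hP.iff_of_deleteEdges h hge).1 hPx)⟩⟩
    rintro rfl
    exact heN (Inc.edge_mem h)
  refine ⟨hG.finite_vertexSet.subset hle.vertexSet_mono, hG.finite_edgeSet.subset hle.edgeSet_mono,
    have := hG.loopless; Loopless.anti hle, ?_, ?_, ?_, ?_⟩
  · refine isConnected_of_isSaturated ⟨u, he.left_mem, hu⟩ fun Q hQ x hx y hy hQx ↦ ?_
    -- The other side of the bridge takes the value at `u`, so the bridge itself is respected.
    have hsat : G.IsSaturated fun x ↦ if P x then Q x else Q u := by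
      intro g x y hg
      by_cases hge : g = e
      · subst hge
        exact he.iff_of_iff (P := fun x ↦ if P x then Q x else Q u) (by simp [hu, hv]) hg
      · have h1 := hP.iff_of_deleteEdges hg hge
        by_cases hx : P x
        · simp only [hx, h1.1 hx, if_true]
          exact hQ (hlink g x y hg hx (h1.1 hx))
        · simp [hx, mt h1.2 hx]
    have := hG.connected.iff_of_isSaturated hsat hx.1 hy.1
    simp only [hx.2, hy.2, if_true] at this
    exact this.1 hQx
  · intro C hC hcyc hcon
    obtain ⟨Q, hQ, x, hx, y, hy, hQx, hQy⟩ := exists_isSaturated_of_not_isConnected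
      (G := G.deleteEdges E(C)) hG.connected.1 (hG.separating C (hC.trans hle) hcyc)
    -- If this side stayed connected without the cycle, then `Q` would be constant on it and hence
    -- respect the edges of the cycle too.
    have hconst : ∀ z ∈ V(G), P z → (Q z ↔ Q u) := fun z hz hPz ↦
      hcon.iff_of_isSaturated (hQ.mono (deleteEdges_mono_left hle _)) ⟨hz, hPz⟩ ⟨he.left_mem, hu⟩
    have hsat : G.IsSaturated Q := by
      intro g a b hg
      by_cases hgC : g ∈ E(C)
      · have hg' := (hle.isLink_iff (hC.edgeSet_mono hgC)).2 hg
        rw [hconst a hg.left_mem hg'.left_mem.2, hconst b hg.right_mem hg'.right_mem.2]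
      · exact hQ (e := g) (by simp [hg, hgC])
    exact hQy ((hG.connected.iff_of_isSaturated hsat hx hy).1 hQx)
  · rintro x ⟨hx, hPx⟩
    have h1 := hG.le_degree x hx
    rw [degree, hinc x hx hPx]
    by_cases hxu : x = u
    · subst hxu
      rw [ncard_sdiff_singleton_of_mem (s := G.incidenceSet x) he.inc_left]
      rw [degree] at hdeg
      omega
    · rw [sdiff_singleton_eq_self]
      · exact h1
      · intro h
        obtain rfl | rfl := h.eq_or_eq_of_isLink he <;> contradiction
  · rintro x ⟨hx, hPx⟩
    have h1 := hG.degree_le x hx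
    rw [degree, hinc x hx hPx]
    exact (ncard_le_ncard sdiff_subset (incidenceSet_finite hG.finite_edgeSet x)).trans h1

/-- The bridge goes into the tree and joins the spanning trees of the two sides. -/
lemma IsCotreeMatching.union_of_bridge {M₁ M₂ : Set β} (hV : V(G).Finite) (hE : E(G).Finite)
    (he : G.IsLink e u v) (hP : (G.deleteEdges {e}).IsSaturated P) (hu : P u) (hv : ¬ P v)
    (h₁ : (G.induce {x ∈ V(G) | P x}).IsCotreeMatching M₁)
    (h₂ : (G.induce {x ∈ V(G) | ¬ P x}).IsCotreeMatching M₂) :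
    G.IsCotreeMatching (M₁ ∪ M₂) := by
  set G₁ := G.induce {x ∈ V(G) | P x} with hG₁
  set G₂ := G.induce {x ∈ V(G) | ¬ P x} with hG₂
  have hle₁ : G₁ ≤ G := induce_le (sep_subset _ _)
  have hle₂ : G₂ ≤ G := induce_le (sep_subset _ _)
  have hlink : ∀ g x y, G.IsLink g x y → g ≠ e →
      (P x ∧ P y ∧ G₁.IsLink g x y) ∨ (¬ P x ∧ ¬ P y ∧ G₂.IsLink g x y) := by
    intro g x y hg hge
    have := hP.iff_of_deleteEdges hg hge
    simp only [hG₁, hG₂, induce_isLink, mem_sep_iff, hg, hg.left_mem, hg.right_mem, true_and]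
    tauto
  have hinc₁ : ∀ g ∈ M₁, ∀ x, G.Inc g x → G₁.Inc g x ∧ P x := fun g hg x hx ↦ by
    have := (hle₁.inc_congr (h₁.isMatching.1 hg)).2 hx
    exact ⟨this, this.vertex_mem.2⟩
  have hinc₂ : ∀ g ∈ M₂, ∀ x, G.Inc g x → G₂.Inc g x ∧ ¬ P x := fun g hg x hx ↦ by
    have := (hle₂.inc_congr (h₂.isMatching.1 hg)).2 hx
    exact ⟨this, this.vertex_mem.2⟩
  have he₁ : e ∉ E(G₁) := fun h ↦ hv ((hle₁.isLink_iff h).2 he).right_mem.2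
  have he₂ : e ∉ E(G₂) := fun h ↦ ((hle₂.isLink_iff h).2 he).left_mem.2 hu
  have hdisj : Disjoint E(G₁) E(G₂) := by
    refine disjoint_left.2 fun g hg hg' ↦ ?_
    obtain ⟨x, y, h⟩ := exists_isLink_of_mem_edgeSet hg
    exact ((hle₂.isLink_iff hg').2 (h.mono hle₁)).left_mem.2 h.left_mem.2
  have hfE₁ := hE.subset hle₁.edgeSet_mono
  have hfE₂ := hE.subset hle₂.edgeSet_mono
  refine ⟨⟨union_subset (h₁.isMatching.1.trans hle₁.edgeSet_mono)
    (h₂.isMatching.1.trans hle₂.edgeSet_mono), ?_⟩, ?_, ?_⟩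
  · rintro f (hf | hf) g (hg | hg) x hfx hgx
    · exact h₁.isMatching.2 f hf g hg x (hinc₁ f hf x hfx).1 (hinc₁ g hg x hgx).1
    · exact absurd (hinc₁ f hf x hfx).2 (hinc₂ g hg x hgx).2
    · exact absurd (hinc₁ g hg x hgx).2 (hinc₂ f hf x hfx).2
    · exact h₂.isMatching.2 f hf g hg x (hinc₂ f hf x hfx).1 (hinc₂ g hg x hgx).1
  · refine isConnected_of_isSaturated ⟨u, he.left_mem⟩ fun Q hQ x hx y hy hQx ↦ ?_
    have hQe : Q u ↔ Q v := hQ (e := e) (by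
      simp only [deleteEdges_isLink, he, mem_union, true_and, not_or]
      exact ⟨fun h ↦ he₁ (h₁.isMatching.1 h), fun h ↦ he₂ (h₂.isMatching.1 h)⟩)
    have hQ₁ : (G₁.deleteEdges M₁).IsSaturated Q := fun g a b hg ↦ by
      rw [deleteEdges_isLink] at hg
      refine hQ (e := g) ?_
      rw [deleteEdges_isLink]
      refine ⟨hg.1.mono hle₁, ?_⟩
      rintro (h | h)
      · exact hg.2 h
      · exact disjoint_left.1 hdisj hg.1.edge_mem (h₂.isMatching.1 h)
    have hQ₂ : (G₂.deleteEdges M₂).IsSaturated Q := fun g a b hg ↦ by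
      rw [deleteEdges_isLink] at hg
      refine hQ (e := g) ?_
      rw [deleteEdges_isLink]
      refine ⟨hg.1.mono hle₂, ?_⟩
      rintro (h | h)
      · exact disjoint_left.1 hdisj (h₁.isMatching.1 h) hg.1.edge_mem
      · exact hg.2 h
    have key : ∀ z ∈ V(G), (Q z ↔ Q u) := by
      intro z hz
      by_cases hPz : P z
      · exact h₁.isConnected.iff_of_isSaturated hQ₁ ⟨hz, hPz⟩ ⟨he.left_mem, hu⟩
      · rw [hQe]
        exact h₂.isConnected.iff_of_isSaturated hQ₂ ⟨hz, hPz⟩ ⟨he.right_mem, hv⟩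
    exact (key y hy).2 ((key x hx).1 hQx)
  · have hVu : V(G).ncard = V(G₁).ncard + V(G₂).ncard := by
      rw [← ncard_union_eq _ (hV.subset hle₁.vertexSet_mono) (hV.subset hle₂.vertexSet_mono)]
      · congr 1
        ext z
        simp [hG₁, hG₂]
        tauto
      · exact disjoint_left.2 fun z hz hz' ↦ hz'.2 hz.2
    have hEu : E(G).ncard = E(G₁).ncard + E(G₂).ncard + 1 := by
      have : E(G) = insert e (E(G₁) ∪ E(G₂)) := by
        ext g
        refine ⟨fun hg ↦ ?_, ?_⟩
        · obtain ⟨x, y, h⟩ := exists_isLink_of_mem_edgeSet hg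
          by_cases hge : g = e
          · exact .inl hge
          · obtain h | h := hlink g x y h hge
            · exact .inr (.inl h.2.2.edge_mem)
            · exact .inr (.inr h.2.2.edge_mem)
        · rintro (rfl | h | h)
          exacts [he.edge_mem, hle₁.edgeSet_mono h, hle₂.edgeSet_mono h]
      rw [this, ncard_insert_of_notMem (by simp [he₁, he₂]) (hfE₁.union hfE₂),
        ncard_union_eq hdisj hfE₁ hfE₂]
    have hMu := ncard_union_eq (hdisj.mono h₁.isMatching.1 h₂.isMatching.1)
      (hfE₁.subset h₁.isMatching.1) (hfE₂.subset h₂.isMatching.1)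
    have := h₁.ncard_add_ncard
    have := h₂.ncard_add_ncard
    omega

lemma phi_induce_lt (hV : V(G).Finite) (hE : E(G).Finite) (hx : x ∈ V(G)) (hPx : ¬ P x) :
    (G.induce {x ∈ V(G) | P x}).phi < G.phi := by
  have h1 : V(G.induce {x ∈ V(G) | P x}).ncard < V(G).ncard :=
    ncard_lt_ncard ⟨sep_subset _ _, fun h ↦ hPx (h hx).2⟩ hV
  have h2 := ncard_le_ncard (G.induce_le (sep_subset V(G) P)).edgeSet_mono hE
  rw [phi, phi]
  omega

lemma IsSaturated.not (hP : G.IsSaturated P) : G.IsSaturated fun x ↦ ¬ P x :=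
  fun _ _ _ h ↦ not_congr (hP h)

/-- If an end `u` of a bridge had degree two, its neighbours would be joined in `G - V_2`, hence
without using the bridge. So both ends have degree three, both sides are smaller members of the
class, and their matchings combine. -/
lemma IsMinimumCounterexample.isBridgeless (hG : G.IsMinimumCounterexample) :
    G.IsBridgeless := by
  have hS := hG.isSepCycle
  have := hS.loopless
  have hdeg : ∀ e u v, ∀ P : α → Prop, (G.deleteEdges {e}).IsSaturated P → G.IsLink e u v →
      P u → ¬ P v → G.degree u = 3 := by
    intro e u v P hP he hu hv
    refine (hS.degree_eq he.left_mem).resolve_left fun h2 ↦ ?_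
    obtain ⟨f, w, hst⟩ := he.exists_isStarTwo h2
    have hPw : P w := (hP.iff_of_deleteEdges hst.right hst.ne.symm).1 hu
    have hvw : v ≠ w := by rintro rfl; exact hv hPw
    refine hv ((hG.iff_of_isStarTwo hst hvw fun g x y hg ↦ ?_).2 hPw)
    rw [deleteVerts_isLink] at hg
    refine hP.iff_of_deleteEdges hg.1 ?_
    rintro rfl
    obtain rfl | rfl := he.inc_left.eq_or_eq_of_isLink hg.1
    · exact hg.2.1 ⟨he.left_mem, h2⟩
    · exact hg.2.2 ⟨he.left_mem, h2⟩
  intro e P hP f u v hf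
  by_contra hcon
  obtain rfl : f = e := by
    by_contra h
    exact hcon (hP.iff_of_deleteEdges hf h)
  wlog hu : P u generalizing u v
  · exact this hf.symm (by tauto) (by tauto)
  have hv : ¬ P v := by tauto
  have hS₁ := hS.induce_of_bridge hf hP hu hv (hdeg f u v P hP hf hu hv)
  have hS₂ := hS.induce_of_bridge hf.symm hP.not hv (not_not.2 hu)
    (hdeg f v u _ hP.not hf.symm hv (not_not.2 hu))
  obtain ⟨M₁, h₁⟩ := hG.exists_isCotreeMatching hS₁
    (phi_induce_lt hS.finite_vertexSet hS.finite_edgeSet hf.right_mem hv)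
  obtain ⟨M₂, h₂⟩ := hG.exists_isCotreeMatching hS₂
    (phi_induce_lt hS.finite_vertexSet hS.finite_edgeSet hf.left_mem (not_not.2 hu))
  exact hG.not_isCotreeMatching
    (.union_of_bridge hS.finite_vertexSet hS.finite_edgeSet hf hP hu hv h₁ h₂)

lemma IsMinimumCounterexample.isEdgeConnected_two (hG : G.IsMinimumCounterexample) :
    G.IsEdgeConnected 2 := by
  have hS := hG.isSepCycle
  refine ⟨hS.nontrivial, fun F hF hcard ↦ ?_⟩
  have hle : F.encard ≤ 1 := Order.le_of_lt_add_one hcard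
  obtain ⟨e, he⟩ : ∃ e, F ⊆ {e} := by
    obtain rfl | ⟨e, rfl⟩ := encard_le_one_iff_eq.1 hle
    · obtain ⟨x, hx⟩ := hS.connected.1
      obtain ⟨e, -⟩ : (G.incidenceSet x).Nonempty := by
        refine nonempty_of_ncard_ne_zero ?_
        have := hS.le_degree x hx
        rw [degree] at this
        omega
      exact ⟨e, by simp⟩
    · exact ⟨e, Subset.rfl⟩
  refine isConnected_of_isSaturated hS.connected.1 fun P hP x hx y hy hPx ↦ ?_
  refine (hS.connected.iff_of_isSaturated (hG.isBridgeless e P fun g a b hg ↦ ?_) hx hy).1 hPx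
  rw [deleteEdges_isLink] at hg
  exact hP (e := g) (by rw [deleteEdges_isLink]; exact ⟨hg.1, fun h ↦ hg.2 (he h)⟩)

end

/-! ### Parallel edges. -/

section


variable {α β : Type*} {G H N : Graph α β} {P Q : α → Prop} {x y z u v w a b c d : α}
  {e f g t : β} {D M K : Set β} {W : Set α} {p q : ℕ}

/-- In a bridgeless graph, a part of a vertex bipartition crossed only by edges of `D` does not
meet `D` in a single vertex that has only one edge outside of `D`. -/
lemma IsBridgeless.false_of_isSaturated [G.Loopless] (hB : G.IsBridgeless)
    (hP : (G.deleteEdges D).IsSaturated P) (hg : G.IsLink g u a) (hgD : g ∉ D) (hu : P u)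
    (hinc : ∀ e, G.Inc e u → e = g ∨ e ∈ D)
    (hD : ∀ e ∈ D, ∀ x, G.Inc e x → x = u ∨ ¬ P x) : False := by
  have hlink : ∀ e x y, G.IsLink e x y → e ∉ D → (P x ↔ P y) := fun e x y h he ↦
    hP (e := e) (by simp [h, he])
  -- Without `u`, the `P`-side is met by no edge of `D`, so only `g` leaves it: `g` would be a
  -- bridge.
  have := hB g (fun x ↦ P x ∧ x ≠ u) (fun e x y h ↦ by
    rw [deleteEdges_isLink] at h
    by_cases he : e ∈ D
    · have := hD e he x h.1.inc_left
      have := hD e he y h.1.inc_right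
      tauto
    · have hu : ∀ x, G.Inc e x → x ≠ u := by
        rintro x hx rfl
        exact (hinc e hx).elim h.2 he
      have := hlink e x y h.1 he
      have := hu x h.1.inc_left
      have := hu y h.1.inc_right
      tauto) hg
  have h1 := hlink g u a hg hgD
  have h2 := hg.ne
  grind

/-- Suppose `x` has degree two. If `y` does too, then `G` consists of the two parallel edges, and
one of them is the matching. If `y` has degree three, its third edge is a bridge. -/
lemma IsMinimumCounterexample.degree_eq_three_of_parallel (hG : G.IsMinimumCounterexample)
    (he : G.IsLink e x y) (hf : G.IsLink f x y) (hef : e ≠ f) : G.degree x = 3 := by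
  have hS := hG.isSepCycle
  have := hS.loopless
  have hB := hG.isBridgeless
  refine (hS.degree_eq he.left_mem).resolve_left fun hx ↦ ?_
  obtain ⟨f', w, hst⟩ := he.exists_isStarTwo hx
  obtain rfl : f = f' := (hst.eq_or_eq f hf.inc_left).resolve_left hef.symm
  have hxy := he.ne
  obtain hy | hy := hS.degree_eq he.right_mem
  · obtain ⟨f', w, hst'⟩ := he.symm.exists_isStarTwo hy
    obtain rfl : f = f' := (hst'.eq_or_eq f hf.inc_right).resolve_left hef.symm
    have hcon : ∀ z ∈ V(G), z = x ∨ z = y := by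
      intro z hz
      refine (hS.connected.iff_of_isSaturated (P := fun z ↦ z = x ∨ z = y)
        (isSaturated_of_imp fun g a b hg hab ↦ ?_) hz he.left_mem).2 (.inl rfl)
      obtain hgef | hgef : g = e ∨ g = f := by
        obtain rfl | rfl := hab
        exacts [hst.eq_or_eq g hg.inc_left, hst'.eq_or_eq g hg.inc_left]
      · exact (hgef ▸ hg).inc_right.eq_or_eq_of_isLink he
      · exact (hgef ▸ hg).inc_right.eq_or_eq_of_isLink hf
    have hV : V(G) = {x, y} := by
      refine Subset.antisymm hcon ?_
      rintro z (rfl | rfl)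
      exacts [he.left_mem, he.right_mem]
    have hE : E(G) = {e, f} := by
      refine Subset.antisymm (fun g hg ↦ ?_) ?_
      · obtain ⟨a, b, h⟩ := exists_isLink_of_mem_edgeSet hg
        obtain rfl | rfl := hcon a h.left_mem
        exacts [hst.eq_or_eq g h.inc_left, hst'.eq_or_eq g h.inc_left]
      · rintro z (rfl | rfl)
        exacts [he.edge_mem, hf.edge_mem]
    refine hG.not_isCotreeMatching (M := {f}) ⟨⟨by simpa using hf.edge_mem, by simp +contextual⟩,
      ?_, ?_⟩
    · refine isConnected_of_isSaturated ⟨x, he.left_mem⟩ fun P hP a ha b hb hPa ↦ ?_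
      have hPxy : P x ↔ P y := hP (e := e) (by simp [he, hef])
      have := hcon a ha
      have := hcon b hb
      grind
    · rw [hV, hE, ncard_pair hxy, ncard_pair hef, ncard_singleton]
  · obtain ⟨g, z, hst'⟩ := he.symm.exists_isStarThree_of_ne hf.symm hef hy
    have hzx : z ≠ x := by
      rintro rfl
      obtain h | h := hst.eq_or_eq g hst'.trd.inc_right
      exacts [hst'.ne₁₃ h.symm, hst'.ne₂₃ h.symm]
    have key : ∀ k, k = e ∨ k = f → ∀ b, G.Inc k b → b = x ∨ b = y := by
      rintro k (rfl | rfl) b hb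
      exacts [hb.eq_or_eq_of_isLink he, hb.eq_or_eq_of_isLink hf]
    have := hB g (fun z ↦ z = x ∨ z = y) (isSaturated_of_imp fun k a b hk hab ↦ by
      rw [deleteEdges_isLink] at hk
      refine key k ?_ b hk.1.inc_right
      obtain rfl | rfl := hab
      · exact hst.eq_or_eq k hk.1.inc_left
      · have := hst'.eq_or_eq k hk.1.inc_left
        have : k ≠ g := hk.2
        tauto) hst'.trd
    have := hst'.trd.ne
    grind

/-- Two parallel edges form a leafless set, so deleting them disconnects `G` and separates `x` from
`y`. Then the third edge at `x` is a bridge. -/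
lemma IsMinimumCounterexample.simple (hG : G.IsMinimumCounterexample) : G.Simple := by
  have hS := hG.isSepCycle
  have := hS.loopless
  refine ⟨fun e f x y he hf ↦ ?_⟩
  by_contra hef
  obtain ⟨g, a, hst⟩ := he.exists_isStarThree_of_ne hf hef
    (hG.degree_eq_three_of_parallel he hf hef)
  obtain ⟨h, b, hst'⟩ := he.symm.exists_isStarThree_of_ne hf.symm hef
    (hG.degree_eq_three_of_parallel he.symm hf.symm hef)
  have hxy := he.ne
  have hD : G.IsLeafless {e, f} := by
    refine ⟨pair_subset he.edge_mem hf.edge_mem, ⟨e, by simp⟩, ?_⟩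
    rintro k (rfl | rfl) z hz
    · refine ⟨f, by simp, Ne.symm hef, ?_⟩
      obtain rfl | rfl := hz.eq_or_eq_of_isLink he
      exacts [hf.inc_left, hf.inc_right]
    · refine ⟨e, by simp, hef, ?_⟩
      obtain rfl | rfl := hz.eq_or_eq_of_isLink hf
      exacts [he.inc_left, he.inc_right]
  obtain ⟨P, hP, u, hu, v, hv, hPu, hPv⟩ := exists_isSaturated_of_not_isConnected
    (G := G.deleteEdges {e, f}) hS.connected.1 (hS.not_isConnected_deleteEdges hD)
  by_cases hPxy : P x ↔ P y
  · refine hPv ((hS.connected.iff_of_isSaturated (P := P) (fun k c d hk ↦ ?_) hu hv).1 hPu)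
    by_cases hkD : k ∈ ({e, f} : Set β)
    · obtain rfl | rfl := hkD
      exacts [he.iff_of_iff hPxy hk, hf.iff_of_iff hPxy hk]
    · exact hP (e := k) (by rw [deleteEdges_isLink]; exact ⟨hk, hkD⟩)
  · have key : ∀ Q : α → Prop, (G.deleteEdges {e, f}).IsSaturated Q → Q x → ¬ Q y → False := by
      intro Q hQ hQx hQy
      refine hG.isBridgeless.false_of_isSaturated hQ hst.trd ?_ hQx ?_ ?_
      · simp [hst.ne₁₃.symm, hst.ne₂₃.symm]
      · intro k hk
        have := hst.eq_or_eq k hk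
        simp
        tauto
      · rintro k (rfl | rfl) z hz
        · obtain rfl | rfl := hz.eq_or_eq_of_isLink he <;> simp [hQy]
        · obtain rfl | rfl := hz.eq_or_eq_of_isLink hf <;> simp [hQy]
    by_cases hPx : P x
    · exact key P hP hPx (by tauto)
    · exact key _ hP.not hPx (by tauto)

/-! ### Vertices of degree two -/

lemma IsStarTwo.left_ne_right [G.Simple] (h : G.IsStarTwo u e v f w) : v ≠ w := by
  rintro rfl
  exact h.ne (h.left.eq h.right)

lemma IsMinimumCounterexample.degree_eq_three_of_isLink (hG : G.IsMinimumCounterexample)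
    (he : G.IsLink e u v) (hu : G.degree u = 2) : G.degree v = 3 := by
  have := hG.simple
  obtain ⟨f, w, hst⟩ := he.exists_isStarTwo hu
  exact (hG.degree_eq_three_of_isStarTwo hst hst.left_ne_right).1

/-- The two neighbours of a vertex of degree two agree on every predicate saturated on `G - V_2`
(`iff_of_isStarTwo`), so the predicate extends to that vertex by their common value and becomes
saturated on `G`. -/
lemma IsMinimumCounterexample.deleteVerts_isConnected (hG : G.IsMinimumCounterexample) :
    (G.deleteVerts (G.verticesOfDegree 2)).IsConnected := by
  have hS := hG.isSepCycle
  have := hG.simple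
  have hmem : ∀ x ∈ V(G), G.degree x = 3 → x ∈ V(G.deleteVerts (G.verticesOfDegree 2)) := by
    intro x hx hdeg
    simp [hx, mem_verticesOfDegree, hdeg]
  have hne : V(G.deleteVerts (G.verticesOfDegree 2)).Nonempty := by
    obtain ⟨x, hx⟩ := hS.connected.1
    obtain h | h := hS.degree_eq hx
    · obtain ⟨e, v, f, w, hst⟩ := exists_isStarTwo h
      exact ⟨v, hmem v hst.left.right_mem (hG.degree_eq_three_of_isLink hst.left h)⟩
    · exact ⟨x, hmem x hx h⟩
  refine isConnected_of_isSaturated hne fun P hP x hx y hy hPx ↦ ?_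
  rw [vertexSet_deleteVerts, mem_sdiff, mem_verticesOfDegree, not_and] at hx hy
  set Q : α → Prop := fun z ↦ (G.degree z ≠ 2 ∧ P z) ∨ (G.degree z = 2 ∧ ∃ c, G.Adj z c ∧ P c)
    with hQ
  have hQ2 : ∀ e z c, G.IsLink e z c → G.degree z = 2 → (Q z ↔ Q c) := by
    intro e z c he hz
    obtain ⟨f, d, hst⟩ := he.exists_isStarTwo hz
    have h1 := hG.iff_of_isStarTwo hst hst.left_ne_right hP
    have h2 := hG.degree_eq_three_of_isLink he hz
    simp only [hQ, hz, h2]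
    constructor
    · rintro (h | ⟨-, c', ⟨k, hk⟩, hc'⟩)
      · exact absurd rfl h.1
      · refine .inl ⟨by simp, ?_⟩
        obtain rfl | rfl := hst.eq_or_eq k hk.inc_left
        · rwa [hst.left.right_unique hk]
        · rwa [h1, hst.right.right_unique hk]
    · rintro (h | h)
      · exact .inr ⟨trivial, c, he.adj, h.2⟩
      · omega
  have hsat : G.IsSaturated Q := by
    intro e z c he
    obtain hz | hz := hS.degree_eq he.left_mem
    · exact hQ2 e z c he hz
    obtain hc | hc := hS.degree_eq he.right_mem
    · exact (hQ2 e c z he.symm hc).symm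
    have := hP (e := e) (x := z) (y := c) (by simp [mem_verticesOfDegree, he, hz, hc])
    simp [hQ, hz, hc, this]
  have := hS.connected.iff_of_isSaturated hsat hx.1 hy.1
  simp only [hQ, ne_eq, hx.2 hx.1, not_false_eq_true, true_and, false_and, or_false,
    hy.2 hy.1] at this
  exact this.1 hPx

/-- A neighbour of a vertex of degree two has a neighbour of degree three. -/
lemma IsMinimumCounterexample.exists_isLink_degree_eq_three (hG : G.IsMinimumCounterexample)
    (ht : G.IsLink t x w) (hx : G.degree x = 2) :
    ∃ k z, G.IsLink k w z ∧ G.degree z = 3 := by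
  have hS := hG.isSepCycle
  have := hG.simple
  obtain ⟨g, y, hst⟩ := ht.exists_isStarTwo hx
  by_contra! hcon
  -- Otherwise `w` would be isolated in `G - V_2`, although it is joined there to the other
  -- neighbour `y` of `x`.
  refine hst.left_ne_right ((hG.iff_of_isStarTwo hst hst.left_ne_right (P := (· = w))
    (isSaturated_of_imp fun k a b hk ha ↦ ?_)).1 rfl).symm
  rw [deleteVerts_isLink] at hk
  subst ha
  have := (hS.degree_eq hk.1.right_mem).resolve_right (hcon k b hk.1)
  exact absurd ⟨hk.1.right_mem, this⟩ hk.2.2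

end

/-! ### Two vertices of degree two with a common neighbour. -/

section


variable {α β : Type*} {G H N : Graph α β} {P Q : α → Prop} {x y z u v w a b c d : α}
  {e f g p q r s t : β} {D M M' K : Set β} {W : Set α}

lemma IsLink.inc_iff (h : G.IsLink e x y) : G.Inc e z ↔ z = x ∨ z = y :=
  ⟨fun hz ↦ hz.eq_or_eq_of_isLink h,
    by rintro (rfl | rfl); exacts [h.inc_left, h.inc_right]⟩

lemma IsSaturated.iff_of_reflTransGen (hP : G.IsSaturated P)
    (h : Relation.ReflTransGen G.Adj x y) : P x ↔ P y := by
  induction h with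
  | refl => rfl
  | tail _ h ih => exact ih.trans (hP h.choose_spec)

/-- Two vertices `u`, `v` of degree two with a common neighbour `w` of degree three. -/
structure IsCherry (G : Graph α β) (p q r s t : β) (a u w v b x : α) : Prop where
  left : G.IsStarTwo u p a q w
  right : G.IsStarTwo v r w s b
  mid : G.IsStarThree w q u r v t x
  ne_left : a ≠ v
  ne_right : b ≠ u
  ne_mid_left : x ≠ u
  ne_mid_right : x ≠ v
  degree_eq : G.degree x = 3
  left_ne_mid : a ≠ w
  right_ne_mid : b ≠ w
  left_ne_right : u ≠ v

lemma deleteVerts_deleteEdges_le {k : β} (hkw : G.Inc k w) :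
    (G.deleteVerts {u, v, w}).deleteEdges M ≤ G.deleteEdges (insert k M) := by
  refine ⟨by simp only [vertexSet_deleteEdges, vertexSet_deleteVerts]; exact sdiff_subset,
    fun g y z hg ↦ ?_⟩
  simp only [deleteEdges_isLink, deleteVerts_isLink, mem_insert_iff, mem_singleton_iff,
    not_or] at hg ⊢
  refine ⟨hg.1.1, ?_, hg.2⟩
  rintro rfl
  have := hkw.eq_or_eq_of_isLink hg.1.1
  tauto

lemma notMem_insert_of_inc {k : β} (hkw : G.Inc k w) :
    ∀ e y z, G.IsLink e y z → e ∉ E(N) → y ∉ ({w, v} : Set α) → z ∉ ({w, v} : Set α) → e ∉ M →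
      e ∉ insert k M := by
  rintro e y z he - hy hz heM (rfl | h)
  · obtain rfl | rfl := hkw.eq_or_eq_of_isLink he
    exacts [hy (by simp), hz (by simp)]
  · exact heM h

namespace IsCherry

variable (h : G.IsCherry p q r s t a u w v b x)
include h

lemma edges_ne [G.Loopless] : p ≠ q ∧ p ≠ r ∧ p ≠ s ∧ p ≠ t ∧ q ≠ r ∧ q ≠ s ∧ q ≠ t ∧ r ≠ s ∧
    r ≠ t ∧ s ≠ t := by
  have := h.left.left.inc_iff (z := u)
  have := h.left.right.inc_iff (z := u)
  have := h.right.left.inc_iff (z := u)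
  have := h.right.right.inc_iff (z := u)
  have := h.mid.trd.inc_iff (z := u)
  have := h.left.left.inc_iff (z := v)
  have := h.left.right.inc_iff (z := v)
  have := h.right.left.inc_iff (z := v)
  have := h.right.right.inc_iff (z := v)
  have := h.mid.trd.inc_iff (z := v)
  have := h.left.left.ne
  have := h.left.right.ne
  have := h.right.left.ne
  have := h.right.right.ne
  grind [h.left_ne_right, h.ne_left, h.ne_right, h.ne_mid_left, h.ne_mid_right, h.left_ne_mid,
    h.right_ne_mid, h.left.ne, h.right.ne, h.mid.ne₁₂, h.mid.ne₁₃, h.mid.ne₂₃]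

lemma mem_iff (g : β) :
    g ∈ ({q, r, s, t} : Set β) ↔ ∃ y ∈ ({w, v} : Set α), G.Inc g y := by
  simp only [mem_insert_iff, mem_singleton_iff, exists_eq_or_imp, exists_eq_left]
  constructor
  · rintro (rfl | rfl | rfl | rfl)
    exacts [.inl h.left.right.inc_right, .inl h.right.left.inc_right, .inr h.right.right.inc_left,
      .inl h.mid.trd.inc_left]
  · rintro (hg | hg)
    · have := h.mid.eq_or_eq g hg
      tauto
    · have := h.right.eq_or_eq g hg
      tauto

lemma edgeSet_banana_subset : E(banana u b {s}) ⊆ E(G) := by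
  simpa using h.right.right.edge_mem

lemma vertexSet_banana_subset [G.Loopless] : V(banana u b {s}) ⊆ V(G) \ {w, v} := by
  have := h.left.left.left_mem
  have := h.right.right.right_mem
  have := h.left.right.ne
  have := h.right.right.ne
  have := h.left_ne_right
  have := h.right_ne_mid
  simp [insert_subset_iff]
  grind

lemma degree_rewire [G.Loopless] (hE : E(G).Finite) (hyw : y ≠ w) (hyv : y ≠ v) :
    (y = x → (G.rewire {w, v} (banana u b {s})).degree y = 2) ∧
      (y ≠ x → (G.rewire {w, v} (banana u b {s})).degree y = G.degree y) := by
  have hd := Graph.degree_rewire (W := {w, v}) (N := banana u b {s}) hE h.edgeSet_banana_subset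
    h.mem_iff (by simp) y
  have hq := h.left.right.inc_iff (z := y)
  have hr := h.right.left.inc_iff (z := y)
  have hs := h.right.right.inc_iff (z := y)
  have ht := h.mid.trd.inc_iff (z := y)
  obtain ⟨-, -, -, -, -, -, -, -, -, hst⟩ := h.edges_ne
  have hmem : ∀ k, k ∈ G.incidenceSet y ∩ {q, r, s, t} ↔
      (k = q ∧ y = u) ∨ (k = s ∧ y = b) ∨ (k = t ∧ y = x) := by
    intro k
    simp only [mem_inter_iff, mem_incidenceSet, mem_insert_iff, mem_singleton_iff]
    grind
  have hub := h.ne_right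
  have hxu := h.ne_mid_left
  by_cases hyu : y = u
  · subst hyu
    have : G.incidenceSet y ∩ {q, r, s, t} = {q} := by
      ext k
      rw [hmem, mem_singleton_iff]
      tauto
    rw [this, ncard_singleton, degree_banana_left] at hd
    exact ⟨fun h ↦ absurd h.symm hxu, fun _ ↦ by omega⟩
  by_cases hyb : y = b
  · have hNy : (banana u b {s}).degree y = 1 := hyb ▸ degree_banana_right u y s
    rw [hNy] at hd
    by_cases hyx : y = x
    · have : G.incidenceSet y ∩ {q, r, s, t} = {s, t} := by
        ext k
        rw [hmem, mem_insert_iff, mem_singleton_iff]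
        tauto
      have hdx : G.degree y = 3 := hyx ▸ h.degree_eq
      rw [this, ncard_pair hst] at hd
      exact ⟨fun _ ↦ by omega, fun h ↦ absurd hyx h⟩
    · have : G.incidenceSet y ∩ {q, r, s, t} = {s} := by
        ext k
        rw [hmem, mem_singleton_iff]
        tauto
      rw [this, ncard_singleton] at hd
      exact ⟨fun h ↦ absurd h hyx, fun _ ↦ by omega⟩
  rw [degree_banana_of_ne hyu hyb] at hd
  by_cases hyx : y = x
  · have : G.incidenceSet y ∩ {q, r, s, t} = {t} := by
      ext k
      rw [hmem, mem_singleton_iff]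
      tauto
    have hdx : G.degree y = 3 := hyx ▸ h.degree_eq
    rw [this, ncard_singleton] at hd
    exact ⟨fun _ ↦ by omega, fun h ↦ absurd hyx h⟩
  · have : G.incidenceSet y ∩ {q, r, s, t} = ∅ := by
      ext k
      rw [hmem, mem_empty_iff_false]
      tauto
    rw [this, ncard_empty] at hd
    exact ⟨fun h ↦ absurd h hyx, fun _ ↦ by omega⟩

/-- The vertices `w` and `v` are replaced by an edge from `u` to `b`. The lost edge `t` is no
bridge, which keeps the graph connected. Every cycle through the new edge passes `u`, still of
degree two. -/
lemma isSepCycle_rewire (hS : G.IsSepCycle 2 3) (hB : G.IsBridgeless) :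
    (G.rewire {w, v} (banana u b {s})).IsSepCycle 2 3 := by
  have := hS.loopless
  have hNE := h.edgeSet_banana_subset
  have hNV := h.vertexSet_banana_subset
  have hE := hS.finite_edgeSet
  have hub := h.ne_right.symm
  have := banana_loopless hub {s}
  have hN : (banana u b {s}).IsLink s u b := by simp
  have huV : u ∈ V(G) \ {w, v} := hNV (by simp)
  have hbV : b ∈ V(G) \ {w, v} := hNV (by simp)
  refine hS.rewire hNE hNV ?_ ?_ ?_ ?_
  · refine isConnected_rewire hS.connected hNV ⟨u, huV⟩ fun P hP ↦ ?_
    obtain ⟨Q, hQ, hQP⟩ := exists_iff_of_mem_of_notMem {w, v} (fun _ ↦ P u) P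
    refine ⟨Q, hB t Q fun g y z hg ↦ ?_, fun y hy ↦ hQP y hy.2⟩
    rw [deleteEdges_isLink] at hg
    have hPub : P u ↔ P b := hP (.inr hN)
    have hQu := hQP u huV.2
    have hQb := hQP b hbV.2
    have hQw := hQ w (by simp)
    have hQv := hQ v (by simp)
    by_cases hgK : g ∈ ({q, r, s, t} : Set β)
    · obtain rfl | rfl | rfl | rfl := hgK
      · exact h.left.right.iff_of_iff (hQu.trans hQw.symm) hg.1
      · exact h.right.left.iff_of_iff (hQv.trans hQw.symm) hg.1
      · exact h.right.right.iff_of_iff (hQv.trans (hPub.trans hQb.symm)) hg.1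
      · exact absurd rfl hg.2
    · exact hP.iff_of_rewire h.mem_iff (by simp) hQP hgK hg.1
  · intro P hP
    have h1 := hP q w u h.left.right.symm (by simp)
    have h2 := hP r w v h.right.left.symm (by simp)
    have h3 := hP s v b h.right.right (by simp)
    refine ⟨fun g y z hg ↦ ?_, ?_⟩
    · obtain rfl : g = s := by simpa using hg.edge_mem
      exact hN.iff_of_iff (by tauto) hg
    · rintro y (rfl | rfl)
      exacts [⟨u, huV, h1⟩, ⟨b, hbV, h3⟩]
  · rintro y ⟨hy, hyW⟩
    simp only [mem_insert_iff, mem_singleton_iff, not_or] at hyW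
    have h1 := h.degree_rewire hE hyW.1 hyW.2
    have h2 := hS.le_degree y hy
    have h3 := hS.degree_le y hy
    by_cases hyx : y = x
    · rw [h1.1 hyx]
      omega
    · rw [h1.2 hyx]
      exact ⟨h2, h3⟩
  · intro C hC hcyc hdisj
    have hsC : s ∈ E(C) := by simpa using hdisj
    have hl : C.IsLink s u b := (hC.isLink_iff hsC).2 (.inr hN)
    refine hcyc.not_isConnected_deleteEdges hC (hE.subset (edgeSet_rewire_subset hNE))
      ?_ hl.left_mem ?_
    · rw [vertexSet_rewire hNV]
      exact ⟨u, huV, b, hbV, hub⟩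
    · rw [(h.degree_rewire hE h.left.right.ne h.left_ne_right).2 h.ne_mid_left.symm,
        h.left.degree_eq]

lemma edgeSet_rewire_eq [G.Loopless] :
    E(G.rewire {w, v} (banana u b {s})) = E(G) \ {q, r, t} := by
  obtain ⟨hpq, hpr, hps, hpt, hqr, hqs, hqt, hrs, hrt, hst⟩ := h.edges_ne
  rw [edgeSet_rewire h.mem_iff (by simp)]
  have := h.right.right.edge_mem
  ext g
  simp
  grind

lemma notMem_of_isMatching [G.Loopless]
    (hM : (G.rewire {w, v} (banana u b {s})).IsMatching M) : q ∉ M ∧ r ∉ M ∧ t ∉ M := by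
  have hM := hM.1
  rw [h.edgeSet_rewire_eq] at hM
  exact ⟨fun h ↦ (hM h).2 (by simp), fun h ↦ (hM h).2 (by simp), fun h ↦ (hM h).2 (by simp)⟩

/-- Restoring two vertices and the three edges `q`, `r`, `t` leaves room for exactly one more
matching edge. -/
lemma ncard_insert_add_ncard (hS : G.IsSepCycle 2 3)
    (hM : (G.rewire {w, v} (banana u b {s})).IsCotreeMatching M) {k : β} (hk : k ∉ M) :
    (insert k M).ncard + V(G).ncard = E(G).ncard + 1 := by
  have := hS.loopless
  have hE := hS.finite_edgeSet
  obtain ⟨hpq, hpr, hps, hpt, hqr, hqs, hqt, hrs, hrt, hst⟩ := h.edges_ne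
  have h1 := hM.ncard_add_ncard
  have h2 := ncard_sdiff_add_ncard_of_subset (s := {q, r, t}) (t := E(G)) (by
    simp [insert_subset_iff, h.mid.fst.edge_mem, h.mid.snd.edge_mem, h.mid.trd.edge_mem]) hE
  have h3 := ncard_sdiff_add_ncard_of_subset (s := {w, v}) (t := V(G)) (by
    simp [insert_subset_iff, h.mid.fst.left_mem, h.mid.snd.right_mem]) hS.finite_vertexSet
  rw [ncard_pair h.mid.snd.ne] at h3
  rw [ncard_eq_three.2 ⟨q, r, t, hqr, hqt, hrt, rfl⟩] at h2
  rw [vertexSet_rewire h.vertexSet_banana_subset, h.edgeSet_rewire_eq] at h1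
  rw [ncard_insert_of_notMem hk
    (hE.subset (hM.isMatching.1.trans (edgeSet_rewire_subset h.edgeSet_banana_subset)))]
  omega

/-- In the forest that remains when `u`, `v` and `w` are removed, `x` is joined to `a` or `b`. -/
lemma reflTransGen_or_reflTransGen [G.Loopless]
    (hM : (G.rewire {w, v} (banana u b {s})).IsCotreeMatching M) :
    (Relation.ReflTransGen ((G.deleteVerts {u, v, w}).deleteEdges M).Adj x b ∧ s ∉ M) ∨
      (Relation.ReflTransGen ((G.deleteVerts {u, v, w}).deleteEdges M).Adj x a ∧ p ∉ M) := by
  have hNV := h.vertexSet_banana_subset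
  have hub := h.ne_right.symm
  have hau := h.left.left.ne
  have hxu := h.ne_mid_left
  have hN : (banana u b {s}).IsLink s u b := by simp
  have huV : u ∈ V(G) \ {w, v} := hNV (by simp)
  have hxV : x ∈ V(G) \ {w, v} := by
    refine ⟨h.mid.trd.right_mem, ?_⟩
    rintro (h' | h')
    exacts [h.mid.trd.ne h'.symm, h.ne_mid_right h']
  have hps := h.edges_ne.2.2.1
  -- In the rewired graph `p` and `s` are the edges at `u`, so the matching contains at most one of
  -- them.
  have hps' : p ∈ M → s ∉ M := fun hp hs ↦ by
    refine hps (hM.isMatching.2 p hp s hs u ?_ ?_)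
    · rw [rewire_inc_iff_of_notMem (by simpa using hps) (hM.isMatching.1 hp)]
      exact h.left.left.inc_left
    · exact (rewire_inc_of_mem (by simp)).2 hN.inc_left
  set F := (G.deleteVerts {u, v, w}).deleteEdges M with hF
  have hFlink : ∀ k y z, G.IsLink k y z → k ∉ M → y ≠ u → y ≠ v → y ≠ w → z ≠ u → z ≠ v →
      z ≠ w → F.IsLink k y z := by
    intro k y z hk hkM _ _ _ _ _ _
    simp only [hF, deleteEdges_isLink, deleteVerts_isLink, mem_insert_iff, mem_singleton_iff]
    tauto
  set R : α → Prop := Relation.ReflTransGen F.Adj x with hR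
  have hRsat : F.IsSaturated R := isSaturated_of_imp fun k y z hk hy ↦ hy.tail ⟨k, hk⟩
  -- Extend `R` to `u` by any value compatible with the unmatched edges at `u`. Connectivity forces
  -- it to be true, so some unmatched edge at `u` leads to a vertex reached from `x`.
  have key : ∀ Q : α → Prop, (∀ y, y ≠ u → (Q y ↔ R y)) → (p ∉ M → (Q u ↔ R a)) →
      (s ∉ M → (Q u ↔ R b)) → Q u := by
    intro Q hQ hQa hQb
    refine (hM.isConnected.iff_of_isSaturated (P := Q) (fun k y z hk ↦ ?_)
      ((vertexSet_rewire hNV).symm.subset hxV) ((vertexSet_rewire hNV).symm.subset huV)).1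
      ((hQ x hxu).2 .refl)
    rw [deleteEdges_isLink] at hk
    obtain ⟨hk | hk, hkM⟩ := hk
    · obtain ⟨hks, hk, hy, hz⟩ := hk
      by_cases hkp : k = p
      · subst hkp
        exact h.left.left.iff_of_iff ((hQa hkM).trans (hQ a hau.symm).symm) hk
      have hku : ¬ G.Inc k u := fun hku ↦ by
        obtain rfl | rfl := h.left.eq_or_eq k hku
        · exact hkp rfl
        · have := h.left.right.inc_right.eq_or_eq_of_isLink hk
          simp only [mem_insert_iff, mem_singleton_iff] at hy hz
          tauto
      have hyu : y ≠ u := by rintro rfl; exact hku hk.inc_left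
      have hzu : z ≠ u := by rintro rfl; exact hku hk.inc_right
      simp only [mem_insert_iff, mem_singleton_iff, not_or] at hy hz
      rw [hQ y hyu, hQ z hzu]
      exact hRsat (hFlink k y z hk hkM hyu hy.2 hy.1 hzu hz.2 hz.1)
    · obtain rfl : k = s := by simpa using hk.edge_mem
      exact hN.iff_of_iff ((hQb hkM).trans (hQ b hub.symm).symm) hk
  by_contra! hcon
  by_cases hs : s ∈ M
  · have hp : p ∉ M := fun hp ↦ hps' hp hs
    obtain ⟨Q, hQ1, hQ2⟩ := exists_iff_of_mem_of_notMem {u} (fun _ ↦ R a) R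
    have := key Q hQ2 (fun _ ↦ hQ1 u rfl) fun h ↦ absurd hs h
    exact hp (hcon.2 ((hQ1 u rfl).1 this))
  · have hRb : ¬ R b := fun h ↦ hs (hcon.1 h)
    by_cases hp : p ∈ M
    · obtain ⟨Q, hQ1, hQ2⟩ := exists_iff_of_mem_of_notMem {u} (fun _ ↦ R b) R
      have := key Q hQ2 (fun h ↦ absurd hp h) fun _ ↦ hQ1 u rfl
      exact hRb ((hQ1 u rfl).1 this)
    · have hRa : ¬ R a := fun h ↦ hp (hcon.2 h)
      obtain ⟨Q, hQ1, hQ2⟩ := exists_iff_of_mem_of_notMem {u} (fun _ ↦ False) R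
      have := key Q hQ2 (fun _ ↦ (hQ1 u rfl).trans (by simp [hRa]))
        fun _ ↦ (hQ1 u rfl).trans (by simp [hRb])
      exact (hQ1 u rfl).1 this

/-- The route from `u` over `w` and `x` to `b` replaces the new edge, and `v` hangs on `b` by `s`;
hence `r` is free for the matching. -/
lemma isCotreeMatching_insert_right (hS : G.IsSepCycle 2 3)
    (hM : (G.rewire {w, v} (banana u b {s})).IsCotreeMatching M)
    (hreach : Relation.ReflTransGen ((G.deleteVerts {u, v, w}).deleteEdges M).Adj x b)
    (hs : s ∉ M) : G.IsCotreeMatching (insert r M) := by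
  have := hS.loopless
  have hNE := h.edgeSet_banana_subset
  have hNV := h.vertexSet_banana_subset
  have hN : (banana u b {s}).IsLink s u b := by simp
  have huV : u ∈ V(G) \ {w, v} := hNV (by simp)
  have hbV : b ∈ V(G) \ {w, v} := hNV (by simp)
  obtain ⟨hpq, hpr, hps, hpt, hqr, hqs, hqt, hrs, hrt, hst⟩ := h.edges_ne
  obtain ⟨hqM, hrM, htM⟩ := h.notMem_of_isMatching hM.isMatching
  have hM0' : M \ E(banana u b {s}) = M := by simpa using hs
  refine ⟨?_, ?_, h.ncard_insert_add_ncard hS hM hrM⟩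
  · have hM0 := hM.isMatching.sdiff_of_rewire hNE
    have hunc := fun x hx ↦ hM.isMatching.not_inc_of_mem_rewire (x := x) hx
    rw [hM0'] at hunc hM0
    exact hM0.insert h.right.left (hunc v (by simp)) (hunc w (by simp))
  · refine hM.isConnected.of_rewire hNV (notMem_insert_of_inc h.right.left.inc_right)
      fun P hP ↦ ?_
    have hxb := (hP.mono
      (deleteVerts_deleteEdges_le h.right.left.inc_right)).iff_of_reflTransGen hreach
    have h1 : P u ↔ P w := hP (e := q) (by simp [h.left.right, hqr, hqM])
    have h2 : P w ↔ P x := hP (e := t) (by simp [h.mid.trd, hrt.symm, htM])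
    have h3 : P v ↔ P b := hP (e := s) (by simp [h.right.right, hrs.symm, hs])
    refine ⟨fun g y z hg _ ↦ ?_, ?_⟩
    · obtain rfl : g = s := by simpa using hg.edge_mem
      exact hN.iff_of_iff (h1.trans (h2.trans hxb)) hg
    · rintro y (rfl | rfl)
      exacts [⟨u, huV, h1.symm⟩, ⟨b, hbV, h3⟩]

/-- The route from `u` over `a` and `x` to `w` makes `q` superfluous. From `w` the edges `r` and `s`
lead to `b` in place of the new edge; if `s` is matched, `v` hangs on `w` by `r`. As `p` is
unmatched, `u` is free. -/
lemma isCotreeMatching_insert_left (hS : G.IsSepCycle 2 3)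
    (hM : (G.rewire {w, v} (banana u b {s})).IsCotreeMatching M)
    (hreach : Relation.ReflTransGen ((G.deleteVerts {u, v, w}).deleteEdges M).Adj x a)
    (hp : p ∉ M) : G.IsCotreeMatching (insert q M) := by
  have := hS.loopless
  have hNE := h.edgeSet_banana_subset
  have hNV := h.vertexSet_banana_subset
  have hN : (banana u b {s}).IsLink s u b := by simp
  have huV : u ∈ V(G) \ {w, v} := hNV (by simp)
  have hbV : b ∈ V(G) \ {w, v} := hNV (by simp)
  obtain ⟨hpq, hpr, hps, hpt, hqr, hqs, hqt, hrs, hrt, hst⟩ := h.edges_ne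
  obtain ⟨hqM, hrM, htM⟩ := h.notMem_of_isMatching hM.isMatching
  refine ⟨?_, ?_, h.ncard_insert_add_ncard hS hM hqM⟩
  · have hM0 := hM.isMatching.sdiff_of_rewire hNE
    rw [edgeSet_banana] at hM0
    have hu0 : ∀ k ∈ M, ¬ G.Inc k u := by
      rintro k hk hku
      obtain rfl | rfl := h.left.eq_or_eq k hku
      exacts [hp hk, hqM hk]
    have hw0 := hM.isMatching.not_inc_of_mem_rewire (x := w) (by simp)
    -- A matched `s` has to be reinserted with its end `v` in place of `u`.
    by_cases hs : s ∈ M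
    · have := hM0.insert h.right.right
        (by simpa using hM.isMatching.not_inc_of_mem_rewire (x := v) (by simp))
        (by simpa using hM.isMatching.not_inc_of_inc_rewire hs hN.inc_right)
      rw [insert_sdiff_singleton, insert_eq_of_mem hs] at this
      refine this.insert h.left.right hu0 ?_
      intro k hk hkw
      by_cases hks : k = s
      · subst hks
        obtain h' | h' := hkw.eq_or_eq_of_isLink h.right.right
        exacts [h.mid.snd.ne h', h.right_ne_mid h'.symm]
      · exact hw0 k ⟨hk, by simpa using hks⟩ hkw
    · rw [sdiff_singleton_eq_self hs] at hM0
      have hM0' : M \ E(banana u b {s}) = M := by simpa using hs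
      exact hM0.insert h.left.right hu0 (hM0' ▸ hw0)
  · refine hM.isConnected.of_rewire hNV (notMem_insert_of_inc h.left.right.inc_right)
      fun P hP ↦ ?_
    have hxa := (hP.mono
      (deleteVerts_deleteEdges_le h.left.right.inc_right)).iff_of_reflTransGen hreach
    have h1 : P v ↔ P w := hP (e := r) (by simp [h.right.left, hqr.symm, hrM])
    have h2 : P w ↔ P x := hP (e := t) (by simp [h.mid.trd, hqt.symm, htM])
    have h3 : P u ↔ P a := hP (e := p) (by simp [h.left.left, hpq, hp])
    have h4 : P w ↔ P u := h2.trans (hxa.trans h3.symm)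
    refine ⟨fun g y z hg hgM ↦ ?_, ?_⟩
    · obtain rfl : g = s := by simpa using hg.edge_mem
      have h5 : P v ↔ P b := hP (e := g) (by simp [h.right.right, hqs.symm, hgM])
      exact hN.iff_of_iff (h4.symm.trans (h1.symm.trans h5)) hg
    · rintro y (rfl | rfl)
      exacts [⟨u, huV, h4⟩, ⟨u, huV, h1.trans h4⟩]

lemma false_of_isMinimumCounterexample (hG : G.IsMinimumCounterexample) : False := by
  have hS := hG.isSepCycle
  have := hS.loopless
  obtain ⟨M, hM⟩ := hG.exists_isCotreeMatching (h.isSepCycle_rewire hS hG.isBridgeless)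
    (phi_rewire_lt hS.finite_vertexSet hS.finite_edgeSet h.edgeSet_banana_subset
      h.vertexSet_banana_subset (x := w) (by simp) h.mid.fst.left_mem)
  obtain ⟨hreach, hs⟩ | ⟨hreach, hp⟩ := h.reflTransGen_or_reflTransGen hM
  · exact hG.not_isCotreeMatching (h.isCotreeMatching_insert_right hS hM hreach hs)
  · exact hG.not_isCotreeMatching (h.isCotreeMatching_insert_left hS hM hreach hp)

end IsCherry

lemma IsMinimumCounterexample.eq_of_isLink_of_degree_eq_two (hG : G.IsMinimumCounterexample)
    (hq : G.IsLink q u w) (hr : G.IsLink r v w) (hu : G.degree u = 2) (hv : G.degree v = 2) :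
    u = v := by
  have hS := hG.isSepCycle
  have := hG.simple
  by_contra huv
  have hqr : q ≠ r := by
    rintro rfl
    exact huv (hq.left_unique hr)
  have hw : G.degree w = 3 := hG.degree_eq_three_of_isLink hq hu
  obtain ⟨t, x, hst⟩ := hq.symm.exists_isStarThree_of_ne hr.symm hqr hw
  obtain ⟨p, a, hst₁⟩ := hq.exists_isStarTwo hu
  obtain ⟨s, b, hst₂⟩ := hr.exists_isStarTwo hv
  have ha : G.degree a = 3 := hG.degree_eq_three_of_isLink hst₁.right hu
  have hb : G.degree b = 3 := hG.degree_eq_three_of_isLink hst₂.right hv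
  -- Some neighbour of `w` has degree three, and `u` and `v` do not.
  have hx : G.degree x = 3 := by
    obtain ⟨k, z, hk, hz⟩ := hG.exists_isLink_degree_eq_three hq hu
    obtain rfl | rfl | rfl := hst.eq_or_eq k hk.inc_left
    · rw [hst.fst.right_unique hk] at hu
      omega
    · rw [hst.snd.right_unique hk] at hv
      omega
    · rwa [hst.trd.right_unique hk]
  refine IsCherry.false_of_isMinimumCounterexample ⟨hst₁.symm, hst₂, hst, ?_, ?_, ?_, ?_, hx,
    hst₁.left_ne_right.symm, hst₂.left_ne_right.symm, huv⟩ hG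
  all_goals
    rintro rfl
    omega

end

/-! ### Triangles. -/

section


variable {α β : Type*} {G H N : Graph α β} {P Q : α → Prop} {x y z u v w a b c d : α}
  {e f g p q r s t : β} {D M M' K : Set β} {W : Set α}

lemma IsSepCycle.exists_isSaturated_deleteEdges (hS : G.IsSepCycle 2 3) (hD : G.IsLeafless D) :
    ∃ P : α → Prop, (G.deleteEdges D).IsSaturated P ∧ ¬ G.IsSaturated P := by
  obtain ⟨P, hP, u, hu, v, hv, hPu, hPv⟩ := exists_isSaturated_of_not_isConnected
    (G := G.deleteEdges D) hS.connected.1 (hS.not_isConnected_deleteEdges hD)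
  exact ⟨P, hP, fun h ↦ hPv ((hS.connected.iff_of_isSaturated h hu hv).1 hPu)⟩

lemma IsSaturated.of_deleteEdges (hP : (G.deleteEdges D).IsSaturated P)
    (hD : ∀ e ∈ D, ∀ x y, G.IsLink e x y → (P x ↔ P y)) : G.IsSaturated P := by
  intro e x y he
  by_cases heD : e ∈ D
  · exact hD e heD x y he
  · exact hP (e := e) (by simp [he, heD])

lemma IsBridgeless.false_of_triangle [G.Loopless] (hB : G.IsBridgeless) (he : G.IsLink e u v)
    (hf : G.IsLink f v w) (hg : G.IsLink g w u) (heg : e ≠ g) (hdeg : G.degree u = 3)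
    (hP : (G.deleteEdges {e, f, g}).IsSaturated P) (hu : P u) (hv : ¬ P v) (hw : ¬ P w) :
    False := by
  obtain ⟨h, a, hst⟩ := he.exists_isStarThree_of_ne hg.symm heg hdeg
  refine hB.false_of_isSaturated hP hst.trd ?_ hu ?_ ?_
  · have hfh : h ≠ f := by
      rintro rfl
      obtain h | h := hst.trd.inc_left.eq_or_eq_of_isLink hf
      exacts [he.ne h, hg.ne h.symm]
    simp [hst.ne₁₃.symm, hst.ne₂₃.symm, hfh]
  · intro k hk
    have := hst.eq_or_eq k hk
    simp
    tauto
  · rintro k (rfl | rfl | rfl) x hx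
    · obtain rfl | rfl := hx.eq_or_eq_of_isLink he <;> simp [hv]
    · obtain rfl | rfl := hx.eq_or_eq_of_isLink hf <;> simp [hv, hw]
    · obtain rfl | rfl := hx.eq_or_eq_of_isLink hg <;> simp [hw]

/-- Deleting the triangle disconnects `G`, so one of its vertices is separated from the other two.
The third edge at that vertex is then a bridge. -/
lemma IsSepCycle.false_of_triangle [G.Simple] (hS : G.IsSepCycle 2 3) (hB : G.IsBridgeless)
    (he : G.IsLink e u v) (hf : G.IsLink f v w) (hg : G.IsLink g w u) (hu : G.degree u = 3)
    (hv : G.degree v = 3) (hw : G.degree w = 3) : False := by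
  have huv := he.ne
  have hvw := hf.ne
  have hwu := hg.ne
  have hef : e ≠ f := by
    rintro rfl
    obtain h | h := he.inc_left.eq_or_eq_of_isLink hf <;> tauto
  have hfg : f ≠ g := by
    rintro rfl
    obtain h | h := hf.inc_left.eq_or_eq_of_isLink hg <;> tauto
  have hge : g ≠ e := by
    rintro rfl
    obtain h | h := hg.inc_left.eq_or_eq_of_isLink he <;> tauto
  have hD : G.IsLeafless {e, f, g} := by
    refine ⟨?_, ⟨e, by simp⟩, ?_⟩
    · simp [insert_subset_iff, he.edge_mem, hf.edge_mem, hg.edge_mem]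
    · rintro k (rfl | rfl | rfl) x hx
      · obtain rfl | rfl := hx.eq_or_eq_of_isLink he
        exacts [⟨g, by simp, hge, hg.inc_right⟩, ⟨f, by simp, hef.symm, hf.inc_left⟩]
      · obtain rfl | rfl := hx.eq_or_eq_of_isLink hf
        exacts [⟨e, by simp, hef, he.inc_right⟩, ⟨g, by simp, hfg.symm, hg.inc_left⟩]
      · obtain rfl | rfl := hx.eq_or_eq_of_isLink hg
        exacts [⟨f, by simp, hfg, hf.inc_right⟩, ⟨e, by simp, hge.symm, he.inc_left⟩]
  obtain ⟨P, hP, hnP⟩ := hS.exists_isSaturated_deleteEdges hD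
  have h1 : ({e, f, g} : Set β) = {f, g, e} := by ext; simp; tauto
  have h2 : ({e, f, g} : Set β) = {g, e, f} := by ext; simp; tauto
  have key : ∀ Q : α → Prop, (G.deleteEdges {e, f, g}).IsSaturated Q →
      ¬ (Q u ∧ ¬ Q v ∧ ¬ Q w) ∧ ¬ (Q v ∧ ¬ Q w ∧ ¬ Q u) ∧ ¬ (Q w ∧ ¬ Q u ∧ ¬ Q v) := by
    refine fun Q hQ ↦ ⟨fun h ↦ ?_, fun h ↦ ?_, fun h ↦ ?_⟩
    · exact hB.false_of_triangle he hf hg hge.symm hu hQ h.1 h.2.1 h.2.2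
    · exact hB.false_of_triangle hf hg he hef.symm hv (h1 ▸ hQ) h.1 h.2.1 h.2.2
    · exact hB.false_of_triangle hg he hf hfg.symm hw (h2 ▸ hQ) h.1 h.2.1 h.2.2
  have k1 := key P hP
  have k2 := key _ hP.not
  simp only [not_not] at k2
  have huv' : P u ↔ P v := by
    by_cases P u <;> by_cases P v <;> by_cases P w <;> simp_all
  have hvw' : P v ↔ P w := by
    by_cases P u <;> by_cases P v <;> by_cases P w <;> simp_all
  refine hnP (hP.of_deleteEdges ?_)
  rintro k (rfl | rfl | rfl) x y hk
  exacts [he.iff_of_iff huv' hk, hf.iff_of_iff hvw' hk,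
    hg.iff_of_iff (huv'.trans hvw').symm hk]

/-- A triangle `u`, `v`, `w` in which `u` has degree two, and `v`, `w` have degree three. -/
structure IsTip (G : Graph α β) (e f g s t : β) (u v w b c : α) : Prop where
  top : G.IsStarTwo u e v g w
  left : G.IsStarThree v e u f w s b
  right : G.IsStarThree w g u f v t c
  ne_left : c ≠ v
  ne_top : c ≠ u
  ne_top' : b ≠ u
  ne_right : b ≠ w

namespace IsTip

variable (h : G.IsTip e f g s t u v w b c)
include h

lemma edges_ne [G.Loopless] : e ≠ f ∧ e ≠ g ∧ e ≠ s ∧ e ≠ t ∧ f ≠ g ∧ f ≠ s ∧ f ≠ t ∧ g ≠ s ∧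
    g ≠ t ∧ s ≠ t := by
  refine ⟨h.left.ne₁₂, h.top.ne, h.left.ne₁₃, ?_, h.right.ne₁₂.symm, h.left.ne₂₃, h.right.ne₂₃, ?_,
    h.right.ne₁₃, ?_⟩
  · rintro rfl
    obtain h' | h' := h.right.trd.inc_right.eq_or_eq_of_isLink h.left.fst
    exacts [h.ne_left h', h.ne_top h']
  · rintro rfl
    obtain h' | h' := h.right.fst.inc_left.eq_or_eq_of_isLink h.left.trd
    exacts [h.left.snd.ne h'.symm, h.ne_right h'.symm]
  · rintro rfl
    obtain h' | h' := h.right.trd.inc_left.eq_or_eq_of_isLink h.left.trd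
    exacts [h.left.snd.ne h'.symm, h.ne_right h'.symm]

lemma mem_iff (k : β) :
    k ∈ ({e, f, g, t} : Set β) ↔ ∃ y ∈ ({u, w} : Set α), G.Inc k y := by
  simp only [mem_insert_iff, mem_singleton_iff, exists_eq_or_imp, exists_eq_left]
  constructor
  · rintro (rfl | rfl | rfl | rfl)
    exacts [.inl h.top.left.inc_left, .inr h.right.snd.inc_left, .inr h.right.fst.inc_left,
      .inr h.right.trd.inc_left]
  · rintro (hk | hk)
    · have := h.top.eq_or_eq k hk
      tauto
    · have := h.right.eq_or_eq k hk
      tauto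

lemma edgeSet_banana_subset : E(banana v c {t}) ⊆ E(G) := by
  simpa using h.right.trd.edge_mem

lemma vertexSet_banana_subset [G.Loopless] : V(banana v c {t}) ⊆ V(G) \ {u, w} := by
  have h1 := h.top.left.right_mem
  have h2 := h.right.trd.right_mem
  have h3 := h.top.left.ne.symm
  have h4 := h.left.snd.ne
  have h5 := h.right.trd.ne.symm
  simp [insert_subset_iff, h1, h2, h3, h4, h5, h.ne_top]

lemma edgeSet_rewire_eq [G.Loopless] :
    E(G.rewire {u, w} (banana v c {t})) = E(G) \ {e, f, g} := by
  obtain ⟨hef, heg, hes, het, hfg, hfs, hft, hgs, hgt, hst⟩ := h.edges_ne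
  rw [edgeSet_rewire h.mem_iff (by simp)]
  have := h.right.trd.edge_mem
  ext k
  simp
  grind

lemma degree_rewire [G.Loopless] (hE : E(G).Finite) (hyu : y ≠ u) (hyw : y ≠ w) :
    (y = v → (G.rewire {u, w} (banana v c {t})).degree y = 2) ∧
      (y ≠ v → (G.rewire {u, w} (banana v c {t})).degree y = G.degree y) := by
  have hd := Graph.degree_rewire (W := {u, w}) (N := banana v c {t}) hE h.edgeSet_banana_subset
    h.mem_iff (by simp) y
  have he := h.top.left.inc_iff (z := y)
  have hf := h.right.snd.inc_iff (z := y)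
  have hg := h.right.fst.inc_iff (z := y)
  have ht := h.right.trd.inc_iff (z := y)
  obtain ⟨hef, -⟩ := h.edges_ne
  have hmem : ∀ k, k ∈ G.incidenceSet y ∩ {e, f, g, t} ↔
      ((k = e ∨ k = f) ∧ y = v) ∨ (k = t ∧ y = c) := by
    intro k
    simp only [mem_inter_iff, mem_incidenceSet, mem_insert_iff, mem_singleton_iff]
    grind
  have hcv := h.ne_left
  by_cases hyv : y = v
  · subst hyv
    have : G.incidenceSet y ∩ {e, f, g, t} = {e, f} := by
      ext k
      rw [hmem, mem_insert_iff, mem_singleton_iff]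
      grind
    rw [this, ncard_pair hef, degree_banana_left, h.left.degree_eq] at hd
    exact ⟨fun _ ↦ by omega, fun h ↦ absurd rfl h⟩
  refine ⟨fun h ↦ absurd h hyv, fun _ ↦ ?_⟩
  by_cases hyc : y = c
  · have : G.incidenceSet y ∩ {e, f, g, t} = {t} := by
      ext k
      rw [hmem, mem_singleton_iff]
      tauto
    have hNy : (banana v c {t}).degree y = 1 := hyc ▸ degree_banana_right v y t
    rw [this, ncard_singleton, hNy] at hd
    omega
  · have : G.incidenceSet y ∩ {e, f, g, t} = ∅ := by
      ext k
      rw [hmem, mem_empty_iff_false]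
      tauto
    rw [this, ncard_empty, degree_banana_of_ne hyv hyc] at hd
    omega

/-- The triangle shrinks to `v`, which keeps `s` and receives `t`. Having degree two there, `v`
makes every cycle through the new edge separating. -/
lemma isSepCycle_rewire (hS : G.IsSepCycle 2 3) :
    (G.rewire {u, w} (banana v c {t})).IsSepCycle 2 3 := by
  have := hS.loopless
  have hNE := h.edgeSet_banana_subset
  have hNV := h.vertexSet_banana_subset
  have hE := hS.finite_edgeSet
  have hvc := h.ne_left.symm
  have := banana_loopless hvc {t}
  have hN : (banana v c {t}).IsLink t v c := by simp
  have hvV : v ∈ V(G) \ {u, w} := hNV (by simp)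
  have hcV : c ∈ V(G) \ {u, w} := hNV (by simp)
  refine hS.rewire hNE hNV ?_ ?_ ?_ ?_
  · refine isConnected_rewire hS.connected hNV ⟨v, hvV⟩ fun P hP ↦ ?_
    obtain ⟨Q, hQ, hQP⟩ := exists_iff_of_mem_of_notMem {u, w} (fun _ ↦ P v) P
    refine ⟨Q, fun k y z hk ↦ ?_, fun y hy ↦ hQP y hy.2⟩
    have hPvc : P v ↔ P c := hP (.inr hN)
    have hQv := hQP v hvV.2
    have hQc := hQP c hcV.2
    have hQu := hQ u (by simp)
    have hQw := hQ w (by simp)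
    by_cases hkK : k ∈ ({e, f, g, t} : Set β)
    · obtain rfl | rfl | rfl | rfl := hkK
      · exact h.top.left.iff_of_iff (hQu.trans hQv.symm) hk
      · exact h.right.snd.iff_of_iff (hQw.trans hQv.symm) hk
      · exact h.right.fst.iff_of_iff (hQw.trans hQu.symm) hk
      · exact h.right.trd.iff_of_iff (hQw.trans (hPvc.trans hQc.symm)) hk
    · exact hP.iff_of_rewire h.mem_iff (by simp) hQP hkK hk
  · intro P hP
    have h1 := hP e u v h.top.left (by simp)
    have h2 := hP f w v h.right.snd (by simp)
    have h3 := hP t w c h.right.trd (by simp)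
    refine ⟨fun k y z hk ↦ ?_, ?_⟩
    · obtain rfl : k = t := by simpa using hk.edge_mem
      exact hN.iff_of_iff (h2.symm.trans h3) hk
    · rintro y (rfl | rfl)
      exacts [⟨v, hvV, h1⟩, ⟨v, hvV, h2⟩]
  · rintro y ⟨hy, hyW⟩
    simp only [mem_insert_iff, mem_singleton_iff, not_or] at hyW
    have h1 := h.degree_rewire hE hyW.1 hyW.2
    have h2 := hS.le_degree y hy
    have h3 := hS.degree_le y hy
    by_cases hyv : y = v
    · rw [h1.1 hyv]
      omega
    · rw [h1.2 hyv]
      exact ⟨h2, h3⟩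
  · intro C hC hcyc hdisj
    have htC : t ∈ E(C) := by simpa using hdisj
    have hl : C.IsLink t v c := (hC.isLink_iff htC).2 (.inr hN)
    refine hcyc.not_isConnected_deleteEdges hC (hE.subset (edgeSet_rewire_subset hNE))
      ?_ hl.left_mem ?_
    · rw [vertexSet_rewire hNV]
      exact ⟨v, hvV, c, hcV, hvc⟩
    · rw [(h.degree_rewire hE h.top.left.ne.symm h.left.snd.ne).1 rfl]

lemma notMem_of_isMatching [G.Loopless]
    (hM : (G.rewire {u, w} (banana v c {t})).IsMatching M) : e ∉ M ∧ f ∉ M ∧ g ∉ M := by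
  have hM := hM.1
  rw [h.edgeSet_rewire_eq] at hM
  exact ⟨fun h ↦ (hM h).2 (by simp), fun h ↦ (hM h).2 (by simp), fun h ↦ (hM h).2 (by simp)⟩

lemma ncard_insert_add_ncard (hS : G.IsSepCycle 2 3)
    (hM : (G.rewire {u, w} (banana v c {t})).IsCotreeMatching M) {k : β} (hk : k ∉ M) :
    (insert k M).ncard + V(G).ncard = E(G).ncard + 1 := by
  have := hS.loopless
  have hE := hS.finite_edgeSet
  obtain ⟨hef, heg, hes, het, hfg, hfs, hft, hgs, hgt, hst⟩ := h.edges_ne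
  have h1 := hM.ncard_add_ncard
  have h2 := ncard_sdiff_add_ncard_of_subset (s := {e, f, g}) (t := E(G)) (by
    simp [insert_subset_iff, h.top.left.edge_mem, h.right.fst.edge_mem, h.right.snd.edge_mem]) hE
  have h3 := ncard_sdiff_add_ncard_of_subset (s := {u, w}) (t := V(G)) (by
    simp [insert_subset_iff, h.top.left.left_mem, h.right.snd.left_mem]) hS.finite_vertexSet
  rw [ncard_pair h.top.right.ne] at h3
  rw [ncard_eq_three.2 ⟨e, f, g, hef, heg, hfg, rfl⟩] at h2
  rw [vertexSet_rewire h.vertexSet_banana_subset, h.edgeSet_rewire_eq] at h1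
  rw [ncard_insert_of_notMem hk
    (hE.subset (hM.isMatching.1.trans (edgeSet_rewire_subset h.edgeSet_banana_subset)))]
  omega

/-- Both `s` and `t` meet `v` in the rewired graph, so `t` is unmatched, which leaves `u` and `w`
free for `g`. The tree receives `e` and `f`. -/
lemma isCotreeMatching_insert_right (hS : G.IsSepCycle 2 3)
    (hM : (G.rewire {u, w} (banana v c {t})).IsCotreeMatching M) (hs : s ∈ M) :
    G.IsCotreeMatching (insert g M) := by
  have := hS.loopless
  have hNV := h.vertexSet_banana_subset
  have hN : (banana v c {t}).IsLink t v c := by simp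
  have hvV : v ∈ V(G) \ {u, w} := hNV (by simp)
  obtain ⟨hef, heg, hes, het, hfg, hfs, hft, hgs, hgt, hst⟩ := h.edges_ne
  obtain ⟨heM, hfM, hgM⟩ := h.notMem_of_isMatching hM.isMatching
  have ht : t ∉ M := fun ht ↦ by
    refine hst (hM.isMatching.2 s hs t ht v ?_ ?_)
    · rw [rewire_inc_iff_of_notMem (by simpa using hst) (hM.isMatching.1 hs)]
      exact h.left.trd.inc_left
    · exact (rewire_inc_of_mem (by simp)).2 hN.inc_left
  have hM0' : M \ E(banana v c {t}) = M := by simpa using ht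
  refine ⟨?_, ?_, h.ncard_insert_add_ncard hS hM hgM⟩
  · have hM0 := hM.isMatching.sdiff_of_rewire h.edgeSet_banana_subset
    have hunc := fun x hx ↦ hM.isMatching.not_inc_of_mem_rewire (x := x) hx
    rw [hM0'] at hunc hM0
    exact hM0.insert h.top.right (hunc u (by simp)) (hunc w (by simp))
  · refine hM.isConnected.of_rewire hNV (pair_comm w u ▸ notMem_insert_of_inc
      h.right.fst.inc_left) fun P hP ↦ ?_
    have h1 : P u ↔ P v := hP (e := e) (by simp [h.top.left, heg, heM])
    have h2 : P w ↔ P v := hP (e := f) (by simp [h.right.snd, hfg, hfM])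
    have h3 : P w ↔ P c := hP (e := t) (by simp [h.right.trd, hgt.symm, ht])
    refine ⟨fun k y z hk _ ↦ ?_, ?_⟩
    · obtain rfl : k = t := by simpa using hk.edge_mem
      exact hN.iff_of_iff (h2.symm.trans h3) hk
    · rintro y (rfl | rfl)
      exacts [⟨v, hvV, h1⟩, ⟨v, hvV, h2⟩]

/-- With `s` unmatched, `v` is free in `G` even if `t` is matched, since `t` ends at `w` there. So
`e` joins the matching, and `f` and `g` the tree. -/
lemma isCotreeMatching_insert_left (hS : G.IsSepCycle 2 3)
    (hM : (G.rewire {u, w} (banana v c {t})).IsCotreeMatching M) (hs : s ∉ M) :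
    G.IsCotreeMatching (insert e M) := by
  have := hS.loopless
  have hNV := h.vertexSet_banana_subset
  have hN : (banana v c {t}).IsLink t v c := by simp
  have hvV : v ∈ V(G) \ {u, w} := hNV (by simp)
  obtain ⟨hef, heg, hes, het, hfg, hfs, hft, hgs, hgt, hst⟩ := h.edges_ne
  obtain ⟨heM, hfM, hgM⟩ := h.notMem_of_isMatching hM.isMatching
  refine ⟨?_, ?_, h.ncard_insert_add_ncard hS hM heM⟩
  · have hM0 := hM.isMatching.sdiff_of_rewire h.edgeSet_banana_subset
    rw [edgeSet_banana] at hM0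
    have hv0 : ∀ k ∈ M, ¬ G.Inc k v := by
      rintro k hk hkv
      obtain rfl | rfl | rfl := h.left.eq_or_eq k hkv
      exacts [heM hk, hfM hk, hs hk]
    have hu0 : ∀ k ∈ M, ¬ G.Inc k u := by
      rintro k hk hku
      obtain rfl | rfl := h.top.eq_or_eq k hku
      exacts [heM hk, hgM hk]
    by_cases ht : t ∈ M
    · have := hM0.insert h.right.trd
        (by simpa using hM.isMatching.not_inc_of_mem_rewire (x := w) (by simp))
        (by simpa using hM.isMatching.not_inc_of_inc_rewire ht hN.inc_right)
      rw [insert_sdiff_singleton, insert_eq_of_mem ht] at this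
      exact this.insert h.top.left hu0 hv0
    · rw [sdiff_singleton_eq_self ht] at hM0
      exact hM0.insert h.top.left hu0 hv0
  · refine hM.isConnected.of_rewire hNV (notMem_insert_of_inc h.top.left.inc_left)
      fun P hP ↦ ?_
    have h1 : P w ↔ P u := hP (e := g) (by simp [h.right.fst, heg.symm, hgM])
    have h2 : P w ↔ P v := hP (e := f) (by simp [h.right.snd, hef.symm, hfM])
    refine ⟨fun k y z hk hkM ↦ ?_, ?_⟩
    · obtain rfl : k = t := by simpa using hk.edge_mem
      have h3 : P w ↔ P c := hP (e := k) (by simp [h.right.trd, het.symm, hkM])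
      exact hN.iff_of_iff (h2.symm.trans h3) hk
    · rintro y (rfl | rfl)
      exacts [⟨v, hvV, h1.symm.trans h2⟩, ⟨v, hvV, h2⟩]

lemma false_of_isMinimumCounterexample (hG : G.IsMinimumCounterexample) : False := by
  have hS := hG.isSepCycle
  have := hS.loopless
  obtain ⟨M, hM⟩ := hG.exists_isCotreeMatching (h.isSepCycle_rewire hS)
    (phi_rewire_lt hS.finite_vertexSet hS.finite_edgeSet h.edgeSet_banana_subset
      h.vertexSet_banana_subset (x := u) (by simp) h.top.left.left_mem)
  by_cases hs : s ∈ M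
  · exact hG.not_isCotreeMatching (h.isCotreeMatching_insert_right hS hM hs)
  · exact hG.not_isCotreeMatching (h.isCotreeMatching_insert_left hS hM hs)

end IsTip

lemma IsMinimumCounterexample.false_of_triangle_of_degree_eq_two (hG : G.IsMinimumCounterexample)
    (he : G.IsLink e u v) (hf : G.IsLink f v w) (hg : G.IsLink g w u) (hu : G.degree u = 2) :
    False := by
  have := hG.simple
  have heg : e ≠ g := by
    rintro rfl
    exact hf.ne (he.right_unique hg.symm)
  have hef : e ≠ f := by
    rintro rfl
    exact hg.ne (he.symm.right_unique hf).symm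
  have hgf : g ≠ f := by
    rintro rfl
    exact he.ne (hg.right_unique hf.symm)
  have hv := hG.degree_eq_three_of_isLink he hu
  have hw := hG.degree_eq_three_of_isLink hg.symm hu
  obtain ⟨g', w', hst⟩ := he.exists_isStarTwo hu
  obtain rfl : g = g' := (hst.eq_or_eq g hg.inc_right).resolve_left heg.symm
  obtain rfl : w = w' := hg.symm.right_unique hst.right
  obtain ⟨s, b, hv⟩ := he.symm.exists_isStarThree_of_ne hf hef hv
  obtain ⟨t, c, hw⟩ := hg.exists_isStarThree_of_ne hf.symm hgf hw
  refine IsTip.false_of_isMinimumCounterexample ⟨hst, hv, hw, ?_, ?_, ?_, ?_⟩ hG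
  · rintro rfl
    exact hw.ne₂₃ (hw.snd.eq hw.trd)
  · rintro rfl
    exact hw.ne₁₃ (hw.fst.eq hw.trd)
  · rintro rfl
    exact hv.ne₁₃ (hv.fst.eq hv.trd)
  · rintro rfl
    exact hv.ne₂₃ (hv.snd.eq hv.trd)

lemma IsMinimumCounterexample.false_of_triangle (hG : G.IsMinimumCounterexample)
    (he : G.IsLink e u v) (hf : G.IsLink f v w) (hg : G.IsLink g w u) : False := by
  have hS := hG.isSepCycle
  have := hG.simple
  obtain hu | hu := hS.degree_eq he.left_mem
  · exact hG.false_of_triangle_of_degree_eq_two he hf hg hu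
  obtain hv | hv := hS.degree_eq hf.left_mem
  · exact hG.false_of_triangle_of_degree_eq_two hf hg he hv
  obtain hw | hw := hS.degree_eq hg.left_mem
  · exact hG.false_of_triangle_of_degree_eq_two hg he hf hw
  exact hS.false_of_triangle hG.isBridgeless he hf hg hu hv hw

end

/-! ### Four-cycles with a vertex of degree two. -/

section


variable {α β : Type*} {G H N : Graph α β} {P Q : α → Prop} {x y z u v w a b c d : α}
  {e f g p q r s t i j k : β} {D M M' K : Set β} {W : Set α}

lemma IsLink.ne_of_ne (he : G.IsLink e x y) (hf : G.IsLink f a b) (hxa : x ≠ a) (hxb : x ≠ b) :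
    e ≠ f := by
  rintro rfl
  exact (he.left_eq_or_eq hf).elim hxa hxb

lemma notMem_insert_of_rewire {l : β} (hKW : G.Inc l x) (hx : x ∈ W)
    (hM : ∀ e y z, G.IsLink e y z → e ∉ E(N) → y ∉ W → z ∉ W → e ∉ M' → e ∉ M) :
    ∀ e y z, G.IsLink e y z → e ∉ E(N) → y ∉ W → z ∉ W → e ∉ M' → e ∉ insert l M := by
  rintro e y z he heN hy hz heM (rfl | h)
  · obtain rfl | rfl := hKW.eq_or_eq_of_isLink he
    exacts [hy hx, hz hx]
  · exact hM e y z he heN hy hz heM h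

/-- A cycle `u`, `v`, `z`, `w` of length four in which only `u` has degree two. -/
structure IsSquareTip (G : Graph α β) (p q r s i j k : β) (u v w z b c d : α) : Prop where
  top : G.IsStarTwo u p v q w
  left : G.IsStarThree v p u r z i b
  right : G.IsStarThree w q u s z j c
  bot : G.IsStarThree z r v s w k d
  ne : v ≠ w
  ne_bot : u ≠ z
  left_notMem : b ∉ ({u, v, w, z} : Set α)
  right_notMem : c ∉ ({u, v, w, z} : Set α)
  bot_notMem : d ∉ ({u, v, w, z} : Set α)
  left_ne : b ≠ d
  right_ne : c ≠ d
  degree_eq : G.degree b = 3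

namespace IsSquareTip

variable (h : G.IsSquareTip p q r s i j k u v w z b c d)
include h

lemma ncard_eq [G.Loopless] : ({u, v, w, z} : Set α).ncard = 4 := by
  have h1 := h.top.left.ne
  have h2 := h.top.right.ne
  have h3 := h.left.snd.ne
  have h4 := h.right.snd.ne
  have h5 := h.ne
  have h6 := h.ne_bot
  rw [ncard_insert_of_notMem (by simp [h1, h2, h6]), ncard_insert_of_notMem (by simp [h5, h3]),
    ncard_pair h4]

lemma edges_ne [G.Loopless] : p ≠ q ∧ p ≠ r ∧ p ≠ s ∧ p ≠ i ∧ p ≠ j ∧ p ≠ k ∧ q ≠ r ∧ q ≠ s ∧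
    q ≠ i ∧ q ≠ j ∧ q ≠ k ∧ r ≠ s ∧ r ≠ i ∧ r ≠ j ∧ r ≠ k ∧ s ≠ i ∧ s ≠ j ∧ s ≠ k ∧ i ≠ j ∧
    i ≠ k ∧ j ≠ k := by
  have huv := h.top.left.ne
  have huw := h.top.right.ne
  have hvz := h.left.snd.ne
  have hwz := h.right.snd.ne
  have hvw := h.ne
  have huz := h.ne_bot
  obtain ⟨hb1, hb2, hb3, hb4⟩ : b ≠ u ∧ b ≠ v ∧ b ≠ w ∧ b ≠ z := by simpa using h.left_notMem
  obtain ⟨hc1, hc2, hc3, hc4⟩ : c ≠ u ∧ c ≠ v ∧ c ≠ w ∧ c ≠ z := by simpa using h.right_notMem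
  obtain ⟨hd1, hd2, hd3, hd4⟩ : d ≠ u ∧ d ≠ v ∧ d ≠ w ∧ d ≠ z := by simpa using h.bot_notMem
  refine ⟨h.top.ne, h.left.ne₁₂, h.top.left.ne_of_ne h.right.snd huw huz, h.left.ne₁₃,
    h.top.left.ne_of_ne h.right.trd huw hc1.symm, h.top.left.ne_of_ne h.bot.trd huz hd1.symm,
    h.top.right.ne_of_ne h.left.snd huv huz, h.right.ne₁₂,
    h.top.right.ne_of_ne h.left.trd huv hb1.symm, h.right.ne₁₃,
    h.top.right.ne_of_ne h.bot.trd huz hd1.symm, h.bot.ne₁₂, h.left.ne₂₃,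
    h.left.snd.ne_of_ne h.right.trd hvw hc2.symm, h.bot.ne₁₃,
    h.right.snd.ne_of_ne h.left.trd hvw.symm hb3.symm, h.right.ne₂₃, h.bot.ne₂₃,
    h.left.trd.ne_of_ne h.right.trd hvw hc2.symm, h.left.trd.ne_of_ne h.bot.trd hvz hd2.symm,
    h.right.trd.ne_of_ne h.bot.trd hwz hd3.symm⟩

lemma ncard_edges_eq [G.Loopless] : ({p, q, r, s, i, k} : Set β).ncard = 6 := by
  obtain ⟨hpq, hpr, hps, hpi, hpj, hpk, hqr, hqs, hqi, hqj, hqk, hrs, hri, hrj, hrk, hsi, hsj,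
    hsk, hij, hik, hjk⟩ := h.edges_ne
  rw [ncard_insert_of_notMem (by simp [hpq, hpr, hps, hpi, hpk]),
    ncard_insert_of_notMem (by simp [hqr, hqs, hqi, hqk]),
    ncard_insert_of_notMem (by simp [hrs, hri, hrk]),
    ncard_insert_of_notMem (by simp [hsi, hsk]), ncard_pair hik]

lemma mem_iff (l : β) :
    l ∈ ({p, q, r, s, i, j, k} : Set β) ↔ ∃ y ∈ ({u, v, w, z} : Set α), G.Inc l y := by
  simp only [mem_insert_iff, mem_singleton_iff, exists_eq_or_imp, exists_eq_left]
  constructor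
  · rintro (rfl | rfl | rfl | rfl | rfl | rfl | rfl)
    exacts [.inl h.top.left.inc_left, .inl h.top.right.inc_left, .inr (.inl h.left.snd.inc_left),
      .inr (.inr (.inl h.right.snd.inc_left)), .inr (.inl h.left.trd.inc_left),
      .inr (.inr (.inl h.right.trd.inc_left)), .inr (.inr (.inr h.bot.trd.inc_left))]
  · rintro (hl | hl | hl | hl)
    · have := h.top.eq_or_eq l hl
      tauto
    · have := h.left.eq_or_eq l hl
      tauto
    · have := h.right.eq_or_eq l hl
      tauto
    · have := h.bot.eq_or_eq l hl
      tauto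

lemma edgeSet_banana_subset : E(banana c d {j}) ⊆ E(G) := by
  simpa using h.right.trd.edge_mem

lemma vertexSet_banana_subset : V(banana c d {j}) ⊆ V(G) \ {u, v, w, z} := by
  rintro y (rfl | rfl)
  exacts [⟨h.right.trd.right_mem, h.right_notMem⟩, ⟨h.bot.trd.right_mem, h.bot_notMem⟩]

lemma edgeSet_rewire_eq [G.Loopless] :
    E(G.rewire {u, v, w, z} (banana c d {j})) = E(G) \ {p, q, r, s, i, k} := by
  obtain ⟨hpq, hpr, hps, hpi, hpj, hpk, hqr, hqs, hqi, hqj, hqk, hrs, hri, hrj, hrk, hsi, hsj,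
    hsk, hij, hik, hjk⟩ := h.edges_ne
  rw [edgeSet_rewire h.mem_iff (by simp)]
  have := h.right.trd.edge_mem
  ext l
  by_cases hl : l = j
  · subst hl
    simp [hpj.symm, hqj.symm, hrj.symm, hsj.symm, hij.symm, hjk, this]
  · simp [hl]

/-- Only `b` loses an edge, namely `i`, without compensation, and its degree three allows this. The
possibility `b = c` is not excluded. -/
lemma degree_rewire [G.Loopless] (hE : E(G).Finite) (hy : y ∉ ({u, v, w, z} : Set α)) :
    2 ≤ (G.rewire {u, v, w, z} (banana c d {j})).degree y ∧ y = b ∨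
      (G.rewire {u, v, w, z} (banana c d {j})).degree y = G.degree y := by
  have hd := Graph.degree_rewire (W := {u, v, w, z}) (N := banana c d {j}) hE
    h.edgeSet_banana_subset h.mem_iff (by simp) y
  have hmem : ∀ l, l ∈ G.incidenceSet y ∩ {p, q, r, s, i, j, k} ↔
      (l = i ∧ y = b) ∨ (l = j ∧ y = c) ∨ (l = k ∧ y = d) := by
    intro l
    simp only [mem_insert_iff, mem_singleton_iff, not_or] at hy
    obtain ⟨hyu, hyv, hyw, hyz⟩ := hy
    constructor
    · rintro ⟨hl, rfl | rfl | rfl | rfl | rfl | rfl | rfl⟩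
      · exact absurd (hl.eq_of_isLink_of_ne_left h.top.left hyu) hyv
      · exact absurd (hl.eq_of_isLink_of_ne_left h.top.right hyu) hyw
      · exact absurd (hl.eq_of_isLink_of_ne_left h.left.snd hyv) hyz
      · exact absurd (hl.eq_of_isLink_of_ne_left h.right.snd hyw) hyz
      · exact .inl ⟨rfl, hl.eq_of_isLink_of_ne_left h.left.trd hyv⟩
      · exact .inr (.inl ⟨rfl, hl.eq_of_isLink_of_ne_left h.right.trd hyw⟩)
      · exact .inr (.inr ⟨rfl, hl.eq_of_isLink_of_ne_left h.bot.trd hyz⟩)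
    · rintro (⟨rfl, rfl⟩ | ⟨rfl, rfl⟩ | ⟨rfl, rfl⟩)
      · exact ⟨h.left.trd.inc_right, by simp⟩
      · exact ⟨h.right.trd.inc_right, by simp⟩
      · exact ⟨h.bot.trd.inc_right, by simp⟩
  have hbd := h.left_ne
  have hcd := h.right_ne
  by_cases hyb : y = b
  · refine .inl ⟨?_, hyb⟩
    have hdy : G.degree y = 3 := hyb ▸ h.degree_eq
    have hyd : y ≠ d := hyb ▸ hbd
    by_cases hyc : y = c
    · have : (G.incidenceSet y ∩ {p, q, r, s, i, j, k}).ncard ≤ 2 := by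
        refine (ncard_le_ncard (t := {i, j}) (fun l hl ↦ ?_)).trans ((ncard_insert_le _ _).trans (by simp))
        have := (hmem l).1 hl
        simp
        tauto
      have hNy : (banana c d {j}).degree y = 1 := hyc ▸ degree_banana_left y d j
      omega
    · have : (G.incidenceSet y ∩ {p, q, r, s, i, j, k}).ncard ≤ 1 := by
        refine (ncard_le_ncard (t := {i}) (fun l hl ↦ ?_)).trans (ncard_singleton _).le
        have := (hmem l).1 hl
        simp
        tauto
      omega
  right
  by_cases hyc : y = c
  · have : G.incidenceSet y ∩ {p, q, r, s, i, j, k} = {j} := by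
      ext l
      rw [hmem, mem_singleton_iff]
      have : y ≠ d := hyc ▸ hcd
      tauto
    have hNy : (banana c d {j}).degree y = 1 := hyc ▸ degree_banana_left y d j
    rw [this, ncard_singleton] at hd
    omega
  by_cases hyd : y = d
  · have : G.incidenceSet y ∩ {p, q, r, s, i, j, k} = {k} := by
      ext l
      rw [hmem, mem_singleton_iff]
      tauto
    have hNy : (banana c d {j}).degree y = 1 := hyd ▸ degree_banana_right c y j
    rw [this, ncard_singleton] at hd
    omega
  · have : G.incidenceSet y ∩ {p, q, r, s, i, j, k} = ∅ := by
      ext l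
      rw [hmem, mem_empty_iff_false]
      tauto
    rw [this, ncard_empty, degree_banana_of_ne hyc hyd] at hd
    omega

/-- The new edge from `c` to `d` is replaced by the path through `w` and `z` with edges `j`, `s`,
`k`. -/
lemma isLeafless_union [G.Loopless] (hD : (G.rewire {u, v, w, z} (banana c d {j})).IsLeafless D)
    (hj : j ∈ D) : G.IsLeafless (D ∪ {s, k}) := by
  have hN : (banana c d {j}).IsLink j c d := by simp
  obtain ⟨hpq, hpr, hps, hpi, hpj, hpk, hqr, hqs, hqi, hqj, hqk, hrs, hri, hrj, hrk, hsi, hsj,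
    hsk, hij, hik, hjk⟩ := h.edges_ne
  have hkD : k ∉ D := fun h' ↦ by
    have := hD.subset h'
    rw [h.edgeSet_rewire_eq] at this
    exact this.2 (by simp)
  have hjN : ∀ e, e ∉ E(banana c d {j}) ↔ e ≠ j := by simp
  have hinc : ∀ e ∈ D, e ≠ j → ∀ x,
      ((G.rewire {u, v, w, z} (banana c d {j})).Inc e x ↔ G.Inc e x) := fun e he hej x ↦
    rewire_inc_iff_of_notMem ((hjN e).2 hej) (hD.subset he)
  have hjinc : ∀ x, (G.rewire {u, v, w, z} (banana c d {j})).Inc j x ↔ x = c ∨ x = d := fun x ↦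
    (rewire_inc_of_mem (by simp)).trans hN.inc_iff
  refine ⟨union_subset (hD.subset.trans (edgeSet_rewire_subset h.edgeSet_banana_subset)) ?_,
    ⟨j, .inl hj⟩, ?_⟩
  · simp [insert_subset_iff, h.right.snd.edge_mem, h.bot.trd.edge_mem]
  rintro e (he | rfl | rfl) x hx
  · by_cases hej : e = j
    · subst hej
      obtain rfl | rfl := hx.eq_or_eq_of_isLink h.right.trd
      · exact ⟨s, by simp, hsj, h.right.snd.inc_left⟩
      · obtain ⟨f, hf, hfe, hfx⟩ := hD.exists_ne e he x ((hjinc x).2 (.inl rfl))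
        exact ⟨f, .inl hf, hfe, (hinc f hf hfe x).1 hfx⟩
    · obtain ⟨f, hf, hfe, hfx⟩ := hD.exists_ne e he x ((hinc e he hej x).2 hx)
      by_cases hfj : f = j
      · subst hfj
        obtain rfl | rfl := (hjinc x).1 hfx
        · exact ⟨f, .inl hf, hfe, h.right.trd.inc_right⟩
        · exact ⟨k, by simp, fun h' ↦ hkD (h' ▸ he), h.bot.trd.inc_right⟩
      · exact ⟨f, .inl hf, hfe, (hinc f hf hfj x).1 hfx⟩
  · obtain rfl | rfl := hx.eq_or_eq_of_isLink h.right.snd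
    · exact ⟨j, .inl hj, hsj.symm, h.right.trd.inc_left⟩
    · exact ⟨k, by simp, hsk.symm, h.bot.trd.inc_left⟩
  · obtain rfl | rfl := hx.eq_or_eq_of_isLink h.bot.trd
    · exact ⟨s, by simp, hsk, h.right.snd.inc_right⟩
    · obtain ⟨f, hf, hfe, hfx⟩ := hD.exists_ne j hj x ((hjinc x).2 (.inr rfl))
      exact ⟨f, .inl hf, fun h' ↦ hkD (h' ▸ hf), (hinc f hf hfe x).1 hfx⟩

/-- No vertex of degree two need lie on the cycle here. Instead the new edge is expanded to a path
of `G`; after deleting the result, the square still hangs together by `q`, `p`, `r` and is attached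
to `b` by `i`, so connectivity would carry over to `G`. -/
lemma not_isConnected_rewire (hS : G.IsSepCycle 2 3)
    (hD : (G.rewire {u, v, w, z} (banana c d {j})).IsLeafless D) (hj : j ∈ D) :
    ¬ ((G.rewire {u, v, w, z} (banana c d {j})).deleteEdges D).IsConnected := by
  have := hS.loopless
  intro hcon
  obtain ⟨hpq, hpr, hps, hpi, hpj, hpk, hqr, hqs, hqi, hqj, hqk, hrs, hri, hrj, hrk, hsi, hsj,
    hsk, hij, hik, hjk⟩ := h.edges_ne
  have hDE := hD.subset
  rw [h.edgeSet_rewire_eq] at hDE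
  have hpD : p ∉ D := fun h' ↦ (hDE h').2 (by simp)
  have hqD : q ∉ D := fun h' ↦ (hDE h').2 (by simp)
  have hrD : r ∉ D := fun h' ↦ (hDE h').2 (by simp)
  have hiD : i ∉ D := fun h' ↦ (hDE h').2 (by simp)
  refine hS.not_isConnected_deleteEdges (h.isLeafless_union hD hj) ?_
  refine hcon.of_rewire h.vertexSet_banana_subset ?_ fun P hP ↦ ⟨?_, ?_⟩
  · rintro e x y he heN hx hy heD (h' | rfl | rfl)
    · exact heD h'
    · have := h.right.snd.inc_left.eq_or_eq_of_isLink he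
      simp only [mem_insert_iff, mem_singleton_iff, not_or] at hx hy
      tauto
    · have := h.bot.trd.inc_left.eq_or_eq_of_isLink he
      simp only [mem_insert_iff, mem_singleton_iff, not_or] at hx hy
      tauto
  · intro e x y he heD
    obtain rfl : e = j := by simpa using he.edge_mem
    exact absurd hj heD
  · have h1 : P u ↔ P v := hP (e := p) (by simp [h.top.left, hpD, hps, hpk])
    have h2 : P u ↔ P w := hP (e := q) (by simp [h.top.right, hqD, hqs, hqk])
    have h3 : P v ↔ P z := hP (e := r) (by simp [h.left.snd, hrD, hrs, hrk])
    have h4 : P v ↔ P b := hP (e := i) (by simp [h.left.trd, hiD, hsi.symm, hik])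
    have hbV : b ∈ V(G) \ {u, v, w, z} := ⟨h.left.trd.right_mem, h.left_notMem⟩
    rintro y (rfl | rfl | rfl | rfl)
    exacts [⟨b, hbV, h1.trans h4⟩, ⟨b, hbV, h4⟩, ⟨b, hbV, h2.symm.trans (h1.trans h4)⟩,
      ⟨b, hbV, h3.symm.trans h4⟩]

lemma isSepCycle_rewire (hS : G.IsSepCycle 2 3) (hB : G.IsBridgeless) :
    (G.rewire {u, v, w, z} (banana c d {j})).IsSepCycle 2 3 := by
  have := hS.loopless
  have hNE := h.edgeSet_banana_subset
  have hNV := h.vertexSet_banana_subset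
  have hE := hS.finite_edgeSet
  have := banana_loopless h.right_ne {j}
  have hN : (banana c d {j}).IsLink j c d := by simp
  have hcV : c ∈ V(G) \ {u, v, w, z} := hNV (by simp)
  have hdV : d ∈ V(G) \ {u, v, w, z} := hNV (by simp)
  refine hS.rewire hNE hNV ?_ ?_ ?_ ?_
  · refine isConnected_rewire hS.connected hNV ⟨c, hcV⟩ fun P hP ↦ ?_
    obtain ⟨Q, hQ, hQP⟩ := exists_iff_of_mem_of_notMem {u, v, w, z} (fun _ ↦ P c) P
    -- The edge `i` has no substitute in the rewired graph, but it is not a bridge.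
    refine ⟨Q, hB i Q fun l x y hl ↦ ?_, fun y hy ↦ hQP y hy.2⟩
    rw [deleteEdges_isLink] at hl
    have hPcd : P c ↔ P d := hP (.inr hN)
    have hQc := hQP c hcV.2
    have hQd := hQP d hdV.2
    have hQu := hQ u (by simp)
    have hQv := hQ v (by simp)
    have hQw := hQ w (by simp)
    have hQz := hQ z (by simp)
    by_cases hlK : l ∈ ({p, q, r, s, i, j, k} : Set β)
    · obtain rfl | rfl | rfl | rfl | rfl | rfl | rfl := hlK
      · exact h.top.left.iff_of_iff (hQu.trans hQv.symm) hl.1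
      · exact h.top.right.iff_of_iff (hQu.trans hQw.symm) hl.1
      · exact h.left.snd.iff_of_iff (hQv.trans hQz.symm) hl.1
      · exact h.right.snd.iff_of_iff (hQw.trans hQz.symm) hl.1
      · exact absurd rfl hl.2
      · exact h.right.trd.iff_of_iff (hQw.trans hQc.symm) hl.1
      · exact h.bot.trd.iff_of_iff (hQz.trans (hPcd.trans hQd.symm)) hl.1
    · exact hP.iff_of_rewire h.mem_iff (by simp) hQP hlK hl.1
  · intro P hP
    have h1 : P u ↔ P v := hP p u v h.top.left (by simp)
    have h2 : P u ↔ P w := hP q u w h.top.right (by simp)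
    have h3 : P v ↔ P z := hP r v z h.left.snd (by simp)
    have h4 : P w ↔ P c := hP j w c h.right.trd (by simp)
    have h5 : P z ↔ P d := hP k z d h.bot.trd (by simp)
    have h6 : P u ↔ P c := h2.trans h4
    refine ⟨fun l x y hl ↦ ?_, ?_⟩
    · obtain rfl : l = j := by simpa using hl.edge_mem
      exact hN.iff_of_iff (h6.symm.trans (h1.trans (h3.trans h5))) hl
    · rintro y (rfl | rfl | rfl | rfl)
      exacts [⟨c, hcV, h6⟩, ⟨c, hcV, h1.symm.trans h6⟩, ⟨c, hcV, h4⟩, ⟨d, hdV, h5⟩]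
  · rintro y ⟨hy, hyW⟩
    have h2 := hS.le_degree y hy
    have h3 := hS.degree_le y hy
    obtain ⟨h1, hyb⟩ | h1 := h.degree_rewire hE hyW
    · refine ⟨h1, ?_⟩
      have hd := Graph.degree_rewire (W := {u, v, w, z}) (N := banana c d {j}) hE
        hNE h.mem_iff (by simp) y
      have hi : 1 ≤ (G.incidenceSet y ∩ {p, q, r, s, i, j, k}).ncard := by
        refine (ncard_pos ((incidenceSet_finite hE y).subset inter_subset_left)).2 ⟨i, ?_, by simp⟩
        rw [hyb]
        exact h.left.trd.inc_right
      have hNd : (banana c d {j}).degree y ≤ 1 := by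
        rw [degree]
        refine (ncard_le_ncard (incidenceSet_subset_edgeSet _) (by simp)).trans ?_
        simp
      omega
    · rw [h1]
      exact ⟨h2, h3⟩
  · intro C hC hcyc hdisj
    exact h.not_isConnected_rewire hS (hcyc.isLeafless hC) (by simpa using hdisj)

lemma notMem_of_isMatching [G.Loopless]
    (hM : (G.rewire {u, v, w, z} (banana c d {j})).IsMatching M) :
    p ∉ M ∧ q ∉ M ∧ r ∉ M ∧ s ∉ M ∧ i ∉ M ∧ k ∉ M := by
  have hM := hM.1
  rw [h.edgeSet_rewire_eq] at hM
  exact ⟨fun h ↦ (hM h).2 (by simp), fun h ↦ (hM h).2 (by simp), fun h ↦ (hM h).2 (by simp),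
    fun h ↦ (hM h).2 (by simp), fun h ↦ (hM h).2 (by simp), fun h ↦ (hM h).2 (by simp)⟩

/-- Four vertices and six edges come back, so the matching grows by two edges. -/
lemma ncard_insert_add_ncard (hS : G.IsSepCycle 2 3)
    (hM : (G.rewire {u, v, w, z} (banana c d {j})).IsCotreeMatching M) {l m : β} (hl : l ∉ M)
    (hm : m ∉ M) (hlm : l ≠ m) :
    (insert l (insert m M)).ncard + V(G).ncard = E(G).ncard + 1 := by
  have := hS.loopless
  have hE := hS.finite_edgeSet
  have h1 := hM.ncard_add_ncard
  have h2 := ncard_sdiff_add_ncard_of_subset (s := {p, q, r, s, i, k}) (t := E(G)) (by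
    simp [insert_subset_iff, h.top.left.edge_mem, h.top.right.edge_mem, h.left.snd.edge_mem,
      h.right.snd.edge_mem, h.left.trd.edge_mem, h.bot.trd.edge_mem]) hE
  have h3 := ncard_sdiff_add_ncard_of_subset (s := {u, v, w, z}) (t := V(G)) (by
    simp [insert_subset_iff, h.top.left.left_mem, h.left.snd.left_mem, h.right.snd.left_mem,
      h.bot.trd.left_mem]) hS.finite_vertexSet
  rw [h.ncard_eq] at h3
  rw [h.ncard_edges_eq] at h2
  rw [vertexSet_rewire h.vertexSet_banana_subset, h.edgeSet_rewire_eq] at h1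
  have hfin : M.Finite :=
    hE.subset (hM.isMatching.1.trans (edgeSet_rewire_subset h.edgeSet_banana_subset))
  rw [ncard_insert_of_notMem (by simp [hl, hlm]) (hfin.insert m),
    ncard_insert_of_notMem hm hfin]
  omega

/-- The square becomes the path `b`, `v`, `z`, `w`, `u` hanging on `b`. The matched new edge
reserved `d`, which makes room for `k`. -/
lemma isCotreeMatching_of_mem (hS : G.IsSepCycle 2 3)
    (hM : (G.rewire {u, v, w, z} (banana c d {j})).IsCotreeMatching M) (hj : j ∈ M) :
    G.IsCotreeMatching (insert k (insert p M)) := by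
  have := hS.loopless
  have hNV := h.vertexSet_banana_subset
  have hN : (banana c d {j}).IsLink j c d := by simp
  obtain ⟨hpq, hpr, hps, hpi, hpj, hpk, hqr, hqs, hqi, hqj, hqk, hrs, hri, hrj, hrk, hsi, hsj,
    hsk, hij, hik, hjk⟩ := h.edges_ne
  obtain ⟨hpM, hqM, hrM, hsM, hiM, hkM⟩ := h.notMem_of_isMatching hM.isMatching
  refine ⟨?_, ?_, h.ncard_insert_add_ncard hS hM hkM hpM hpk.symm⟩
  · have huv := h.top.left.ne
    have huw := h.top.right.ne
    have hvz := h.left.snd.ne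
    have hwz := h.right.snd.ne
    have hvw := h.ne
    have huz := h.ne_bot
    obtain ⟨hc1, hc2, hc3, hc4⟩ : c ≠ u ∧ c ≠ v ∧ c ≠ w ∧ c ≠ z := by simpa using h.right_notMem
    obtain ⟨hd1, hd2, hd3, hd4⟩ : d ≠ u ∧ d ≠ v ∧ d ≠ w ∧ d ≠ z := by simpa using h.bot_notMem
    have hM0 := hM.isMatching.sdiff_of_rewire h.edgeSet_banana_subset
    have hunc := fun x hx ↦ hM.isMatching.not_inc_of_mem_rewire (x := x) hx
    have hc := hM.isMatching.not_inc_of_inc_rewire hj hN.inc_left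
    have hd := hM.isMatching.not_inc_of_inc_rewire hj hN.inc_right
    have hMj : insert j (M \ E(banana c d {j})) = M := by
      rw [edgeSet_banana, insert_sdiff_singleton, insert_eq_of_mem hj]
    have hj0 : ∀ y, (∀ f ∈ M \ E(banana c d {j}), ¬ G.Inc f y) → y ≠ w → y ≠ c →
        ∀ f ∈ M, ¬ G.Inc f y := fun y hy hyw hyc ↦
      hMj ▸ not_inc_insert h.right.trd hy hyw hyc
    have h1 : G.IsMatching M := hMj ▸ hM0.insert h.right.trd (hunc w (by simp)) hc
    have h2 := h1.insert h.top.left (hj0 u (hunc u (by simp)) huw hc1.symm)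
      (hj0 v (hunc v (by simp)) hvw hc2.symm)
    exact h2.insert h.bot.trd
      (not_inc_insert h.top.left (hj0 z (hunc z (by simp)) hwz.symm hc4.symm) huz.symm hvz.symm)
      (not_inc_insert h.top.left (hj0 d hd hd3 h.right_ne.symm) hd1 hd2)
  · refine hM.isConnected.of_rewire hNV (notMem_insert_of_rewire h.bot.trd.inc_left (by simp)
      (notMem_insert_of_rewire h.top.left.inc_left (by simp) (by simp +contextual)))
      fun P hP ↦ ⟨?_, ?_⟩
    · intro l x y hl hlM
      obtain rfl : l = j := by simpa using hl.edge_mem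
      exact absurd hj hlM
    · have h1 : P u ↔ P w := hP (e := q) (by simp [h.top.right, hqM, hqk, hpq.symm])
      have h2 : P v ↔ P z := hP (e := r) (by simp [h.left.snd, hrM, hrk, hpr.symm])
      have h3 : P w ↔ P z := hP (e := s) (by simp [h.right.snd, hsM, hsk, hps.symm])
      have h4 : P v ↔ P b := hP (e := i) (by simp [h.left.trd, hiM, hik, hpi.symm])
      have hbV : b ∈ V(G) \ {u, v, w, z} := ⟨h.left.trd.right_mem, h.left_notMem⟩
      have h5 : P z ↔ P b := h2.symm.trans h4
      rintro y (rfl | rfl | rfl | rfl)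
      exacts [⟨b, hbV, h1.trans (h3.trans h5)⟩, ⟨b, hbV, h4⟩, ⟨b, hbV, h3.trans h5⟩, ⟨b, hbV, h5⟩]

/-- The path `c`, `w`, `z`, `d` replaces the new tree edge, and `v`, `u` hang on `b`; the two edges
`q` and `r` between these paths are matched. -/
lemma isCotreeMatching_of_notMem (hS : G.IsSepCycle 2 3)
    (hM : (G.rewire {u, v, w, z} (banana c d {j})).IsCotreeMatching M) (hj : j ∉ M) :
    G.IsCotreeMatching (insert q (insert r M)) := by
  have := hS.loopless
  have hNV := h.vertexSet_banana_subset
  have hN : (banana c d {j}).IsLink j c d := by simp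
  obtain ⟨hpq, hpr, hps, hpi, hpj, hpk, hqr, hqs, hqi, hqj, hqk, hrs, hri, hrj, hrk, hsi, hsj,
    hsk, hij, hik, hjk⟩ := h.edges_ne
  obtain ⟨hpM, hqM, hrM, hsM, hiM, hkM⟩ := h.notMem_of_isMatching hM.isMatching
  refine ⟨?_, ?_, h.ncard_insert_add_ncard hS hM hqM hrM hqr⟩
  · have hM0 := hM.isMatching.sdiff_of_rewire h.edgeSet_banana_subset
    have hunc := fun x hx ↦ hM.isMatching.not_inc_of_mem_rewire (x := x) hx
    have hM0' : M \ E(banana c d {j}) = M := by simpa using hj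
    rw [hM0'] at hM0 hunc
    exact (hM0.insert h.left.snd (hunc v (by simp)) (hunc z (by simp))).insert h.top.right
      (not_inc_insert h.left.snd (hunc u (by simp)) h.top.left.ne h.ne_bot)
      (not_inc_insert h.left.snd (hunc w (by simp)) h.ne.symm h.right.snd.ne)
  · refine hM.isConnected.of_rewire hNV (notMem_insert_of_rewire h.top.right.inc_left (by simp)
      (notMem_insert_of_rewire h.left.snd.inc_left (by simp) (by simp +contextual)))
      fun P hP ↦ ?_
    have h1 : P u ↔ P v := hP (e := p) (by simp [h.top.left, hpM, hpq, hpr])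
    have h2 : P w ↔ P z := hP (e := s) (by simp [h.right.snd, hsM, hqs.symm, hrs.symm])
    have h3 : P v ↔ P b := hP (e := i) (by simp [h.left.trd, hiM, hqi.symm, hri.symm])
    have h4 : P w ↔ P c := hP (e := j) (by simp [h.right.trd, hj, hqj.symm, hrj.symm])
    have h5 : P z ↔ P d := hP (e := k) (by simp [h.bot.trd, hkM, hqk.symm, hrk.symm])
    have hbV : b ∈ V(G) \ {u, v, w, z} := ⟨h.left.trd.right_mem, h.left_notMem⟩
    have hcV : c ∈ V(G) \ {u, v, w, z} := hNV (by simp)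
    have hdV : d ∈ V(G) \ {u, v, w, z} := hNV (by simp)
    refine ⟨?_, ?_⟩
    · intro l x y hl hlM
      obtain rfl : l = j := by simpa using hl.edge_mem
      exact hN.iff_of_iff (h4.symm.trans (h2.trans h5)) hl
    · rintro y (rfl | rfl | rfl | rfl)
      exacts [⟨b, hbV, h1.trans h3⟩, ⟨b, hbV, h3⟩, ⟨c, hcV, h4⟩, ⟨d, hdV, h5⟩]

lemma false_of_isMinimumCounterexample (hG : G.IsMinimumCounterexample) : False := by
  have hS := hG.isSepCycle
  have := hS.loopless
  obtain ⟨M, hM⟩ := hG.exists_isCotreeMatching (h.isSepCycle_rewire hS hG.isBridgeless)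
    (phi_rewire_lt hS.finite_vertexSet hS.finite_edgeSet h.edgeSet_banana_subset
      h.vertexSet_banana_subset (x := u) (by simp) h.top.left.left_mem)
  by_cases hj : j ∈ M
  · exact hG.not_isCotreeMatching (h.isCotreeMatching_of_mem hS hM hj)
  · exact hG.not_isCotreeMatching (h.isCotreeMatching_of_notMem hS hM hj)

end IsSquareTip

/-- A vertex of degree three on a cycle of length four has a third neighbour off the cycle. -/
lemma IsMinimumCounterexample.exists_isStarThree_of_square (hG : G.IsMinimumCounterexample)
    (hp : G.IsLink p u v) (hq : G.IsLink q v w) (hr : G.IsLink r w z) (hs : G.IsLink s z u)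
    (hvz : v ≠ z) (hu : G.degree u = 3) :
    ∃ k b, G.IsStarThree u p v s z k b ∧ b ∉ ({u, v, w, z} : Set α) := by
  have := hG.simple
  have hps : p ≠ s := by
    rintro rfl
    exact hvz (hp.right_unique hs.symm)
  obtain ⟨k, b, hst⟩ := hp.exists_isStarThree_of_ne hs.symm hps hu
  refine ⟨k, b, hst, ?_⟩
  rintro (rfl | rfl | rfl | rfl)
  · exact hst.trd.ne rfl
  · exact hst.ne₁₃ (hst.fst.eq hst.trd)
  · exact hG.false_of_triangle hp hq hst.trd.symm
  · exact hst.ne₂₃ (hst.snd.eq hst.trd)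

lemma IsMinimumCounterexample.false_of_square_of_degree_eq_two (hG : G.IsMinimumCounterexample)
    (hp : G.IsLink p u v) (hr : G.IsLink r v z) (hs : G.IsLink s z w) (hq : G.IsLink q w u)
    (huz : u ≠ z) (hvw : v ≠ w) (hu : G.degree u = 2) : False := by
  have hS := hG.isSepCycle
  have := hG.simple
  have hpq : p ≠ q := by
    rintro rfl
    exact hvw (hp.right_unique hq.symm)
  obtain ⟨q', w', hst⟩ := hp.exists_isStarTwo hu
  obtain rfl : q = q' := (hst.eq_or_eq q hq.inc_right).resolve_left hpq.symm
  obtain rfl : w = w' := hq.symm.right_unique hst.right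
  have hv := hG.degree_eq_three_of_isLink hp hu
  have hw := hG.degree_eq_three_of_isLink hq.symm hu
  -- Two vertices of degree two have no common neighbour; the same argument applies to `b` below.
  have hz : G.degree z = 3 := (hS.degree_eq hs.left_mem).resolve_left fun hz ↦
    huz (hG.eq_of_isLink_of_degree_eq_two hp hr.symm hu hz)
  obtain ⟨i, b, hv, hb⟩ := hG.exists_isStarThree_of_square hr hs hq hp huz.symm hv
  obtain ⟨j, c, hw, hc⟩ := hG.exists_isStarThree_of_square hq hp hr hs huz hw
  obtain ⟨k, d, hz, hd⟩ := hG.exists_isStarThree_of_square hs hq hp hr hvw.symm hz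
  have hdb : G.degree b = 3 := (hS.degree_eq hv.trd.right_mem).resolve_left fun hdb ↦ by
    have := hG.eq_of_isLink_of_degree_eq_two hp hv.trd.symm hu hdb
    exact hb (by simp [this])
  refine IsSquareTip.false_of_isMinimumCounterexample ⟨hst, hv.swap, hw, hz.swap, hvw, huz,
    by simp_all, by simp_all, by simp_all, ?_, ?_, hdb⟩ hG
  · rintro rfl
    exact hG.false_of_triangle hr hz.trd hv.trd.symm
  · rintro rfl
    exact hG.false_of_triangle hs.symm hz.trd hw.trd.symm

end

/-! ### Four-cycles of vertices of degree three. -/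

section


variable {α β : Type*} {G H N : Graph α β} {P Q S : α → Prop} {x y z : α}
  {u₁ u₂ u₃ u₄ a₁ a₂ a₃ a₄ : α} {e f g e₁ e₂ e₃ e₄ g₁ g₂ g₃ g₄ : β} {D M : Set β} {W : Set α}

/-- The graph with two edges: `g` from `a` to `b`, and `h` from `c` to `d`. -/
def twoEdges (g : β) (a b : α) (h : β) (c d : α) : Graph α β :=
  (banana a b {g}).rewire ∅ (banana c d {h})

lemma twoEdges_isLink (hne : g₁ ≠ g₂) : (twoEdges g₁ a₁ a₄ g₂ a₂ a₃).IsLink e x y ↔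
    (e = g₁ ∧ (x = a₁ ∧ y = a₄ ∨ x = a₄ ∧ y = a₁)) ∨
      (e = g₂ ∧ (x = a₂ ∧ y = a₃ ∨ x = a₃ ∧ y = a₂)) := by
  simp only [twoEdges, rewire_isLink, edgeSet_banana, mem_singleton_iff, banana_isLink,
    mem_empty_iff_false, not_false_eq_true, and_true]
  constructor
  · rintro (h | h)
    exacts [.inl h.2, .inr h]
  · rintro (h | h)
    exacts [.inl ⟨h.1 ▸ hne, h⟩, .inr h]

lemma vertexSet_twoEdges : V(twoEdges g₁ a₁ a₄ g₂ a₂ a₃) = {a₁, a₄, a₂, a₃} := by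
  ext y
  simp [twoEdges, rewire]
  tauto

lemma edgeSet_twoEdges (hne : g₁ ≠ g₂) : E(twoEdges g₁ a₁ a₄ g₂ a₂ a₃) = {g₁, g₂} := by
  ext e
  refine ⟨fun ⟨x, y, h⟩ ↦ ?_, ?_⟩
  · have := (twoEdges_isLink hne).1 h
    exact this.imp (·.1) (·.1)
  · rintro (rfl | rfl)
    exacts [⟨a₁, a₄, (twoEdges_isLink hne).2 (.inl ⟨rfl, .inl ⟨rfl, rfl⟩⟩)⟩,
      ⟨a₂, a₃, (twoEdges_isLink hne).2 (.inr ⟨rfl, .inl ⟨rfl, rfl⟩⟩)⟩]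

lemma twoEdges_loopless (h₁₄ : a₁ ≠ a₄) (h₂₃ : a₂ ≠ a₃) :
    (twoEdges g₁ a₁ a₄ g₂ a₂ a₃).Loopless :=
  have := banana_loopless h₁₄ {g₁}
  have := banana_loopless h₂₃ {g₂}
  Loopless.rewire ∅

lemma twoEdges_inc (hne : g₁ ≠ g₂) : (twoEdges g₁ a₁ a₄ g₂ a₂ a₃).Inc e y ↔
    (e = g₁ ∧ (y = a₁ ∨ y = a₄)) ∨ (e = g₂ ∧ (y = a₂ ∨ y = a₃)) := by
  simp only [Inc, twoEdges_isLink hne]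
  grind

/-- Degree bookkeeping for merging a spoke to `a` and a spoke to `b` into a single edge between `a`
and `b`. -/
lemma ncard_setOf_eq_and (a b y : α) (g h : β) (hab : a ≠ b) :
    {l | (l = g ∧ y = a) ∨ (l = h ∧ y = b)}.ncard = {l | l = g ∧ (y = a ∨ y = b)}.ncard := by
  by_cases ha : y = a
  · have : y ≠ b := ha ▸ hab
    simp [ha, hab]
  · by_cases hb : y = b <;> simp [ha, hb, hab.symm]

/-- A cycle `u₁`, `u₂`, `u₃`, `u₄` of length four whose vertices have degree three, with their
further neighbours `a₁`, `a₂`, `a₃`, `a₄`. -/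
structure IsSquare (G : Graph α β) (e₁ e₂ e₃ e₄ g₁ g₂ g₃ g₄ : β)
    (u₁ u₂ u₃ u₄ a₁ a₂ a₃ a₄ : α) : Prop where
  star₁ : G.IsStarThree u₁ e₄ u₄ e₁ u₂ g₁ a₁
  star₂ : G.IsStarThree u₂ e₁ u₁ e₂ u₃ g₂ a₂
  star₃ : G.IsStarThree u₃ e₂ u₂ e₃ u₄ g₃ a₃
  star₄ : G.IsStarThree u₄ e₃ u₃ e₄ u₁ g₄ a₄
  ne₁₃ : u₁ ≠ u₃
  ne₂₄ : u₂ ≠ u₄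
  notMem₁ : a₁ ∉ ({u₁, u₂, u₃, u₄} : Set α)
  notMem₂ : a₂ ∉ ({u₁, u₂, u₃, u₄} : Set α)
  notMem₃ : a₃ ∉ ({u₁, u₂, u₃, u₄} : Set α)
  notMem₄ : a₄ ∉ ({u₁, u₂, u₃, u₄} : Set α)

namespace IsSquare

variable (h : G.IsSquare e₁ e₂ e₃ e₄ g₁ g₂ g₃ g₄ u₁ u₂ u₃ u₄ a₁ a₂ a₃ a₄)
include h

lemma rotate : G.IsSquare e₂ e₃ e₄ e₁ g₂ g₃ g₄ g₁ u₂ u₃ u₄ u₁ a₂ a₃ a₄ a₁ := by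
  have hset : ({u₂, u₃, u₄, u₁} : Set α) = {u₁, u₂, u₃, u₄} := by
    ext
    simp
    tauto
  exact ⟨h.star₂, h.star₃, h.star₄, h.star₁, h.ne₂₄, h.ne₁₃.symm, hset ▸ h.notMem₂,
    hset ▸ h.notMem₃, hset ▸ h.notMem₄, hset ▸ h.notMem₁⟩

lemma vertices_ne [G.Loopless] :
    u₁ ≠ u₂ ∧ u₁ ≠ u₃ ∧ u₁ ≠ u₄ ∧ u₂ ≠ u₃ ∧ u₂ ≠ u₄ ∧ u₃ ≠ u₄ :=
  ⟨h.star₁.snd.ne, h.ne₁₃, h.star₁.fst.ne, h.star₂.snd.ne, h.ne₂₄, h.star₃.snd.ne⟩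

lemma cycle_ne [G.Loopless] : e₁ ≠ e₂ ∧ e₁ ≠ e₃ ∧ e₁ ≠ e₄ ∧ e₂ ≠ e₃ ∧ e₂ ≠ e₄ ∧ e₃ ≠ e₄ := by
  obtain ⟨h12, h13, h14, h23, h24, h34⟩ := h.vertices_ne
  exact ⟨h.star₂.ne₁₂, h.star₁.snd.ne_of_ne h.star₃.snd h13 h14, h.star₁.ne₁₂.symm, h.star₃.ne₁₂,
    h.star₂.snd.ne_of_ne h.star₄.snd h24 h12.symm, h.star₄.ne₁₂⟩

lemma ne_spoke [G.Loopless] : g₁ ≠ e₁ ∧ g₁ ≠ e₂ ∧ g₁ ≠ e₃ ∧ g₁ ≠ e₄ := by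
  obtain ⟨h12, h13, h14, h23, h24, h34⟩ := h.vertices_ne
  exact ⟨h.star₁.ne₂₃.symm, h.star₁.trd.ne_of_ne h.star₂.snd h12 h13,
    h.star₁.trd.ne_of_ne h.star₃.snd h13 h14, h.star₁.ne₁₃.symm⟩

lemma spokes_ne [G.Loopless] : g₁ ≠ g₂ ∧ g₁ ≠ g₃ ∧ g₁ ≠ g₄ ∧ g₂ ≠ g₃ ∧ g₂ ≠ g₄ ∧ g₃ ≠ g₄ := by
  obtain ⟨h12, h13, h14, h23, h24, h34⟩ := h.vertices_ne
  have n2 := h.notMem₂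
  have n3 := h.notMem₃
  have n4 := h.notMem₄
  simp only [mem_insert_iff, mem_singleton_iff, not_or] at n2 n3 n4
  exact ⟨h.star₁.trd.ne_of_ne h.star₂.trd h12 (Ne.symm n2.1),
    h.star₁.trd.ne_of_ne h.star₃.trd h13 (Ne.symm n3.1),
    h.star₁.trd.ne_of_ne h.star₄.trd h14 (Ne.symm n4.1),
    h.star₂.trd.ne_of_ne h.star₃.trd h23 (Ne.symm n3.2.1),
    h.star₂.trd.ne_of_ne h.star₄.trd h24 (Ne.symm n4.2.1),
    h.star₃.trd.ne_of_ne h.star₄.trd h34 (Ne.symm n4.2.2.1)⟩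

lemma ncard_eq [G.Loopless] : ({u₁, u₂, u₃, u₄} : Set α).ncard = 4 := by
  obtain ⟨h12, h13, h14, h23, h24, h34⟩ := h.vertices_ne
  rw [ncard_insert_of_notMem (by simp [h12, h13, h14]), ncard_insert_of_notMem (by simp [h23, h24]),
    ncard_pair h34]

lemma ncard_edges_eq [G.Loopless] : ({e₁, e₂, e₃, e₄, g₃, g₄} : Set β).ncard = 6 := by
  obtain ⟨h12, h13, h14, h23, h24, h34⟩ := h.cycle_ne
  obtain ⟨s33, s34, s31, s32⟩ := h.rotate.rotate.ne_spoke
  obtain ⟨s44, s41, s42, s43⟩ := h.rotate.rotate.rotate.ne_spoke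
  obtain ⟨-, -, -, -, -, hg⟩ := h.spokes_ne
  rw [ncard_insert_of_notMem (by simp [h12, h13, h14, s31.symm, s41.symm]),
    ncard_insert_of_notMem (by simp [h23, h24, s32.symm, s42.symm]),
    ncard_insert_of_notMem (by simp [h34, s33.symm, s43.symm]),
    ncard_insert_of_notMem (by simp [s34.symm, s44.symm]), ncard_pair hg]

lemma mem_iff (l : β) : l ∈ ({e₁, e₂, e₃, e₄, g₁, g₂, g₃, g₄} : Set β) ↔
    ∃ y ∈ ({u₁, u₂, u₃, u₄} : Set α), G.Inc l y := by
  simp only [mem_insert_iff, mem_singleton_iff, exists_eq_or_imp, exists_eq_left]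
  constructor
  · rintro (rfl | rfl | rfl | rfl | rfl | rfl | rfl | rfl)
    exacts [.inl h.star₁.snd.inc_left, .inr (.inl h.star₂.snd.inc_left),
      .inr (.inr (.inl h.star₃.snd.inc_left)), .inl h.star₁.fst.inc_left,
      .inl h.star₁.trd.inc_left, .inr (.inl h.star₂.trd.inc_left),
      .inr (.inr (.inl h.star₃.trd.inc_left)), .inr (.inr (.inr h.star₄.trd.inc_left))]
  · rintro (hl | hl | hl | hl)
    · obtain rfl | rfl | rfl := h.star₁.eq_or_eq l hl <;> simp
    · obtain rfl | rfl | rfl := h.star₂.eq_or_eq l hl <;> simp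
    · obtain rfl | rfl | rfl := h.star₃.eq_or_eq l hl <;> simp
    · obtain rfl | rfl | rfl := h.star₄.eq_or_eq l hl <;> simp

lemma isLeafless [G.Loopless] : G.IsLeafless {e₁, e₂, e₃, e₄} := by
  obtain ⟨h12, h13, h14, h23, h24, h34⟩ := h.cycle_ne
  refine ⟨?_, ⟨e₁, by simp⟩, ?_⟩
  · simp [insert_subset_iff, h.star₁.snd.edge_mem, h.star₂.snd.edge_mem, h.star₃.snd.edge_mem,
      h.star₄.snd.edge_mem]
  · rintro l (rfl | rfl | rfl | rfl) x hx
    · obtain rfl | rfl := hx.eq_or_eq_of_isLink h.star₁.snd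
      exacts [⟨e₄, by simp, h14.symm, h.star₁.fst.inc_left⟩,
        ⟨e₂, by simp, h12.symm, h.star₂.snd.inc_left⟩]
    · obtain rfl | rfl := hx.eq_or_eq_of_isLink h.star₂.snd
      exacts [⟨e₁, by simp, h12, h.star₁.snd.inc_right⟩,
        ⟨e₃, by simp, h23.symm, h.star₃.snd.inc_left⟩]
    · obtain rfl | rfl := hx.eq_or_eq_of_isLink h.star₃.snd
      exacts [⟨e₂, by simp, h23, h.star₂.snd.inc_right⟩,
        ⟨e₄, by simp, h34.symm, h.star₄.snd.inc_left⟩]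
    · obtain rfl | rfl := hx.eq_or_eq_of_isLink h.star₄.snd
      exacts [⟨e₃, by simp, h34, h.star₃.snd.inc_right⟩,
        ⟨e₁, by simp, h14, h.star₁.snd.inc_left⟩]

/-- A vertex of the square alone on its side would make its spoke a bridge. -/
lemma false_of_isSaturated [G.Loopless] (hB : G.IsBridgeless)
    (hP : (G.deleteEdges {e₁, e₂, e₃, e₄}).IsSaturated P) :
    ¬ (P u₁ ∧ ¬ P u₂ ∧ ¬ P u₃ ∧ ¬ P u₄) := by
  rintro ⟨h1, h2, h3, h4⟩
  obtain ⟨s11, s12, s13, s14⟩ := h.ne_spoke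
  refine hB.false_of_isSaturated hP h.star₁.trd (by simp [s11, s12, s13, s14]) h1 ?_ ?_
  · intro l hl
    obtain rfl | rfl | rfl := h.star₁.eq_or_eq l hl <;> simp
  · rintro l (rfl | rfl | rfl | rfl) x hx
    · obtain rfl | rfl := hx.eq_or_eq_of_isLink h.star₁.snd <;> simp [h2]
    · obtain rfl | rfl := hx.eq_or_eq_of_isLink h.star₂.snd <;> simp [h2, h3]
    · obtain rfl | rfl := hx.eq_or_eq_of_isLink h.star₃.snd <;> simp [h3, h4]
    · obtain rfl | rfl := hx.eq_or_eq_of_isLink h.star₄.snd <;> simp [h4]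

end IsSquare

/-- A square of vertices of degree three, together with a bipartition of the vertex set that is
crossed only by edges of the square, and that separates `u₁` from `u₄`, and `u₂` from `u₃`. -/
structure IsSeparatedSquare (G : Graph α β) (S : α → Prop) (e₁ e₂ e₃ e₄ g₁ g₂ g₃ g₄ : β)
    (u₁ u₂ u₃ u₄ a₁ a₂ a₃ a₄ : α) : Prop
    extends IsSquare G e₁ e₂ e₃ e₄ g₁ g₂ g₃ g₄ u₁ u₂ u₃ u₄ a₁ a₂ a₃ a₄ where
  sat : (G.deleteEdges {e₁, e₂, e₃, e₄}).IsSaturated S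
  pos : S u₁
  neg : ¬ S u₄
  iff_not : S u₂ ↔ ¬ S u₃

namespace IsSeparatedSquare

variable (h : G.IsSeparatedSquare S e₁ e₂ e₃ e₄ g₁ g₂ g₃ g₄ u₁ u₂ u₃ u₄ a₁ a₂ a₃ a₄)
include h

lemma outer [G.Loopless] : S a₁ ∧ ¬ S a₄ ∧ (S a₂ ↔ ¬ S a₃) := by
  obtain ⟨s11, s12, s13, s14⟩ := h.ne_spoke
  obtain ⟨s22, s23, s24, s21⟩ := h.rotate.ne_spoke
  obtain ⟨s33, s34, s31, s32⟩ := h.rotate.rotate.ne_spoke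
  obtain ⟨s44, s41, s42, s43⟩ := h.rotate.rotate.rotate.ne_spoke
  have h1 : S u₁ ↔ S a₁ := h.sat (e := g₁) (by simp [h.star₁.trd, s11, s12, s13, s14])
  have h2 : S u₂ ↔ S a₂ := h.sat (e := g₂) (by simp [h.star₂.trd, s22, s23, s24, s21])
  have h3 : S u₃ ↔ S a₃ := h.sat (e := g₃) (by simp [h.star₃.trd, s33, s34, s31, s32])
  have h4 : S u₄ ↔ S a₄ := h.sat (e := g₄) (by simp [h.star₄.trd, s44, s41, s42, s43])
  rw [← h1, ← h2, ← h3, ← h4]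
  exact ⟨h.pos, h.neg, h.iff_not⟩

lemma outer_ne [G.Loopless] : a₁ ≠ a₄ ∧ a₂ ≠ a₃ := by
  obtain ⟨h1, h4, h23⟩ := h.outer
  refine ⟨?_, ?_⟩
  · rintro rfl
    exact h4 h1
  · rintro rfl
    tauto

lemma isLink₁ [G.Loopless] : (twoEdges g₁ a₁ a₄ g₂ a₂ a₃).IsLink g₁ a₁ a₄ :=
  (twoEdges_isLink h.spokes_ne.1).2 (.inl ⟨rfl, .inl ⟨rfl, rfl⟩⟩)

lemma isLink₂ [G.Loopless] : (twoEdges g₁ a₁ a₄ g₂ a₂ a₃).IsLink g₂ a₂ a₃ :=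
  (twoEdges_isLink h.spokes_ne.1).2 (.inr ⟨rfl, .inl ⟨rfl, rfl⟩⟩)

lemma edgeSet_twoEdges_subset [G.Loopless] : E(twoEdges g₁ a₁ a₄ g₂ a₂ a₃) ⊆ E(G) := by
  rw [edgeSet_twoEdges h.spokes_ne.1]
  exact pair_subset h.star₁.trd.edge_mem h.star₂.trd.edge_mem

lemma edgeSet_twoEdges_subset' [G.Loopless] :
    E(twoEdges g₁ a₁ a₄ g₂ a₂ a₃) ⊆ {e₁, e₂, e₃, e₄, g₁, g₂, g₃, g₄} := by
  rw [edgeSet_twoEdges h.spokes_ne.1]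
  exact pair_subset (by simp) (by simp)

lemma vertexSet_twoEdges_subset :
    V(twoEdges g₁ a₁ a₄ g₂ a₂ a₃) ⊆ V(G) \ {u₁, u₂, u₃, u₄} := by
  rw [vertexSet_twoEdges]
  rintro y (rfl | rfl | rfl | rfl)
  exacts [⟨h.star₁.trd.right_mem, h.notMem₁⟩, ⟨h.star₄.trd.right_mem, h.notMem₄⟩,
    ⟨h.star₂.trd.right_mem, h.notMem₂⟩, ⟨h.star₃.trd.right_mem, h.notMem₃⟩]

lemma edgeSet_rewire_eq [G.Loopless] :
    E(G.rewire {u₁, u₂, u₃, u₄} (twoEdges g₁ a₁ a₄ g₂ a₂ a₃)) =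
      E(G) \ {e₁, e₂, e₃, e₄, g₃, g₄} := by
  obtain ⟨s11, s12, s13, s14⟩ := h.ne_spoke
  obtain ⟨s22, s23, s24, s21⟩ := h.rotate.ne_spoke
  obtain ⟨g12, g13, g14, g23, g24, g34⟩ := h.spokes_ne
  rw [edgeSet_rewire h.mem_iff h.edgeSet_twoEdges_subset', edgeSet_twoEdges g12]
  have h1 := h.star₁.trd.edge_mem
  have h2 := h.star₂.trd.edge_mem
  ext l
  by_cases hl1 : l = g₁
  · subst hl1
    simp [s11, s12, s13, s14, g13, g14, h1]
  by_cases hl2 : l = g₂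
  · subst hl2
    simp [s21, s22, s23, s24, g23, g24, h2]
  · simp [hl1, hl2]

/-- The spokes `g₁`, `g₄` merge into one edge and `g₂`, `g₃` into another. Counting pair by pair
allows an end of one pair to coincide with an end of the other. -/
lemma degree_rewire [G.Loopless] (hE : E(G).Finite) (hy : y ∉ ({u₁, u₂, u₃, u₄} : Set α)) :
    (G.rewire {u₁, u₂, u₃, u₄} (twoEdges g₁ a₁ a₄ g₂ a₂ a₃)).degree y = G.degree y := by
  have hd := Graph.degree_rewire (W := {u₁, u₂, u₃, u₄}) (N := twoEdges g₁ a₁ a₄ g₂ a₂ a₃) hE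
    h.edgeSet_twoEdges_subset h.mem_iff h.edgeSet_twoEdges_subset' y
  suffices (G.incidenceSet y ∩ {e₁, e₂, e₃, e₄, g₁, g₂, g₃, g₄}).ncard =
    (twoEdges g₁ a₁ a₄ g₂ a₂ a₃).degree y by omega
  obtain ⟨g12, g13, g14, g23, g24, g34⟩ := h.spokes_ne
  have hL : G.incidenceSet y ∩ {e₁, e₂, e₃, e₄, g₁, g₂, g₃, g₄} =
      {l | (l = g₁ ∧ y = a₁) ∨ (l = g₄ ∧ y = a₄)} ∪
        {l | (l = g₂ ∧ y = a₂) ∨ (l = g₃ ∧ y = a₃)} := by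
    ext l
    simp only [mem_insert_iff, mem_singleton_iff, not_or] at hy
    obtain ⟨hy1, hy2, hy3, hy4⟩ := hy
    constructor
    · rintro ⟨hl, rfl | rfl | rfl | rfl | rfl | rfl | rfl | rfl⟩
      · exact absurd (hl.eq_of_isLink_of_ne_left h.star₁.snd hy1) hy2
      · exact absurd (hl.eq_of_isLink_of_ne_left h.star₂.snd hy2) hy3
      · exact absurd (hl.eq_of_isLink_of_ne_left h.star₃.snd hy3) hy4
      · exact absurd (hl.eq_of_isLink_of_ne_left h.star₄.snd hy4) hy1
      · exact .inl (.inl ⟨rfl, hl.eq_of_isLink_of_ne_left h.star₁.trd hy1⟩)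
      · exact .inr (.inl ⟨rfl, hl.eq_of_isLink_of_ne_left h.star₂.trd hy2⟩)
      · exact .inr (.inr ⟨rfl, hl.eq_of_isLink_of_ne_left h.star₃.trd hy3⟩)
      · exact .inl (.inr ⟨rfl, hl.eq_of_isLink_of_ne_left h.star₄.trd hy4⟩)
    · rintro ((⟨rfl, rfl⟩ | ⟨rfl, rfl⟩) | (⟨rfl, rfl⟩ | ⟨rfl, rfl⟩))
      · exact ⟨h.star₁.trd.inc_right, by simp⟩
      · exact ⟨h.star₄.trd.inc_right, by simp⟩
      · exact ⟨h.star₂.trd.inc_right, by simp⟩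
      · exact ⟨h.star₃.trd.inc_right, by simp⟩
  have hR : (twoEdges g₁ a₁ a₄ g₂ a₂ a₃).incidenceSet y =
      {l | l = g₁ ∧ (y = a₁ ∨ y = a₄)} ∪ {l | l = g₂ ∧ (y = a₂ ∨ y = a₃)} := by
    ext l
    exact twoEdges_inc g12
  have hfin : ∀ (g g' : β) (a a' : α), {l | (l = g ∧ y = a) ∨ (l = g' ∧ y = a')}.Finite :=
    fun g g' a a' ↦ (toFinite {g, g'}).subset fun l hl ↦ hl.imp (·.1) (·.1)
  have hfin' : ∀ (g : β) (p : Prop), {l | l = g ∧ p}.Finite :=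
    fun g p ↦ (finite_singleton g).subset fun l hl ↦ hl.1
  rw [degree, hL, hR, ncard_union_eq _ (hfin ..) (hfin ..), ncard_union_eq _ (hfin' ..) (hfin' ..),
    ncard_setOf_eq_and _ _ _ _ _ h.outer_ne.1, ncard_setOf_eq_and _ _ _ _ _ h.outer_ne.2]
  · refine disjoint_left.2 fun l hl hl' ↦ g12 (hl.1.symm.trans hl'.1)
  · refine disjoint_left.2 ?_
    rintro l (⟨rfl, -⟩ | ⟨rfl, -⟩) (⟨h', -⟩ | ⟨h', -⟩)
    exacts [g12 h', g13 h', g24 h'.symm, g34 h'.symm]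

lemma sat_rewire [G.Loopless] (hx : x ∉ ({u₁, u₂, u₃, u₄} : Set α))
    (hy : y ∉ ({u₁, u₂, u₃, u₄} : Set α)) (he : G.IsLink e x y) : S x ↔ S y := by
  refine h.sat (e := e) ?_
  rw [deleteEdges_isLink]
  refine ⟨he, fun heD ↦ ?_⟩
  obtain ⟨z, hz, hez⟩ := (h.mem_iff e).1 (by
    obtain rfl | rfl | rfl | rfl := heD <;> simp)
  obtain rfl | rfl := hez.eq_or_eq_of_isLink he
  exacts [hx hz, hy hz]

/-- If `P` separated `a₁` from `a₂`, then the outer vertices satisfying both `P` and `S` would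
include `a₁` but none of `a₂`, `a₃`, `a₄`, so `g₁` would be a bridge of `G`. -/
lemma iff_of_isSaturated_rewire [G.Loopless] (hB : G.IsBridgeless)
    (hP : (G.rewire {u₁, u₂, u₃, u₄} (twoEdges g₁ a₁ a₄ g₂ a₂ a₃)).IsSaturated P) :
    P a₁ ↔ P a₂ := by
  have key : ∀ P : α → Prop,
      (G.rewire {u₁, u₂, u₃, u₄} (twoEdges g₁ a₁ a₄ g₂ a₂ a₃)).IsSaturated P →
        P a₁ → ¬ P a₂ → False := by
    intro P hP h1 h2
    have h14 : P a₁ ↔ P a₄ := hP (.inr h.isLink₁)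
    have h23 : P a₂ ↔ P a₃ := hP (.inr h.isLink₂)
    obtain ⟨hS1, hS4, hS23⟩ := h.outer
    obtain ⟨Q, hQ, hQP⟩ := exists_iff_of_mem_of_notMem {u₁, u₂, u₃, u₄} (fun _ ↦ False)
      (fun x ↦ P x ∧ S x)
    have hQ1 := hQ u₁ (by simp)
    have hQ2 := hQ u₂ (by simp)
    have hQ3 := hQ u₃ (by simp)
    have hQ4 := hQ u₄ (by simp)
    have hA1 := hQP a₁ h.notMem₁
    have hA2 := hQP a₂ h.notMem₂
    have hA3 := hQP a₃ h.notMem₃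
    have hA4 := hQP a₄ h.notMem₄
    have hA2' : ¬ Q a₂ := fun h' ↦ h2 (hA2.1 h').1
    have hA3' : ¬ Q a₃ := fun h' ↦ h2 (h23.2 (hA3.1 h').1)
    have hA4' : ¬ Q a₄ := fun h' ↦ hS4 (hA4.1 h').2
    have hsat := hB g₁ Q (fun l x y hl ↦ by
      rw [deleteEdges_isLink] at hl
      by_cases hlK : l ∈ ({e₁, e₂, e₃, e₄, g₁, g₂, g₃, g₄} : Set β)
      · obtain rfl | rfl | rfl | rfl | rfl | rfl | rfl | rfl := hlK
        · exact h.star₁.snd.iff_of_iff (hQ1.trans hQ2.symm) hl.1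
        · exact h.star₂.snd.iff_of_iff (hQ2.trans hQ3.symm) hl.1
        · exact h.star₃.snd.iff_of_iff (hQ3.trans hQ4.symm) hl.1
        · exact h.star₄.snd.iff_of_iff (hQ4.trans hQ1.symm) hl.1
        · exact absurd rfl hl.2
        · exact h.star₂.trd.iff_of_iff (iff_of_false hQ2.1 hA2') hl.1
        · exact h.star₃.trd.iff_of_iff (iff_of_false hQ3.1 hA3') hl.1
        · exact h.star₄.trd.iff_of_iff (iff_of_false hQ4.1 hA4') hl.1
      · have hx : x ∉ ({u₁, u₂, u₃, u₄} : Set α) := fun hx ↦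
          hlK ((h.mem_iff l).2 ⟨x, hx, hl.1.inc_left⟩)
        have hy : y ∉ ({u₁, u₂, u₃, u₄} : Set α) := fun hy ↦
          hlK ((h.mem_iff l).2 ⟨y, hy, hl.1.inc_right⟩)
        rw [hQP x hx, hQP y hy, h.sat_rewire hx hy hl.1]
        have : P x ↔ P y := hP (e := l)
          (.inl ⟨fun h' ↦ hlK (h.edgeSet_twoEdges_subset' h'), hl.1, hx, hy⟩)
        rw [this]) h.star₁.trd
    exact hQ1.1 (hsat.2 (hA1.2 ⟨h1, hS1⟩))
  refine ⟨fun h1 ↦ by_contra fun h2 ↦ key P hP h1 h2, fun h2 ↦ by_contra fun h1 ↦ ?_⟩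
  exact key _ hP.not h1 (not_not_intro h2)

/-- A cycle of the rewired graph uses both of the new edges or none of them. -/
lemma mem_and_mem_of_isCycle [G.Loopless] {C : Graph α β}
    (hC : C ≤ G.rewire {u₁, u₂, u₃, u₄} (twoEdges g₁ a₁ a₄ g₂ a₂ a₃)) (hcyc : C.IsCycle)
    (hdisj : ¬ Disjoint E(C) E(twoEdges g₁ a₁ a₄ g₂ a₂ a₃)) : g₁ ∈ E(C) ∧ g₂ ∈ E(C) := by
  obtain ⟨hS1, hS4, hS23⟩ := h.outer
  have hcross : ∀ l x y, C.IsLink l x y → ¬ (S x ↔ S y) → l = g₁ ∨ l = g₂ := by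
    intro l x y hl hxy
    obtain hl' | hl' := hC.isLink_mono hl
    · exact absurd (h.sat_rewire hl'.2.2.1 hl'.2.2.2 hl'.2.1) hxy
    · have := hl'.edge_mem
      rwa [edgeSet_twoEdges h.spokes_ne.1] at this
  have h1 : g₁ ∈ E(C) → g₂ ∈ E(C) := by
    intro hg
    have hl : C.IsLink g₁ a₁ a₄ := (hC.isLink_iff hg).2 (.inr h.isLink₁)
    obtain ⟨l, x, y, hne, hl, hx, hy⟩ := hcyc.exists_crossing_ne hl hS1 hS4
    obtain rfl := (hcross l x y hl (by tauto)).resolve_left hne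
    exact hl.edge_mem
  have h2 : g₂ ∈ E(C) → g₁ ∈ E(C) := by
    intro hg
    have hl : C.IsLink g₂ a₂ a₃ := (hC.isLink_iff hg).2 (.inr h.isLink₂)
    by_cases h2 : S a₂
    · obtain ⟨l, x, y, hne, hl, hx, hy⟩ := hcyc.exists_crossing_ne hl h2 (hS23.1 h2)
      obtain rfl := (hcross l x y hl (by tauto)).resolve_right hne
      exact hl.edge_mem
    · obtain ⟨l, x, y, hne, hl, hx, hy⟩ := hcyc.exists_crossing_ne hl.symm
        (by_contra fun h3 ↦ h2 (hS23.2 h3)) h2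
      obtain rfl := (hcross l x y hl (by tauto)).resolve_right hne
      exact hl.edge_mem
  obtain ⟨l, hl, hl'⟩ := not_disjoint_iff.1 hdisj
  rw [edgeSet_twoEdges h.spokes_ne.1] at hl'
  obtain rfl | rfl := hl'
  exacts [⟨hl, h1 hl⟩, ⟨h2 hl, hl⟩]

/-- The two new edges form an edge cut of the rewired graph. -/
lemma not_isConnected_rewire [G.Loopless] (h₁ : g₁ ∈ D) (h₂ : g₂ ∈ D) :
    ¬ ((G.rewire {u₁, u₂, u₃, u₄} (twoEdges g₁ a₁ a₄ g₂ a₂ a₃)).deleteEdges D).IsConnected := by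
  obtain ⟨hS1, hS4, -⟩ := h.outer
  have hNV := h.vertexSet_twoEdges_subset
  have hmem : ∀ a ∈ V(twoEdges g₁ a₁ a₄ g₂ a₂ a₃),
      a ∈ V(G.rewire {u₁, u₂, u₃, u₄} (twoEdges g₁ a₁ a₄ g₂ a₂ a₃)) := fun a ha ↦ .inr ha
  refine not_isConnected_of_isSaturated (P := S) (fun l x y hl ↦ ?_)
    (hmem _ h.isLink₁.left_mem) (hmem _ h.isLink₁.right_mem) hS1 hS4
  rw [deleteEdges_isLink] at hl
  obtain ⟨hl | hl, hlD⟩ := hl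
  · exact h.sat_rewire hl.2.2.1 hl.2.2.2 hl.2.1
  · have := hl.edge_mem
    rw [edgeSet_twoEdges h.spokes_ne.1] at this
    obtain rfl | rfl := this <;> contradiction

/-- Both new edges cross the bipartition `S` and no other edge does, so a cycle through one contains
the other, and deleting it removes the whole cut. -/
lemma isSepCycle_rewire (hS : G.IsSepCycle 2 3) (hB : G.IsBridgeless) :
    (G.rewire {u₁, u₂, u₃, u₄} (twoEdges g₁ a₁ a₄ g₂ a₂ a₃)).IsSepCycle 2 3 := by
  have := hS.loopless
  have hNE := h.edgeSet_twoEdges_subset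
  have hNV := h.vertexSet_twoEdges_subset
  have hE := hS.finite_edgeSet
  have := twoEdges_loopless (g₁ := g₁) (g₂ := g₂) h.outer_ne.1 h.outer_ne.2
  have ha₁ : a₁ ∈ V(G) \ {u₁, u₂, u₃, u₄} := ⟨h.star₁.trd.right_mem, h.notMem₁⟩
  refine hS.rewire hNE hNV ?_ ?_ ?_ ?_
  · refine isConnected_rewire hS.connected hNV ⟨a₁, ha₁⟩ fun P hP ↦ ?_
    obtain ⟨Q, hQ, hQP⟩ := exists_iff_of_mem_of_notMem {u₁, u₂, u₃, u₄} (fun _ ↦ P a₁) P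
    refine ⟨Q, fun l x y hl ↦ ?_, fun y hy ↦ hQP y hy.2⟩
    have h14 : P a₁ ↔ P a₄ := hP (.inr h.isLink₁)
    have h23 : P a₂ ↔ P a₃ := hP (.inr h.isLink₂)
    have h12 := h.iff_of_isSaturated_rewire hB hP
    have hQ1 := hQ u₁ (by simp)
    have hQ2 := hQ u₂ (by simp)
    have hQ3 := hQ u₃ (by simp)
    have hQ4 := hQ u₄ (by simp)
    have hA1 := hQP a₁ h.notMem₁
    have hA2 := hQP a₂ h.notMem₂
    have hA3 := hQP a₃ h.notMem₃
    have hA4 := hQP a₄ h.notMem₄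
    by_cases hlK : l ∈ ({e₁, e₂, e₃, e₄, g₁, g₂, g₃, g₄} : Set β)
    · obtain rfl | rfl | rfl | rfl | rfl | rfl | rfl | rfl := hlK
      · exact h.star₁.snd.iff_of_iff (hQ1.trans hQ2.symm) hl
      · exact h.star₂.snd.iff_of_iff (hQ2.trans hQ3.symm) hl
      · exact h.star₃.snd.iff_of_iff (hQ3.trans hQ4.symm) hl
      · exact h.star₄.snd.iff_of_iff (hQ4.trans hQ1.symm) hl
      · exact h.star₁.trd.iff_of_iff (hQ1.trans hA1.symm) hl
      · exact h.star₂.trd.iff_of_iff (hQ2.trans (h12.trans hA2.symm)) hl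
      · exact h.star₃.trd.iff_of_iff (hQ3.trans (h12.trans (h23.trans hA3.symm))) hl
      · exact h.star₄.trd.iff_of_iff (hQ4.trans (h14.trans hA4.symm)) hl
    · exact hP.iff_of_rewire h.mem_iff h.edgeSet_twoEdges_subset' hQP hlK hl
  · intro P hP
    have h1 : P u₁ ↔ P u₂ := hP e₁ _ _ h.star₁.snd (by simp)
    have h2 : P u₂ ↔ P u₃ := hP e₂ _ _ h.star₂.snd (by simp)
    have h4 : P u₄ ↔ P u₁ := hP e₄ _ _ h.star₄.snd (by simp)
    have k1 : P u₁ ↔ P a₁ := hP g₁ _ _ h.star₁.trd (by simp)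
    have k2 : P u₂ ↔ P a₂ := hP g₂ _ _ h.star₂.trd (by simp)
    have k3 : P u₃ ↔ P a₃ := hP g₃ _ _ h.star₃.trd (by simp)
    have k4 : P u₄ ↔ P a₄ := hP g₄ _ _ h.star₄.trd (by simp)
    refine ⟨fun l x y hl ↦ ?_, ?_⟩
    · have hlN := hl.edge_mem
      rw [edgeSet_twoEdges h.spokes_ne.1] at hlN
      obtain rfl | rfl := hlN
      · exact h.isLink₁.iff_of_iff (k1.symm.trans (h4.symm.trans k4)) hl
      · exact h.isLink₂.iff_of_iff (k2.symm.trans (h2.trans k3)) hl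
    · rintro y (rfl | rfl | rfl | rfl)
      exacts [⟨a₁, ha₁, k1⟩, ⟨a₁, ha₁, h1.symm.trans k1⟩,
        ⟨a₁, ha₁, h2.symm.trans (h1.symm.trans k1)⟩, ⟨a₁, ha₁, h4.trans k1⟩]
  · rintro y ⟨hy, hyW⟩
    rw [h.degree_rewire hE hyW]
    exact ⟨hS.le_degree y hy, hS.degree_le y hy⟩
  · intro C hC hcyc hdisj
    obtain ⟨h1, h2⟩ := h.mem_and_mem_of_isCycle hC hcyc hdisj
    exact h.not_isConnected_rewire h1 h2

lemma notMem_of_isMatching [G.Loopless]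
    (hM : (G.rewire {u₁, u₂, u₃, u₄} (twoEdges g₁ a₁ a₄ g₂ a₂ a₃)).IsMatching M) :
    e₁ ∉ M ∧ e₂ ∉ M ∧ e₃ ∉ M ∧ e₄ ∉ M ∧ g₃ ∉ M ∧ g₄ ∉ M := by
  have hM := hM.1
  rw [h.edgeSet_rewire_eq] at hM
  exact ⟨fun h ↦ (hM h).2 (by simp), fun h ↦ (hM h).2 (by simp), fun h ↦ (hM h).2 (by simp),
    fun h ↦ (hM h).2 (by simp), fun h ↦ (hM h).2 (by simp), fun h ↦ (hM h).2 (by simp)⟩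

lemma ncard_insert_add_ncard (hS : G.IsSepCycle 2 3)
    (hM : (G.rewire {u₁, u₂, u₃, u₄} (twoEdges g₁ a₁ a₄ g₂ a₂ a₃)).IsCotreeMatching M) {l m : β}
    (hl : l ∉ M) (hm : m ∉ M) (hlm : l ≠ m) :
    (insert l (insert m M)).ncard + V(G).ncard = E(G).ncard + 1 := by
  have := hS.loopless
  have hE := hS.finite_edgeSet
  have h1 := hM.ncard_add_ncard
  have h2 := ncard_sdiff_add_ncard_of_subset (s := {e₁, e₂, e₃, e₄, g₃, g₄}) (t := E(G)) (by
    simp [insert_subset_iff, h.star₁.snd.edge_mem, h.star₂.snd.edge_mem, h.star₃.snd.edge_mem,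
      h.star₄.snd.edge_mem, h.star₃.trd.edge_mem, h.star₄.trd.edge_mem]) hE
  have h3 := ncard_sdiff_add_ncard_of_subset (s := {u₁, u₂, u₃, u₄}) (t := V(G)) (by
    simp [insert_subset_iff, h.star₁.fst.left_mem, h.star₂.fst.left_mem, h.star₃.fst.left_mem,
      h.star₄.fst.left_mem]) hS.finite_vertexSet
  rw [h.ncard_eq] at h3
  rw [h.ncard_edges_eq] at h2
  rw [vertexSet_rewire h.vertexSet_twoEdges_subset, h.edgeSet_rewire_eq] at h1
  have hfin : M.Finite :=
    hE.subset (hM.isMatching.1.trans (edgeSet_rewire_subset h.edgeSet_twoEdges_subset))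
  rw [ncard_insert_of_notMem (by simp [hl, hlm]) (hfin.insert m),
    ncard_insert_of_notMem hm hfin]
  omega

/-- The paths `a₁`, `u₁`, `u₄`, `a₄` and `a₂`, `u₂`, `u₃`, `a₃` replace the new edges, and the other
two edges of the square are matched. -/
lemma isCotreeMatching_of_notMem (hS : G.IsSepCycle 2 3)
    (hM : (G.rewire {u₁, u₂, u₃, u₄} (twoEdges g₁ a₁ a₄ g₂ a₂ a₃)).IsCotreeMatching M)
    (h₁ : g₁ ∉ M) (h₂ : g₂ ∉ M) : G.IsCotreeMatching (insert e₁ (insert e₃ M)) := by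
  have := hS.loopless
  have hNV := h.vertexSet_twoEdges_subset
  obtain ⟨n12, n13, n14, n23, n24, n34⟩ := h.cycle_ne
  obtain ⟨v12, v13, v14, v23, v24, v34⟩ := h.vertices_ne
  obtain ⟨s11, s12, s13, s14⟩ := h.ne_spoke
  obtain ⟨s22, s23, s24, s21⟩ := h.rotate.ne_spoke
  obtain ⟨s33, s34, s31, s32⟩ := h.rotate.rotate.ne_spoke
  obtain ⟨s44, s41, s42, s43⟩ := h.rotate.rotate.rotate.ne_spoke
  obtain ⟨m1, m2, m3, m4, k3, k4⟩ := h.notMem_of_isMatching hM.isMatching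
  refine ⟨?_, ?_, h.ncard_insert_add_ncard hS hM m1 m3 n13⟩
  · have hM0 := hM.isMatching.sdiff_of_rewire h.edgeSet_twoEdges_subset
    have hunc := fun x hx ↦ hM.isMatching.not_inc_of_mem_rewire (x := x) hx
    have hM0' : M \ E(twoEdges g₁ a₁ a₄ g₂ a₂ a₃) = M := by
      rw [edgeSet_twoEdges h.spokes_ne.1]
      simp [h₁, h₂]
    rw [hM0'] at hM0 hunc
    exact (hM0.insert h.star₃.snd (hunc u₃ (by simp)) (hunc u₄ (by simp))).insert h.star₁.snd
      (not_inc_insert h.star₃.snd (hunc u₁ (by simp)) v13 v14)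
      (not_inc_insert h.star₃.snd (hunc u₂ (by simp)) v23 v24)
  · refine hM.isConnected.of_rewire hNV (notMem_insert_of_rewire h.star₁.snd.inc_left (by simp)
      (notMem_insert_of_rewire h.star₃.snd.inc_left (by simp) (by simp +contextual)))
      fun P hP ↦ ?_
    have h1 : P u₁ ↔ P a₁ := hP (e := g₁) (by simp [h.star₁.trd, h₁, s11, s13])
    have h2 : P u₂ ↔ P a₂ := hP (e := g₂) (by simp [h.star₂.trd, h₂, s21, s23])
    have h3 : P u₃ ↔ P a₃ := hP (e := g₃) (by simp [h.star₃.trd, k3, s31, s33])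
    have h4 : P u₄ ↔ P a₄ := hP (e := g₄) (by simp [h.star₄.trd, k4, s41, s43])
    have h5 : P u₂ ↔ P u₃ := hP (e := e₂) (by simp [h.star₂.snd, m2, n12.symm, n23])
    have h6 : P u₄ ↔ P u₁ := hP (e := e₄) (by simp [h.star₄.snd, m4, n14.symm, n34.symm])
    refine ⟨fun l x y hl _ ↦ ?_, ?_⟩
    · have hlN := hl.edge_mem
      rw [edgeSet_twoEdges h.spokes_ne.1] at hlN
      obtain rfl | rfl := hlN
      · exact h.isLink₁.iff_of_iff (h1.symm.trans (h6.symm.trans h4)) hl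
      · exact h.isLink₂.iff_of_iff (h2.symm.trans (h5.trans h3)) hl
    · rintro y (rfl | rfl | rfl | rfl)
      exacts [⟨a₁, ⟨h.star₁.trd.right_mem, h.notMem₁⟩, h1⟩,
        ⟨a₂, ⟨h.star₂.trd.right_mem, h.notMem₂⟩, h2⟩,
        ⟨a₃, ⟨h.star₃.trd.right_mem, h.notMem₃⟩, h3⟩, ⟨a₄, ⟨h.star₄.trd.right_mem, h.notMem₄⟩, h4⟩]

/-- The path `a₂`, `u₂`, `u₁`, `u₄`, `u₃`, `a₃` replaces the new edge `g₂`. The matched edge from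
`a₁` to `a₄` splits into the matched spokes `g₁` and `g₄`, which leave `u₂` and `u₃` free for `e₂`.
-/
lemma isCotreeMatching_of_mem_left (hS : G.IsSepCycle 2 3)
    (hM : (G.rewire {u₁, u₂, u₃, u₄} (twoEdges g₁ a₁ a₄ g₂ a₂ a₃)).IsCotreeMatching M)
    (h₁ : g₁ ∈ M) (h₂ : g₂ ∉ M) : G.IsCotreeMatching (insert g₄ (insert e₂ M)) := by
  have := hS.loopless
  have hNV := h.vertexSet_twoEdges_subset
  obtain ⟨n12, n13, n14, n23, n24, n34⟩ := h.cycle_ne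
  obtain ⟨v12, v13, v14, v23, v24, v34⟩ := h.vertices_ne
  obtain ⟨s22, s23, s24, s21⟩ := h.rotate.ne_spoke
  obtain ⟨s33, s34, s31, s32⟩ := h.rotate.rotate.ne_spoke
  obtain ⟨s44, s41, s42, s43⟩ := h.rotate.rotate.rotate.ne_spoke
  obtain ⟨g12, g13, g14, g23, g24, g34⟩ := h.spokes_ne
  obtain ⟨m1, m2, m3, m4, k3, k4⟩ := h.notMem_of_isMatching hM.isMatching
  refine ⟨?_, ?_, h.ncard_insert_add_ncard hS hM k4 m2 s42⟩
  · have hM0 := hM.isMatching.sdiff_of_rewire h.edgeSet_twoEdges_subset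
    have hunc := fun x hx ↦ hM.isMatching.not_inc_of_mem_rewire (x := x) hx
    have hu1 := hM.isMatching.not_inc_of_inc_rewire h₁ h.isLink₁.inc_left
    have hu4 := hM.isMatching.not_inc_of_inc_rewire h₁ h.isLink₁.inc_right
    have hMg : insert g₁ (M \ E(twoEdges g₁ a₁ a₄ g₂ a₂ a₃)) = M := by
      rw [edgeSet_twoEdges g12]
      ext l
      by_cases hl : l = g₁
      · simp [hl, h₁]
      · simp only [mem_insert_iff, hl, false_or, mem_sdiff, mem_singleton_iff,
          and_iff_left_iff_imp]
        rintro hlM rfl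
        exact h₂ hlM
    have hmono : ∀ y, (∀ f ∈ M \ E(twoEdges g₁ a₁ a₄ g₂ a₂ a₃), ¬ G.Inc f y) → y ≠ u₁ →
        y ≠ a₁ → ∀ f ∈ M, ¬ G.Inc f y := fun y hy hyu hya ↦
      hMg ▸ not_inc_insert h.star₁.trd hy hyu hya
    have hMm : G.IsMatching M := hMg ▸ hM0.insert h.star₁.trd (hunc u₁ (by simp)) hu1
    have n1 := h.notMem₁
    have n4 := h.notMem₄
    simp only [mem_insert_iff, mem_singleton_iff, not_or] at n1 n4
    obtain ⟨n11, n12, n13, n14⟩ := n1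
    obtain ⟨n41, n42, n43, n44⟩ := n4
    have hMe := hMm.insert h.star₂.snd
      (hmono u₂ (hunc u₂ (by simp)) v12.symm (Ne.symm n12))
      (hmono u₃ (hunc u₃ (by simp)) v13.symm (Ne.symm n13))
    exact hMe.insert h.star₄.trd
      (not_inc_insert h.star₂.snd (hmono u₄ (hunc u₄ (by simp)) v14.symm (Ne.symm n14))
        v24.symm v34.symm)
      (not_inc_insert h.star₂.snd (hmono a₄ hu4 n41 h.outer_ne.1.symm) n42 n43)
  · refine hM.isConnected.of_rewire hNV (notMem_insert_of_rewire h.star₄.trd.inc_left (by simp)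
      (notMem_insert_of_rewire h.star₂.snd.inc_left (by simp) (by simp +contextual)))
      fun P hP ↦ ?_
    have h1 : P u₁ ↔ P u₂ := hP (e := e₁) (by simp [h.star₁.snd, m1, s41.symm, n12])
    have h3 : P u₃ ↔ P u₄ := hP (e := e₃) (by simp [h.star₃.snd, m3, s43.symm, n23.symm])
    have h4 : P u₄ ↔ P u₁ := hP (e := e₄) (by simp [h.star₄.snd, m4, s44.symm, n24.symm])
    have h5 : P u₂ ↔ P a₂ := hP (e := g₂) (by simp [h.star₂.trd, h₂, g24, s22])
    have h6 : P u₃ ↔ P a₃ := hP (e := g₃) (by simp [h.star₃.trd, k3, g34, s32])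
    have ha₃ : a₃ ∈ V(G) \ {u₁, u₂, u₃, u₄} := ⟨h.star₃.trd.right_mem, h.notMem₃⟩
    refine ⟨fun l x y hl hlM ↦ ?_, ?_⟩
    · have hlN := hl.edge_mem
      rw [edgeSet_twoEdges g12] at hlN
      obtain rfl | rfl := hlN
      · exact absurd h₁ hlM
      · exact h.isLink₂.iff_of_iff
          (h5.symm.trans (h1.symm.trans (h4.symm.trans (h3.symm.trans h6)))) hl
    · have k4 := h3.symm.trans h6
      have k1 := h4.symm.trans k4
      rintro y (rfl | rfl | rfl | rfl)
      exacts [⟨a₃, ha₃, k1⟩, ⟨a₃, ha₃, h1.symm.trans k1⟩, ⟨a₃, ha₃, h6⟩, ⟨a₃, ha₃, k4⟩]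

/-- Symmetrically, the path `a₁`, `u₁`, `u₂`, `u₃`, `u₄`, `a₄` replaces the new edge `g₁`, and `g₂`,
`g₃`, `e₄` are matched. -/
lemma isCotreeMatching_of_mem_right (hS : G.IsSepCycle 2 3)
    (hM : (G.rewire {u₁, u₂, u₃, u₄} (twoEdges g₁ a₁ a₄ g₂ a₂ a₃)).IsCotreeMatching M)
    (h₁ : g₁ ∉ M) (h₂ : g₂ ∈ M) : G.IsCotreeMatching (insert g₃ (insert e₄ M)) := by
  have := hS.loopless
  have hNV := h.vertexSet_twoEdges_subset
  obtain ⟨n12, n13, n14, n23, n24, n34⟩ := h.cycle_ne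
  obtain ⟨v12, v13, v14, v23, v24, v34⟩ := h.vertices_ne
  obtain ⟨s11, s12, s13, s14⟩ := h.ne_spoke
  obtain ⟨s33, s34, s31, s32⟩ := h.rotate.rotate.ne_spoke
  obtain ⟨s44, s41, s42, s43⟩ := h.rotate.rotate.rotate.ne_spoke
  obtain ⟨g12, g13, g14, g23, g24, g34⟩ := h.spokes_ne
  obtain ⟨m1, m2, m3, m4, k3, k4⟩ := h.notMem_of_isMatching hM.isMatching
  refine ⟨?_, ?_, h.ncard_insert_add_ncard hS hM k3 m4 s34⟩
  · have hM0 := hM.isMatching.sdiff_of_rewire h.edgeSet_twoEdges_subset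
    have hunc := fun x hx ↦ hM.isMatching.not_inc_of_mem_rewire (x := x) hx
    have hu2 := hM.isMatching.not_inc_of_inc_rewire h₂ h.isLink₂.inc_left
    have hu3 := hM.isMatching.not_inc_of_inc_rewire h₂ h.isLink₂.inc_right
    have hMg : insert g₂ (M \ E(twoEdges g₁ a₁ a₄ g₂ a₂ a₃)) = M := by
      rw [edgeSet_twoEdges g12]
      ext l
      by_cases hl : l = g₂
      · simp [hl, h₂]
      · simp only [mem_insert_iff, hl, false_or, or_false, mem_sdiff, mem_singleton_iff,
          and_iff_left_iff_imp]
        rintro hlM rfl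
        exact h₁ hlM
    have hmono : ∀ y, (∀ f ∈ M \ E(twoEdges g₁ a₁ a₄ g₂ a₂ a₃), ¬ G.Inc f y) → y ≠ u₂ →
        y ≠ a₂ → ∀ f ∈ M, ¬ G.Inc f y := fun y hy hyu hya ↦
      hMg ▸ not_inc_insert h.star₂.trd hy hyu hya
    have hMm : G.IsMatching M := hMg ▸ hM0.insert h.star₂.trd (hunc u₂ (by simp)) hu2
    have n2 := h.notMem₂
    have n3 := h.notMem₃
    simp only [mem_insert_iff, mem_singleton_iff, not_or] at n2 n3
    obtain ⟨n21, n22, n23, n24⟩ := n2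
    obtain ⟨n31, n32, n33, n34⟩ := n3
    have hMe := hMm.insert h.star₄.snd
      (hmono u₄ (hunc u₄ (by simp)) v24.symm (Ne.symm n24))
      (hmono u₁ (hunc u₁ (by simp)) v12 (Ne.symm n21))
    exact hMe.insert h.star₃.trd
      (not_inc_insert h.star₄.snd (hmono u₃ (hunc u₃ (by simp)) v23.symm (Ne.symm n23))
        v34 v13.symm)
      (not_inc_insert h.star₄.snd (hmono a₃ hu3 n32 h.outer_ne.2.symm) n34 n31)
  · refine hM.isConnected.of_rewire hNV (notMem_insert_of_rewire h.star₃.trd.inc_left (by simp)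
      (notMem_insert_of_rewire h.star₄.snd.inc_left (by simp) (by simp +contextual)))
      fun P hP ↦ ?_
    have h1 : P u₁ ↔ P u₂ := hP (e := e₁) (by simp [h.star₁.snd, m1, s31.symm, n14])
    have h2 : P u₂ ↔ P u₃ := hP (e := e₂) (by simp [h.star₂.snd, m2, s32.symm, n24])
    have h3 : P u₃ ↔ P u₄ := hP (e := e₃) (by simp [h.star₃.snd, m3, s33.symm, n34])
    have h5 : P u₁ ↔ P a₁ := hP (e := g₁) (by simp [h.star₁.trd, h₁, g13, s14])
    have h6 : P u₄ ↔ P a₄ := hP (e := g₄) (by simp [h.star₄.trd, k4, g34.symm, s44])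
    have ha₄ : a₄ ∈ V(G) \ {u₁, u₂, u₃, u₄} := ⟨h.star₄.trd.right_mem, h.notMem₄⟩
    have k3 := h3.trans h6
    have k2 := h2.trans k3
    have k1 := h1.trans k2
    refine ⟨fun l x y hl hlM ↦ ?_, ?_⟩
    · have hlN := hl.edge_mem
      rw [edgeSet_twoEdges g12] at hlN
      obtain rfl | rfl := hlN
      · exact h.isLink₁.iff_of_iff (h5.symm.trans k1) hl
      · exact absurd h₂ hlM
    · rintro y (rfl | rfl | rfl | rfl)
      exacts [⟨a₄, ha₄, k1⟩, ⟨a₄, ha₄, k2⟩, ⟨a₄, ha₄, k3⟩, ⟨a₄, ha₄, h6⟩]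

lemma false_of_isMinimumCounterexample (hG : G.IsMinimumCounterexample) : False := by
  have hS := hG.isSepCycle
  have := hS.loopless
  obtain ⟨M, hM⟩ := hG.exists_isCotreeMatching (h.isSepCycle_rewire hS hG.isBridgeless)
    (phi_rewire_lt hS.finite_vertexSet hS.finite_edgeSet h.edgeSet_twoEdges_subset
      h.vertexSet_twoEdges_subset (x := u₁) (by simp) h.star₁.fst.left_mem)
  by_cases h₁ : g₁ ∈ M <;> by_cases h₂ : g₂ ∈ M
  -- The two new edges form a cut, so the tree contains at least one of them.
  · exact h.not_isConnected_rewire h₁ h₂ hM.isConnected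
  · exact hG.not_isCotreeMatching (h.isCotreeMatching_of_mem_left hS hM h₁ h₂)
  · exact hG.not_isCotreeMatching (h.isCotreeMatching_of_mem_right hS hM h₁ h₂)
  · exact hG.not_isCotreeMatching (h.isCotreeMatching_of_notMem hS hM h₁ h₂)

end IsSeparatedSquare

/-- Deleting the square separates some of its vertices, and none lies alone on its side, so the
split is two against two. Either it separates `u₁` from `u₄` and `u₂` from `u₃`, or it does so after
rotating the square by one and complementing. -/
lemma IsSquare.false_of_isMinimumCounterexample
    (h : G.IsSquare e₁ e₂ e₃ e₄ g₁ g₂ g₃ g₄ u₁ u₂ u₃ u₄ a₁ a₂ a₃ a₄)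
    (hG : G.IsMinimumCounterexample) : False := by
  have hS := hG.isSepCycle
  have := hS.loopless
  have hB := hG.isBridgeless
  obtain ⟨P, hP, hnP⟩ := hS.exists_isSaturated_deleteEdges h.isLeafless
  wlog hP1 : P u₁ generalizing P
  · exact this _ hP.not (fun h' ↦ hnP fun e x y he ↦ not_iff_not.1 (h' he)) hP1
  have r1 : ({e₂, e₃, e₄, e₁} : Set β) = {e₁, e₂, e₃, e₄} := by ext; simp; tauto
  have r2 : ({e₃, e₄, e₁, e₂} : Set β) = {e₁, e₂, e₃, e₄} := by ext; simp; tauto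
  have r3 : ({e₄, e₁, e₂, e₃} : Set β) = {e₁, e₂, e₃, e₄} := by ext; simp; tauto
  have k1 := h.false_of_isSaturated hB hP
  have k2 := h.rotate.false_of_isSaturated hB (r1 ▸ hP.not)
  have k3 := h.rotate.rotate.false_of_isSaturated hB (r2 ▸ hP.not)
  have k4 := h.rotate.rotate.rotate.false_of_isSaturated hB (r3 ▸ hP.not)
  simp only [not_not] at k2 k3 k4
  by_cases hP4 : P u₄
  · by_cases hP2 : P u₂
    · have hP3 : P u₃ := by_contra fun h3 ↦ k3 ⟨h3, hP4, hP1, hP2⟩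
      refine hnP (hP.of_deleteEdges ?_)
      rintro e (rfl | rfl | rfl | rfl) x y he
      · exact h.star₁.snd.iff_of_iff (by tauto) he
      · exact h.star₂.snd.iff_of_iff (by tauto) he
      · exact h.star₃.snd.iff_of_iff (by tauto) he
      · exact h.star₄.snd.iff_of_iff (by tauto) he
    · have hP3 : ¬ P u₃ := fun h3 ↦ k2 ⟨hP2, h3, hP4, hP1⟩
      have h' : G.IsSeparatedSquare (fun x ↦ ¬ P x) _ _ _ _ _ _ _ _ _ _ _ _ _ _ _ _ :=
        ⟨h.rotate, r1 ▸ hP.not, hP2, not_not.2 hP1, by tauto⟩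
      exact h'.false_of_isMinimumCounterexample hG
  · have h' : G.IsSeparatedSquare P _ _ _ _ _ _ _ _ _ _ _ _ _ _ _ _ :=
      ⟨h, hP, hP1, hP4, by tauto⟩
    exact h'.false_of_isMinimumCounterexample hG

lemma IsMinimumCounterexample.false_of_square (hG : G.IsMinimumCounterexample)
    (h₁ : G.IsLink e₁ u₁ u₂) (h₂ : G.IsLink e₂ u₂ u₃) (h₃ : G.IsLink e₃ u₃ u₄)
    (h₄ : G.IsLink e₄ u₄ u₁) (h₁₃ : u₁ ≠ u₃) (h₂₄ : u₂ ≠ u₄) : False := by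
  have hS := hG.isSepCycle
  obtain d₁ | d₁ := hS.degree_eq h₁.left_mem
  · exact hG.false_of_square_of_degree_eq_two h₁ h₂ h₃ h₄ h₁₃ h₂₄ d₁
  obtain d₂ | d₂ := hS.degree_eq h₂.left_mem
  · exact hG.false_of_square_of_degree_eq_two h₂ h₃ h₄ h₁ h₂₄ h₁₃.symm d₂
  obtain d₃ | d₃ := hS.degree_eq h₃.left_mem
  · exact hG.false_of_square_of_degree_eq_two h₃ h₄ h₁ h₂ h₁₃.symm h₂₄.symm d₃
  obtain d₄ | d₄ := hS.degree_eq h₄.left_mem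
  · exact hG.false_of_square_of_degree_eq_two h₄ h₁ h₂ h₃ h₂₄.symm h₁₃ d₄
  obtain ⟨g₁, a₁, s₁, n₁⟩ := hG.exists_isStarThree_of_square h₁ h₂ h₃ h₄ h₂₄ d₁
  obtain ⟨g₂, a₂, s₂, n₂⟩ := hG.exists_isStarThree_of_square h₂ h₃ h₄ h₁ h₁₃.symm d₂
  obtain ⟨g₃, a₃, s₃, n₃⟩ := hG.exists_isStarThree_of_square h₃ h₄ h₁ h₂ h₂₄.symm d₃
  obtain ⟨g₄, a₄, s₄, n₄⟩ := hG.exists_isStarThree_of_square h₄ h₁ h₂ h₃ h₁₃ d₄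
  have hsq : G.IsSquare e₁ e₂ e₃ e₄ g₁ g₂ g₃ g₄ u₁ u₂ u₃ u₄ a₁ a₂ a₃ a₄ :=
    ⟨s₁.swap, s₂.swap, s₃.swap, s₄.swap, h₁₃, h₂₄, n₁, by simp_all, by simp_all, by simp_all⟩
  exact hsq.false_of_isMinimumCounterexample hG

end

/-! ### Girth, distance, and a cycle of vertices of degree three. -/

section


variable {α β : Type*} {G : Graph α β} {x y : α}

/-- Walking two steps along the cycle in both directions from a vertex gives five distinct vertices:
a coincidence would close a triangle or a square. -/
lemma IsMinimumCounterexample.five_le_encard (hG : G.IsMinimumCounterexample) {C : Graph α β}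
    (hC : C ≤ G) (hcyc : C.IsCycle) : 5 ≤ E(C).encard := by
  have := hG.simple
  have hCs : C.Simple := Simple.anti hC
  have hlink : ∀ {e a b}, C.IsLink e a b → G.IsLink e a b := fun h ↦ h.mono hC
  by_contra hcon
  have hcard : V(C).ncard ≤ 4 := by
    have h := hcyc.ncard_eq
    rw [← hcyc.finite_edgeSet.cast_ncard_eq, ← h, not_le] at hcon
    exact Nat.le_of_lt_succ (by exact_mod_cast hcon)
  obtain ⟨x, hx⟩ := hcyc.connected.1
  obtain ⟨e, y, f, z, hxs⟩ := exists_isStarTwo (hcyc.degree_eq_two x hx)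
  obtain ⟨g, t, hys⟩ := hxs.left.symm.exists_isStarTwo
    (hcyc.degree_eq_two y hxs.left.right_mem)
  obtain ⟨h, s, hzs⟩ := hxs.right.symm.exists_isStarTwo
    (hcyc.degree_eq_two z hxs.right.right_mem)
  have hyz : y ≠ z := hxs.left_ne_right
  have hxt : x ≠ t := hys.left_ne_right
  have hxs' : x ≠ s := hzs.left_ne_right
  have htz : t ≠ z := by
    rintro rfl
    exact hG.false_of_triangle (hlink hxs.left) (hlink hys.right) (hlink hxs.right.symm)
  have hsy : s ≠ y := by
    rintro rfl
    exact hG.false_of_triangle (hlink hxs.left) (hlink hzs.right.symm) (hlink hxs.right.symm)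
  have hst : s ≠ t := by
    rintro rfl
    exact hG.false_of_square (hlink hxs.left) (hlink hys.right) (hlink hzs.right.symm)
      (hlink hxs.right.symm) hxt hyz
  classical
  have hsub : (({x, y, z, t, s} : Finset α) : Set α) ⊆ V(C) := by
    intro a ha
    simp only [Finset.coe_insert, Finset.coe_singleton] at ha
    obtain rfl | rfl | rfl | rfl | rfl := ha
    exacts [hx, hxs.left.right_mem, hxs.right.right_mem, hys.right.right_mem, hzs.right.right_mem]
  have h5 := ncard_le_ncard hsub hcyc.finite
  rw [ncard_coe_finset, Finset.card_insert_of_notMem, Finset.card_insert_of_notMem,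
    Finset.card_insert_of_notMem, Finset.card_pair hst.symm] at h5
  · omega
  · simp [htz.symm, hzs.right.ne]
  · simp [hyz, hys.right.ne, hsy.symm]
  · simp [hxs.left.ne, hxs.right.ne, hxt, hxs']

lemma IsMinimumCounterexample.three_le_dist (hG : G.IsMinimumCounterexample)
    (hx : x ∈ G.verticesOfDegree 2) (hy : y ∈ G.verticesOfDegree 2) (hxy : x ≠ y) :
    3 ≤ G.dist x y := by
  refine le_iInf₂ fun p hp ↦ ?_
  obtain ⟨-, -, hchain, hhead, hlast⟩ := hp
  match p with
  | [] => simp at hhead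
  | [a] =>
    simp only [List.head?_cons, List.getLast?_singleton, Option.some.injEq] at hhead hlast
    exact absurd (hhead.symm.trans hlast) hxy
  | [a, b] =>
    simp only [List.head?_cons, List.getLast?_cons_cons, List.getLast?_singleton,
      Option.some.injEq] at hhead hlast
    subst hhead hlast
    obtain ⟨e, he⟩ := List.isChain_pair.1 hchain
    have := hG.degree_eq_three_of_isLink he hx.2
    have := hy.2
    omega
  | [a, b, c] =>
    simp only [List.head?_cons, List.getLast?_cons_cons, List.getLast?_singleton,
      Option.some.injEq] at hhead hlast
    subst hhead hlast
    rw [List.isChain_cons_cons, List.isChain_pair] at hchain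
    obtain ⟨⟨e, he⟩, ⟨f, hf⟩⟩ := hchain
    exact absurd (hG.eq_of_isLink_of_degree_eq_two he hf.symm hx.2 hy.2) hxy
  | a :: b :: c :: d :: l =>
    have : 3 ≤ (a :: b :: c :: d :: l).length - 1 := by simp
    exact_mod_cast this

/-- If deleting the vertices of degree two left no cycle, then one edge at each of them would
form the matching of a decomposition. -/
lemma IsMinimumCounterexample.exists_isCycle_subset (hG : G.IsMinimumCounterexample) :
    ∃ C : Graph α β, C ≤ G ∧ C.IsCycle ∧ V(C) ⊆ G.verticesOfDegree 3 := by
  have hS := hG.isSepCycle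
  have hloop := hS.loopless
  have hH := hG.deleteVerts_isConnected
  set U := G.verticesOfDegree 2 with hU
  have hUV : U ⊆ V(G) := fun x hx ↦ hx.1
  have hUfin : U.Finite := hS.finite_vertexSet.subset hUV
  have hle : G.deleteVerts U ≤ G := deleteVerts_le
  have : (G.deleteVerts U).Loopless := Loopless.anti hle
  have hVH : (V(G.deleteVerts U)).ncard + U.ncard = V(G).ncard := by
    rw [vertexSet_deleteVerts]
    exact ncard_sdiff_add_ncard_of_subset hUV hS.finite_vertexSet
  by_contra hcon
  -- All vertices of `G - V_2` have degree three in `G`, so by assumption this graph has no cycle.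
  have hlt : E(G.deleteVerts U).ncard < V(G.deleteVerts U).ncard := by
    by_contra! hge
    obtain ⟨C, hC, hcyc⟩ := exists_isCycle_of_ncard_le
      (hS.finite_vertexSet.subset hle.vertexSet_mono)
      (hS.finite_edgeSet.subset hle.edgeSet_mono) hH.1 hge
    refine hcon ⟨C, hC.trans hle, hcyc, fun x hx ↦ ?_⟩
    have hx' := hC.vertexSet_mono hx
    rw [vertexSet_deleteVerts] at hx'
    exact ⟨hx'.1, (hS.degree_eq hx'.1).resolve_left fun h ↦ hx'.2 ⟨hx'.1, h⟩⟩
  obtain ⟨x₀, hx₀⟩ := hS.connected.1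
  obtain ⟨e₀, -⟩ : (G.incidenceSet x₀).Nonempty := nonempty_of_ncard_ne_zero fun h ↦ by
    have := hS.le_degree x₀ hx₀
    rw [degree] at this
    omega
  have : Nonempty α := ⟨x₀⟩
  have : Nonempty β := ⟨e₀⟩
  -- At each `u` of degree two, `m u` is to be matched, while `f u` attaches `u` to `G - V_2` as a
  -- leaf of the tree.
  choose! m v f w hst using fun u (hu : u ∈ U) ↦ exists_isStarTwo hu.2
  have hend : ∀ {e u a y}, u ∈ U → G.IsLink e u a → y ∈ U → G.Inc e y → y = u := by
    intro e u a y hu he hy hey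
    refine (hey.eq_or_eq_of_isLink he).resolve_right ?_
    rintro rfl
    have := hG.degree_eq_three_of_isLink he hu.2
    have := hy.2
    omega
  have hminj : InjOn m U := fun u hu y hy h ↦
    hend hy (hst y hy).left hu (h ▸ (hst u hu).left.inc_left)
  have hM : G.IsMatching (m '' U) := by
    refine ⟨image_subset_iff.2 fun u hu ↦ (hst u hu).left.edge_mem, ?_⟩
    rintro _ ⟨u, hu, rfl⟩ _ ⟨y, hy, rfl⟩ x hux hyx
    have hu' := (hst u hu).left
    have hy' := (hst y hy).left
    obtain rfl | rfl := hux.eq_or_eq_of_isLink hu'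
    · rw [hend hy hy' hu hyx]
    · obtain rfl | hx := hyx.eq_or_eq_of_isLink hy'
      · rw [hend hu hu' hy hux]
      -- Two chosen edges meeting in a vertex of degree three would give two vertices of degree two
      -- with a common neighbour.
      · rw [hG.eq_of_isLink_of_degree_eq_two hu' (hx ▸ hy') hu.2 hy.2]
  have hconn : (G.deleteEdges (m '' U)).IsConnected := by
    refine isConnected_of_isSaturated hS.connected.1 fun P hP x hx y hy ↦ ?_
    have hPH : (G.deleteVerts U).IsSaturated P := by
      intro e a b he
      rw [deleteVerts_isLink] at he
      refine hP (e := e) ?_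
      rw [deleteEdges_isLink]
      refine ⟨he.1, ?_⟩
      rintro ⟨u, hu, rfl⟩
      obtain rfl | rfl := (hst u hu).left.inc_left.eq_or_eq_of_isLink he.1
      exacts [he.2.1 hu, he.2.2 hu]
    have key : ∀ x ∈ V(G), ∃ y ∈ V(G.deleteVerts U), P x ↔ P y := by
      intro x hx
      by_cases hxU : x ∈ U
      · have hr := (hst x hxU).right
        refine ⟨w x, ?_, hP (e := f x) ?_⟩
        · rw [vertexSet_deleteVerts]
          exact ⟨hr.right_mem, fun h ↦
            hr.ne (hend hxU hr h hr.inc_right).symm⟩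
        · rw [deleteEdges_isLink]
          refine ⟨hr, ?_⟩
          rintro ⟨u, hu, h⟩
          obtain rfl := hend hxU hr hu (h ▸ (hst u hu).left.inc_left)
          exact (hst u hu).ne h
      · exact ⟨x, by rw [vertexSet_deleteVerts]; exact ⟨hx, hxU⟩, Iff.rfl⟩
    obtain ⟨x', hx', hxx'⟩ := key x hx
    obtain ⟨y', hy', hyy'⟩ := key y hy
    rw [hxx', hyy']
    exact (hH.iff_of_isSaturated hPH hx' hy').1
  have hE : E(G) ⊆ E(G.deleteVerts U) ∪ (m '' U ∪ f '' U) := by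
    intro e he
    obtain ⟨a, b, hab⟩ := exists_isLink_of_mem_edgeSet he
    by_cases ha : a ∈ U
    · obtain rfl | rfl := (hst a ha).eq_or_eq e hab.inc_left
      exacts [.inr (.inl ⟨a, ha, rfl⟩), .inr (.inr ⟨a, ha, rfl⟩)]
    by_cases hb : b ∈ U
    · obtain rfl | rfl := (hst b hb).eq_or_eq e hab.inc_right
      exacts [.inr (.inl ⟨b, hb, rfl⟩), .inr (.inr ⟨b, hb, rfl⟩)]
    have : (G.deleteVerts U).IsLink e a b := by
      rw [deleteVerts_isLink]
      exact ⟨hab, ha, hb⟩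
    exact .inl this.edge_mem
  have hMU : (m '' U).ncard = U.ncard := hminj.ncard_image
  refine hG.not_isCotreeMatching (M := m '' U) ⟨hM, hconn, le_antisymm ?_ ?_⟩
  · have h1 := hconn.ncard_add_ncard_le (D := ∅) hS.finite_vertexSet
      (hS.finite_edgeSet.subset deleteEdges_le.edgeSet_mono) (singleton_nonempty x₀)
      (singleton_subset_iff.2 hx₀) (empty_subset _) (by simp)
    rw [edgeSet_deleteEdges, vertexSet_deleteEdges, ncard_singleton, ncard_empty] at h1
    have h2 := ncard_sdiff_add_ncard_of_subset hM.1 hS.finite_edgeSet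
    omega
  -- At most `2 * U.ncard` edges meet `U`, and at most one fewer than the number of vertices of `G -
  -- V_2` do not. The opposite bound above came from connectivity.
  · have h1 := ncard_le_ncard hE (((hS.finite_edgeSet.subset hle.edgeSet_mono)).union
      ((hUfin.image m).union (hUfin.image f)))
    have h2 := ncard_union_le E(G.deleteVerts U) (m '' U ∪ f '' U)
    have h3 := ncard_union_le (m '' U) (f '' U)
    have h4 := ncard_image_le (f := f) hUfin
    omega

end

end Graph

theorem theorem1p4 {α : Type*} {β : Type*} (G : Graph α β)
    (hG : G.IsMinimumCounterexample) :
    (G.Simple ∧ G.IsEdgeConnected 2) ∧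
    5 ≤ G.girth ∧
    (∀ x ∈ G.verticesOfDegree 2, ∀ y ∈ G.verticesOfDegree 2, x ≠ y → 3 ≤ G.dist x y) ∧
    (G.deleteVerts (G.verticesOfDegree 2)).IsConnected ∧
    ∃ C : Graph α β, C ≤ G ∧ C.IsCycle ∧ C.vertexSet ⊆ G.verticesOfDegree 3 := by
  exact ⟨⟨hG.simple, hG.isEdgeConnected_two⟩,
    le_iInf₂ fun C hC ↦ hG.five_le_encard hC.1 hC.2,
    fun x hx y hy hxy ↦ hG.three_le_dist hx hy hxy,
    hG.deleteVerts_isConnected, hG.exists_isCycle_subset⟩
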